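/- Let $(X,d)$ be a compact metric space of diameter at most $2$, let $\mu$ be a $\sigma$-finite Borel measure on $X$ of full support, and let $\Gamma$ be a countable discrete group with a proper length function $\ell$. Let $\Gamma$ act freely on $X$ by Lipschitz maps, and suppose that the action is non-singular, i.e. it preserves the measure class of $\mu$. Let $\mathcal O X=X\times[1,\infty)$ be the open cone, with the metric $d_{\mathcal O}((x,t),(y,s))=\min(t,s)\,d(x,y)+|t-s|$, and let $\mathcal O_\Gamma X$ be the unified warped cone, i.e. the same set with the largest metric $\delta_\Gamma$ such that $\delta_\Gamma\le d_{\mathcal O}$ and $\delta_\Gamma(p,\gamma p)\le\ell(\gamma)$ for all $p\in\mathcal OX$, $\gamma\in\Gamma$, where $\gamma(x,t)=(\gamma x,t)$. Put $H=L^2(X\times[1,\infty),\mu\times\lambda)$ with $\lambda$ Lebesgue measure. The algebras $C_0(\mathcal OX)=C_0(\mathcal O_\Gamma X)$ and, more generally, bounded Borel functions act on $H$ by multiplication operators $M_f$; $\chi_A=M_{\mathbb 1_A}$. Let $\mathcal K$ denote the compact operators on $H$. For a metric $\delta\in\{d_{\mathcal O},\delta_\Gamma\}$, an operator $T\in B(H)$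 has propagation at most $r$ if $M_fTM_g=0$ for all $f,g\in C_0$ with $\delta(\operatorname{supp}f,\operatorname{supp}g)>r$; it is locally compact if $M_fT$ and $TM_f$ are compact for all $f\in C_c$. The Roe $*$-algebras $\mathbb C_{\mathrm{Roe}}^*[\mathcal OX]$ and $\mathbb C_{\mathrm{Roe}}^*[\mathcal O_\Gamma X]$ consist of the locally compact operators of finite propagation (for $d_{\mathcal O}$, respectively $\delta_\Gamma$), and the Roe algebras $C^*_{\mathrm{Roe}}(\mathcal OX)$ and $C^*_{\mathrm{Roe}}(\mathcal O_\Gamma X)$ are their norm closures. Let $\pi\colon\Gamma\to U(H)$ be the Koopman representation, $\pi(\gamma)\xi(p)=\big(\tfrac{d\gamma_*(\mu\times\lambda)}{d(\mu\times\lambda)}(p)\big)^{1/2}\xi(\gamma^{-1}p)$. Conjugation by $\pi(\gamma)$ defines actions of $\Gamma$ on $\mathbb C_{\mathrm{Roe}}^*[\mathcal OX]$, on $C^*_{\mathrm{Roe}}(\mathcal OX)$, and on their quotients by the ideals of compact operators. For an action of $\Gamma$ on a $*$-algebra $A$, let $A\rtimes_{\mathrm{alg}}\Gamma$ be the algebraic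 crossed product, whose elements are finite formal sums $\sum(a_\gamma,\gamma)$ with $(a,\gamma)(a',\gamma')=(a\,\gamma(a'),\gamma\gamma')$ and $(a,\gamma)^*=(\gamma^{-1}(a^*),\gamma^{-1})$, and let $\Psi$ be the $*$-homomorphism determined by $\Psi(T,\gamma)=T\pi(\gamma)$. Assume that $(\mathcal OX,d_{\mathcal O})$ has bounded geometry: there is $\varrho>0$ such that for every $R>0$ there is $N\in\mathbb N$ such that every ball of radius $R$ is contained in a union of $N$ balls of radius $\varrho$. Assume also that $H$ has the operator norm localization property over $(\mathcal OX,d_{\mathcal O})$: there is $0<c\le1$ such that for every $r>0$ there is $R$ such that for every $T\in B(H)$ of propagation at most $r$ there is a measurable $A\subseteq\mathcal OX$ of diameter at most $R$ with $\|\chi_AT\|\ge c\|T\|$. Then: 1. $\Psi$ is a surjective $*$-homomorphism $\mathbb C_{\mathrm{Roe}}^*[\mathcal OX]\rtimes_{\mathrm{alg}}\Gamma\to\mathbb C_{\mathrm{Roe}}^*[\mathcal O_\Gamma X]$, and it descends to a $*$-isomorphism $$\frac{\mathbb C_{\mathrm{Roe}}^*[\mathcal OX]}{\mathcal K\cap\mathbb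 C_{\mathrm{Roe}}^*[\mathcal OX]}\rtimes_{\mathrm{alg}}\Gamma\;\cong\;\frac{\mathbb C_{\mathrm{Roe}}^*[\mathcal O_\Gamma X]}{\mathcal K\cap\mathbb C_{\mathrm{Roe}}^*[\mathcal O_\Gamma X]}.$$ 2. $\mathcal K$ is contained in $C^*_{\mathrm{Roe}}(\mathcal OX)$ and in $C^*_{\mathrm{Roe}}(\mathcal O_\Gamma X)$. The map $\Psi$ takes $C^*_{\mathrm{Roe}}(\mathcal OX)\rtimes_{\mathrm{alg}}\Gamma$ into $C^*_{\mathrm{Roe}}(\mathcal O_\Gamma X)$ and descends to an injective $*$-homomorphism with dense image $$\frac{C^*_{\mathrm{Roe}}(\mathcal OX)}{\mathcal K}\rtimes_{\mathrm{alg}}\Gamma\;\to\;\frac{C^*_{\mathrm{Roe}}(\mathcal O_\Gamma X)}{\mathcal K},$$ whose target is complete in the quotient norm, so that it may be viewed as a completion of the source. -/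

import Mathlib

open MeasureTheory Filter Topology
open scoped ENNReal NNReal ZeroAtInfty CompactlySupported

noncomputable section

/-! ## Quotients of `*`-algebras by two-sided `*`-ideals -/

/-- A two-sided `*`-ideal of a (not necessarily unital) complex `*`-algebra. -/
structure StarIdeal (A : Type*) [NonUnitalRing A] [StarRing A] [Module ℂ A] extends
    Submodule ℂ A where
  mul_mem_left' : ∀ (a : A) {b : A}, b ∈ carrier → a * b ∈ carrier
  mul_mem_right' : ∀ {a : A} (b : A), a ∈ carrier → a * b ∈ carrier
  star_mem' : ∀ {a : A}, a ∈ carrier → star a ∈ carrier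

namespace StarIdeal

section Algebra

variable {A : Type*} [NonUnitalRing A] [StarRing A] [Module ℂ A]

/-- The quotient of a `*`-algebra by a two-sided `*`-ideal. -/
def Quot (I : StarIdeal A) : Type _ := A ⧸ I.toSubmodule

variable (I : StarIdeal A)

instance : AddCommGroup I.Quot := inferInstanceAs (AddCommGroup (A ⧸ I.toSubmodule))
instance : Module ℂ I.Quot := inferInstanceAs (Module ℂ (A ⧸ I.toSubmodule))

/-- The class of an element in the quotient. -/
def cls (a : A) : I.Quot := Submodule.Quotient.mk a

theorem cls_eq_iff {a b : A} : I.cls a = I.cls b ↔ a - b ∈ I.toSubmodule :=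
  Submodule.Quotient.eq _

theorem cls_surjective : Function.Surjective I.cls := Submodule.Quotient.mk_surjective _

theorem cls_add (a b : A) : I.cls (a + b) = I.cls a + I.cls b := rfl
theorem cls_zero : I.cls 0 = 0 := rfl
theorem cls_smul (c : ℂ) (a : A) : I.cls (c • a) = c • I.cls a := rfl

instance : Mul I.Quot where
  mul := Quotient.map₂ (· * ·) (by
    intro a a' ha b b' hb
    have ha' := (Submodule.quotientRel_def _).1 ha
    have hb' := (Submodule.quotientRel_def _).1 hb
    refine (Submodule.quotientRel_def _).2 ?_
    have : a * b - a' * b' = a * (b - b') + (a - a') * b' := by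
      rw [mul_sub, sub_mul]; abel
    change a * b - a' * b' ∈ I.toSubmodule
    rw [this]
    exact I.toSubmodule.add_mem (I.mul_mem_left' _ hb') (I.mul_mem_right' _ ha'))

theorem cls_mul (a b : A) : I.cls (a * b) = I.cls a * I.cls b := rfl

instance : Star I.Quot where
  star := Quotient.map star (by
    intro a a' ha
    have ha' := (Submodule.quotientRel_def _).1 ha
    refine (Submodule.quotientRel_def _).2 ?_
    rw [← star_sub]
    exact I.star_mem' ha')

theorem cls_star (a : A) : I.cls (star a) = star (I.cls a) := rfl

instance : NonUnitalRing I.Quot where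
  left_distrib := by
    intro x y z
    obtain ⟨a, rfl⟩ := I.cls_surjective x
    obtain ⟨b, rfl⟩ := I.cls_surjective y
    obtain ⟨c, rfl⟩ := I.cls_surjective z
    exact congrArg I.cls (mul_add a b c)
  right_distrib := by
    intro x y z
    obtain ⟨a, rfl⟩ := I.cls_surjective x
    obtain ⟨b, rfl⟩ := I.cls_surjective y
    obtain ⟨c, rfl⟩ := I.cls_surjective z
    exact congrArg I.cls (add_mul a b c)
  zero_mul := by
    intro x
    obtain ⟨a, rfl⟩ := I.cls_surjective x
    exact congrArg I.cls (zero_mul a)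
  mul_zero := by
    intro x
    obtain ⟨a, rfl⟩ := I.cls_surjective x
    exact congrArg I.cls (mul_zero a)
  mul_assoc := by
    intro x y z
    obtain ⟨a, rfl⟩ := I.cls_surjective x
    obtain ⟨b, rfl⟩ := I.cls_surjective y
    obtain ⟨c, rfl⟩ := I.cls_surjective z
    exact congrArg I.cls (mul_assoc a b c)

instance : StarRing I.Quot where
  star_involutive := by
    intro x
    obtain ⟨a, rfl⟩ := I.cls_surjective x
    exact congrArg I.cls (star_star a)
  star_mul := by
    intro x y
    obtain ⟨a, rfl⟩ := I.cls_surjective x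
    obtain ⟨b, rfl⟩ := I.cls_surjective y
    exact congrArg I.cls (star_mul a b)
  star_add := by
    intro x y
    obtain ⟨a, rfl⟩ := I.cls_surjective x
    obtain ⟨b, rfl⟩ := I.cls_surjective y
    exact congrArg I.cls (star_add a b)

instance [StarModule ℂ A] : StarModule ℂ I.Quot where
  star_smul := by
    intro c x
    obtain ⟨a, rfl⟩ := I.cls_surjective x
    exact congrArg I.cls (star_smul c a)

instance [IsScalarTower ℂ A A] : IsScalarTower ℂ I.Quot I.Quot where
  smul_assoc := by
    intro c x y
    obtain ⟨a, rfl⟩ := I.cls_surjective x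
    obtain ⟨b, rfl⟩ := I.cls_surjective y
    exact congrArg I.cls (smul_assoc c a b)

instance [SMulCommClass ℂ A A] : SMulCommClass ℂ I.Quot I.Quot where
  smul_comm := by
    intro c x y
    obtain ⟨a, rfl⟩ := I.cls_surjective x
    obtain ⟨b, rfl⟩ := I.cls_surjective y
    exact congrArg I.cls (smul_comm c a b)

/-- An automorphism that maps the ideal onto itself descends to the quotient. -/
def quotEquiv (f : A ≃⋆ₐ[ℂ] A) (h : ∀ a ∈ I.toSubmodule, f a ∈ I.toSubmodule)
    (h' : ∀ a ∈ I.toSubmodule, f.symm a ∈ I.toSubmodule) : I.Quot ≃⋆ₐ[ℂ] I.Quot where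
  toFun := Quotient.map f (by
    intro a b hab
    refine (Submodule.quotientRel_def _).2 ?_
    rw [← map_sub]
    exact h _ ((Submodule.quotientRel_def _).1 hab))
  invFun := Quotient.map f.symm (by
    intro a b hab
    refine (Submodule.quotientRel_def _).2 ?_
    rw [← map_sub]
    exact h' _ ((Submodule.quotientRel_def _).1 hab))
  left_inv := by
    intro x
    obtain ⟨a, rfl⟩ := I.cls_surjective x
    exact congrArg I.cls (f.symm_apply_apply a)
  right_inv := by
    intro x
    obtain ⟨a, rfl⟩ := I.cls_surjective x
    exact congrArg I.cls (f.apply_symm_apply a)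
  map_mul' := by
    intro x y
    obtain ⟨a, rfl⟩ := I.cls_surjective x
    obtain ⟨b, rfl⟩ := I.cls_surjective y
    exact congrArg I.cls (map_mul f a b)
  map_add' := by
    intro x y
    obtain ⟨a, rfl⟩ := I.cls_surjective x
    obtain ⟨b, rfl⟩ := I.cls_surjective y
    exact congrArg I.cls (map_add f a b)
  map_star' := by
    intro x
    obtain ⟨a, rfl⟩ := I.cls_surjective x
    exact congrArg I.cls (map_star f a)
  map_smul' := by
    intro c x
    obtain ⟨a, rfl⟩ := I.cls_surjective x
    exact congrArg I.cls (map_smul f c a)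

/-- The action induced on the quotient by an invariant ideal. -/
def quotAction {G : Type*} [Group G] (α : G →* (A ≃⋆ₐ[ℂ] A))
    (h : ∀ g, ∀ a ∈ I.toSubmodule, α g a ∈ I.toSubmodule) : G →* (I.Quot ≃⋆ₐ[ℂ] I.Quot) where
  toFun g := I.quotEquiv (α g) (h g) (by
    intro a ha
    have := h g⁻¹ a ha
    rwa [map_inv, StarAlgEquiv.aut_inv] at this)
  map_one' := by
    ext x
    obtain ⟨a, rfl⟩ := I.cls_surjective x
    exact congrArg I.cls (by rw [map_one]; rfl)
  map_mul' := by
    intro g k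
    ext x
    obtain ⟨a, rfl⟩ := I.cls_surjective x
    exact congrArg I.cls (by rw [map_mul]; rfl)

theorem quotAction_cls {G : Type*} [Group G] (α : G →* (A ≃⋆ₐ[ℂ] A))
    (h : ∀ g, ∀ a ∈ I.toSubmodule, α g a ∈ I.toSubmodule) (g : G) (a : A) :
    I.quotAction α h g (I.cls a) = I.cls (α g a) := rfl

end Algebra

section Norm

variable {B : Type*} [NonUnitalNormedRing B] [StarRing B] [NormedSpace ℂ B]
  {A : NonUnitalStarSubalgebra ℂ B} (I : StarIdeal A)

/-- The quotient (semi)norm `‖a + I‖ = inf {‖a + i‖ | i ∈ I}`. -/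
instance : SeminormedAddCommGroup I.Quot :=
  inferInstanceAs (SeminormedAddCommGroup (A ⧸ I.toSubmodule))

end Norm

end StarIdeal

/-! ## Algebraic crossed products -/

/-- The algebraic crossed product `A ⋊_alg G` of a `*`-algebra by an action of a group by
`*`-automorphisms: finite formal sums `∑ (a_g, g)`. -/
structure AlgCrossedProduct {A G : Type*} [NonUnitalRing A] [StarRing A] [Module ℂ A] [Group G]
    (α : G →* (A ≃⋆ₐ[ℂ] A)) where
  /-- the coefficients of the formal sum -/
  coeff : G →₀ A

namespace AlgCrossedProduct

variable {A G : Type*} [NonUnitalRing A] [StarRing A] [Module ℂ A] [Group G]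
  {α : G →* (A ≃⋆ₐ[ℂ] A)}

theorem coeff_injective : Function.Injective (coeff : AlgCrossedProduct α → G →₀ A) := by
  rintro ⟨x⟩ ⟨y⟩ h
  exact congrArg _ h

instance : Zero (AlgCrossedProduct α) := ⟨⟨0⟩⟩
instance : Add (AlgCrossedProduct α) := ⟨fun x y => ⟨x.coeff + y.coeff⟩⟩
instance : Neg (AlgCrossedProduct α) := ⟨fun x => ⟨-x.coeff⟩⟩
instance : Sub (AlgCrossedProduct α) := ⟨fun x y => ⟨x.coeff - y.coeff⟩⟩
instance {S : Type*} [SMulZeroClass S A] : SMul S (AlgCrossedProduct α) :=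
  ⟨fun c x => ⟨c • x.coeff⟩⟩

instance : AddCommGroup (AlgCrossedProduct α) :=
  coeff_injective.addCommGroup coeff rfl (fun _ _ => rfl) (fun _ => rfl) (fun _ _ => rfl)
    (fun _ _ => rfl) (fun _ _ => rfl)

/-- `coeff` as an additive map. -/
def coeffHom : AlgCrossedProduct α →+ (G →₀ A) where
  toFun := coeff
  map_zero' := rfl
  map_add' _ _ := rfl

instance : Module ℂ (AlgCrossedProduct α) :=
  coeff_injective.module ℂ coeffHom (fun _ _ => rfl)

variable (α) in
/-- The formal sum `(a, g)` with one term. -/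
def single (g : G) (a : A) : AlgCrossedProduct α := ⟨Finsupp.single g a⟩

theorem single_zero (g : G) : single α g 0 = 0 := congrArg mk (Finsupp.single_zero g)

theorem single_add (g : G) (a b : A) : single α g (a + b) = single α g a + single α g b :=
  congrArg mk (Finsupp.single_add g a b)

theorem smul_single (c : ℂ) (g : G) (a : A) : c • single α g a = single α g (c • a) :=
  congrArg mk (Finsupp.smul_single c g a)

variable (α) in
/-- `single` as an additive map. -/
def singleHom (g : G) : A →+ AlgCrossedProduct α where
  toFun := single α g
  map_zero' := single_zero g
  map_add' := single_add g

/-- Extension of a family of additive maps, one for each coefficient. -/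
def liftAdd {M : Type*} [AddCommGroup M] (f : G → A →+ M) : AlgCrossedProduct α →+ M :=
  (Finsupp.liftAddHom f).comp coeffHom

theorem liftAdd_single {M : Type*} [AddCommGroup M] (f : G → A →+ M) (g : G) (a : A) :
    liftAdd f (single α g a) = f g a := by
  change Finsupp.liftAddHom f (Finsupp.single g a) = _
  simp

@[elab_as_elim]
theorem induction {p : AlgCrossedProduct α → Prop} (x : AlgCrossedProduct α) (zero : p 0)
    (add : ∀ x y, p x → p y → p (x + y)) (single : ∀ g a, p (single α g a)) : p x := by
  obtain ⟨f⟩ := x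
  induction f using Finsupp.induction_linear with
  | zero => exact zero
  | add f g hf hg => exact add ⟨f⟩ ⟨g⟩ hf hg
  | single g a => exact single g a

/-- Multiplication as a biadditive map, determined by `(a, g) (b, k) = (a α_g(b), g k)`. -/
def mulHom : AlgCrossedProduct α →+ AlgCrossedProduct α →+ AlgCrossedProduct α :=
  liftAdd fun g =>
    { toFun := fun a => liftAdd fun k =>
        (singleHom α (g * k)).comp
          ((AddMonoidHom.mulLeft a).comp ((α g : A ≃⋆ₐ[ℂ] A) : A →+ A))
      map_zero' := by
        ext x
        induction x using induction with
        | zero => simp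
        | add x y hx hy => rw [map_add, map_add, hx, hy]
        | single k b => simp [liftAdd_single]
      map_add' := by
        intro a a'
        ext x
        induction x using induction with
        | zero => simp
        | add x y hx hy => rw [map_add, map_add, hx, hy]
        | single k b => simp [liftAdd_single, add_mul, map_add] }

instance : Mul (AlgCrossedProduct α) := ⟨fun x y => mulHom x y⟩

theorem mul_def (x y : AlgCrossedProduct α) : x * y = mulHom x y := rfl

theorem single_mul_single (g k : G) (a b : A) :
    single α g a * single α k b = single α (g * k) (a * α g b) := by
  rw [mul_def, mulHom, liftAdd_single]
  exact liftAdd_single _ _ _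

theorem add_mul' (x y z : AlgCrossedProduct α) : (x + y) * z = x * z + y * z := by
  simp only [mul_def, map_add, AddMonoidHom.add_apply]

theorem mul_add' (x y z : AlgCrossedProduct α) : x * (y + z) = x * y + x * z := by
  simp only [mul_def, map_add]

theorem zero_mul' (x : AlgCrossedProduct α) : 0 * x = 0 := by simp [mul_def]

theorem mul_zero' (x : AlgCrossedProduct α) : x * 0 = 0 := by simp [mul_def]

instance : NonUnitalRing (AlgCrossedProduct α) where
  left_distrib := mul_add'
  right_distrib := add_mul'
  zero_mul := zero_mul'
  mul_zero := mul_zero'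
  mul_assoc := by
    intro x y z
    induction x using induction with
    | zero => simp only [zero_mul']
    | add x x' hx hx' => simp only [add_mul', hx, hx']
    | single g a =>
      induction y using induction with
      | zero => simp only [zero_mul', mul_zero']
      | add x x' hx hx' => simp only [add_mul', mul_add', hx, hx']
      | single k b =>
        induction z using induction with
        | zero => simp only [mul_zero']
        | add x x' hx hx' => simp only [mul_add', hx, hx']
        | single l c =>
          simp only [single_mul_single, map_mul, StarAlgEquiv.mul_apply, mul_assoc]

/-- The involution as an additive map, determined by `(a, g)* = (α_{g⁻¹}(a*), g⁻¹)`. -/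
def starHom : AlgCrossedProduct α →+ AlgCrossedProduct α :=
  liftAdd fun g => (singleHom α g⁻¹).comp
    (((α g⁻¹ : A ≃⋆ₐ[ℂ] A) : A →+ A).comp (starAddEquiv : A ≃+ A).toAddMonoidHom)

instance : Star (AlgCrossedProduct α) := ⟨fun x => starHom x⟩

theorem star_def (x : AlgCrossedProduct α) : star x = starHom x := rfl

theorem star_single (g : G) (a : A) :
    star (single α g a) = single α g⁻¹ (α g⁻¹ (star a)) := by
  rw [star_def, starHom, liftAdd_single]
  rfl

theorem star_add' (x y : AlgCrossedProduct α) : star (x + y) = star x + star y := by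
  simp only [star_def, map_add]

theorem star_zero' : star (0 : AlgCrossedProduct α) = 0 := by simp [star_def]

instance : StarRing (AlgCrossedProduct α) where
  star_involutive := by
    intro x
    induction x using induction with
    | zero => simp only [star_zero']
    | add x y hx hy => rw [star_add', star_add', hx, hy]
    | single g a =>
      rw [star_single, star_single, inv_inv, ← map_star, star_star, ← StarAlgEquiv.mul_apply,
        ← map_mul, mul_inv_cancel, map_one, StarAlgEquiv.one_apply]
  star_add := star_add'
  star_mul := by
    intro x y
    induction x using induction with
    | zero => simp only [star_zero', zero_mul', mul_zero']
    | add x y hx hy => simp only [add_mul', mul_add', star_add', hx, hy]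
    | single g a =>
      induction y using induction with
      | zero => simp only [star_zero', zero_mul', mul_zero']
      | add x y hx hy => simp only [add_mul', mul_add', star_add', hx, hy]
      | single k b =>
        simp only [single_mul_single, star_single, mul_inv_rev, star_mul, map_mul,
          StarAlgEquiv.mul_apply, ← map_star]
        rw [← StarAlgEquiv.mul_apply (α g⁻¹) (α g), ← map_mul α, inv_mul_cancel, map_one,
          StarAlgEquiv.one_apply]

instance [StarModule ℂ A] : StarModule ℂ (AlgCrossedProduct α) where
  star_smul := by
    intro c x
    induction x using induction with
    | zero => simp only [star_zero', smul_zero]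
    | add x y hx hy => simp only [smul_add, star_add', hx, hy]
    | single g a => simp only [smul_single, star_single, star_smul, map_smul]

instance [IsScalarTower ℂ A A] : IsScalarTower ℂ (AlgCrossedProduct α) (AlgCrossedProduct α) where
  smul_assoc := by
    intro c x y
    simp only [smul_eq_mul]
    induction x using induction with
    | zero => simp only [smul_zero, zero_mul']
    | add x y hx hy => simp only [smul_add, add_mul', hx, hy]
    | single g a =>
      induction y using induction with
      | zero => simp only [smul_zero, mul_zero']
      | add x y hx hy => simp only [smul_add, mul_add', hx, hy]
      | single k b => simp only [smul_single, single_mul_single, smul_mul_assoc]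

instance [SMulCommClass ℂ A A] :
    SMulCommClass ℂ (AlgCrossedProduct α) (AlgCrossedProduct α) where
  smul_comm := by
    intro c x y
    simp only [smul_eq_mul]
    induction x using induction with
    | zero => simp only [smul_zero, zero_mul']
    | add x y hx hy => simp only [smul_add, add_mul', hx, hy]
    | single g a =>
      induction y using induction with
      | zero => simp only [smul_zero, mul_zero']
      | add x y hx hy => simp only [smul_add, mul_add', hx, hy]
      | single k b => simp only [smul_single, single_mul_single, map_smul, mul_smul_comm]

/-- The map `A ⋊_alg G → (A / I) ⋊_alg G` that applies the quotient map to every coefficient. -/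
def toQuot (I : StarIdeal A) (h : ∀ g, ∀ a ∈ I.toSubmodule, α g a ∈ I.toSubmodule)
    (x : AlgCrossedProduct α) : AlgCrossedProduct (I.quotAction α h) :=
  ⟨x.coeff.mapRange I.cls I.cls_zero⟩

end AlgCrossedProduct

/-! ## Algebras of operators normalized by a unitary representation -/

section Operators

variable {H G : Type*} [NormedAddCommGroup H] [InnerProductSpace ℂ H] [CompleteSpace H] [Group G]

theorem isCompactOperator_star {T : H →L[ℂ] H} (hT : IsCompactOperator T) :
    IsCompactOperator (star T : H →L[ℂ] H) := by
  have h2 : IsCompactOperator (T * star T : H →L[ℂ] H) := hT.comp_clm (star T)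
  have htb : TotallyBounded ((T * star T : H →L[ℂ] H) '' Metric.closedBall 0 1) :=
    (h2.isCompact_closure_image_closedBall (f := ((T * star T : H →L[ℂ] H) : H →ₗ[ℂ] H))
      1).totallyBounded.subset subset_closure
  rw [show ((star T : H →L[ℂ] H) : H → H) = (((star T : H →L[ℂ] H) : H →ₗ[ℂ] H) : H → H) from rfl,
    isCompactOperator_iff_isCompact_closure_image_closedBall _ (zero_lt_one (α := ℝ))]
  refine TotallyBounded.isCompact_of_isClosed (TotallyBounded.closure ?_) isClosed_closure
  rw [Metric.totallyBounded_iff]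
  intro ε hε
  obtain ⟨t, hts, htf, htc⟩ := Metric.finite_approx_of_totallyBounded htb (ε ^ 2 / 4) (by positivity)
  have hex : ∀ y : t, ∃ x ∈ Metric.closedBall (0 : H) 1, (T * star T : H →L[ℂ] H) x = y :=
    fun y => hts y.2
  choose p hp hpy using hex
  have : Finite t := htf
  refine ⟨Set.range fun y : t => (star T : H →L[ℂ] H) (p y), Set.finite_range _, ?_⟩
  rintro _ ⟨x, hx, rfl⟩
  have hxm := htc (Set.mem_image_of_mem _ hx)
  simp only [Set.mem_iUnion] at hxm
  obtain ⟨y, hy, hxy⟩ := hxm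
  simp only [Set.mem_iUnion]
  refine ⟨_, ⟨⟨y, hy⟩, rfl⟩, ?_⟩
  rw [Metric.mem_ball, dist_eq_norm] at hxy ⊢
  rw [show y = (T * star T : H →L[ℂ] H) (p ⟨y, hy⟩) from (hpy ⟨y, hy⟩).symm, ← map_sub] at hxy
  change ‖(star T : H →L[ℂ] H) x - (star T : H →L[ℂ] H) (p ⟨y, hy⟩)‖ < ε
  rw [← map_sub]
  set z := x - p ⟨y, hy⟩ with hz
  have hzn : ‖z‖ ≤ 2 := by
    have h1 : ‖x‖ ≤ 1 := by simpa using hx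
    have h2 : ‖p ⟨y, hy⟩‖ ≤ 1 := by simpa using hp ⟨y, hy⟩
    exact (norm_sub_le _ _).trans (by linarith)
  have key : ‖(star T : H →L[ℂ] H) z‖ ^ 2 ≤ ‖(T * star T : H →L[ℂ] H) z‖ * ‖z‖ := by
    have h3 : inner ℂ ((star T : H →L[ℂ] H) z) ((star T : H →L[ℂ] H) z)
        = inner ℂ ((T * star T : H →L[ℂ] H) z) z := by
      rw [ContinuousLinearMap.star_eq_adjoint, ContinuousLinearMap.adjoint_inner_right]
      rfl
    rw [← inner_self_eq_norm_sq (𝕜 := ℂ), h3]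
    exact (RCLike.re_le_norm _).trans (norm_inner_le_norm _ _)
  have : ‖(star T : H →L[ℂ] H) z‖ ^ 2 < ε ^ 2 := by
    have := mul_le_mul hxy.le hzn (norm_nonneg _) (by positivity)
    nlinarith [sq_pos_of_pos hε]
  exact lt_of_pow_lt_pow_left₀ 2 hε.le this

variable (A : NonUnitalStarSubalgebra ℂ (H →L[ℂ] H)) (U : G →* unitary (H →L[ℂ] H))

/-- The two-sided `*`-ideal `A ∩ 𝒦(H)` of a `*`-algebra `A` of operators on `H`. -/
def compactIdeal : StarIdeal A where
  carrier := {T | IsCompactOperator (T : H →L[ℂ] H)}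
  add_mem' := fun ha hb => IsCompactOperator.add ha hb
  zero_mem' := isCompactOperator_zero
  smul_mem' := fun c _ ha => IsCompactOperator.smul ha c
  mul_mem_left' := fun a _ hb => IsCompactOperator.clm_comp hb (a : H →L[ℂ] H)
  mul_mem_right' := fun b ha => IsCompactOperator.comp_clm ha (b : H →L[ℂ] H)
  star_mem' := fun ha => isCompactOperator_star ha

/-- The unitary representation `U` normalizes `A`. -/
def Normalizes : Prop :=
  ∀ g : G, ∀ T ∈ A, (U g : H →L[ℂ] H) * T * star (U g : H →L[ℂ] H) ∈ A

variable {A U}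

/-- `U` normalizes the norm closure of an algebra that it normalizes. -/
theorem Normalizes.topologicalClosure (h : Normalizes A U) :
    Normalizes A.topologicalClosure U := by
  intro g T hT
  have hc : Continuous fun T : H →L[ℂ] H =>
      (U g : H →L[ℂ] H) * T * star (U g : H →L[ℂ] H) := by fun_prop
  exact map_mem_closure
    (f := fun T : H →L[ℂ] H => (U g : H →L[ℂ] H) * T * star (U g : H →L[ℂ] H)) hc hT (h g)

/-- The action of `G` on `A` by conjugation, `γ · T = U(γ) T U(γ)*`. -/
def conjAction (h : Normalizes A U) : G →* (A ≃⋆ₐ[ℂ] A) where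
  toFun g :=
    { toFun := fun T => ⟨(U g : H →L[ℂ] H) * T * star (U g : H →L[ℂ] H), h g T T.2⟩
      invFun := fun T => ⟨(U g⁻¹ : H →L[ℂ] H) * T * star (U g⁻¹ : H →L[ℂ] H), h g⁻¹ T T.2⟩
      left_inv := by
        intro T
        ext1
        change (U g⁻¹ : H →L[ℂ] H) * ((U g : H →L[ℂ] H) * T * star (U g : H →L[ℂ] H)) *
          star (U g⁻¹ : H →L[ℂ] H) = T
        have e1 : (U g⁻¹ : H →L[ℂ] H) * (U g : H →L[ℂ] H) = 1 := by
          rw [← Submonoid.coe_mul, ← map_mul]; simp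
        have e2 : star (U g : H →L[ℂ] H) * star (U g⁻¹ : H →L[ℂ] H) = 1 := by
          rw [← star_mul, e1, star_one]
        rw [mul_assoc, mul_assoc, mul_assoc, e2, ← mul_assoc, e1, one_mul, mul_one]
      right_inv := by
        intro T
        ext1
        change (U g : H →L[ℂ] H) * ((U g⁻¹ : H →L[ℂ] H) * T * star (U g⁻¹ : H →L[ℂ] H)) *
          star (U g : H →L[ℂ] H) = T
        have e1 : (U g : H →L[ℂ] H) * (U g⁻¹ : H →L[ℂ] H) = 1 := by
          rw [← Submonoid.coe_mul, ← map_mul]; simp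
        have e2 : star (U g⁻¹ : H →L[ℂ] H) * star (U g : H →L[ℂ] H) = 1 := by
          rw [← star_mul, e1, star_one]
        rw [mul_assoc, mul_assoc, mul_assoc, e2, ← mul_assoc, e1, one_mul, mul_one]
      map_mul' := by
        intro S T
        ext1
        change (U g : H →L[ℂ] H) * (S * T) * star (U g : H →L[ℂ] H) =
          ((U g : H →L[ℂ] H) * S * star (U g : H →L[ℂ] H)) *
            ((U g : H →L[ℂ] H) * T * star (U g : H →L[ℂ] H))
        have e : star (U g : H →L[ℂ] H) * (U g : H →L[ℂ] H) = 1 :=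
          Unitary.coe_star_mul_self (U g)
        simp only [mul_assoc]
        rw [← mul_assoc (star (U g : H →L[ℂ] H)) (U g : H →L[ℂ] H), e, one_mul]
      map_add' := by
        intro S T
        ext1
        change (U g : H →L[ℂ] H) * (S + T) * star (U g : H →L[ℂ] H) =
          (U g : H →L[ℂ] H) * S * star (U g : H →L[ℂ] H) +
            (U g : H →L[ℂ] H) * T * star (U g : H →L[ℂ] H)
        rw [mul_add, add_mul]
      map_star' := by
        intro T
        ext1
        change (U g : H →L[ℂ] H) * star (T : H →L[ℂ] H) * star (U g : H →L[ℂ] H) =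
          star ((U g : H →L[ℂ] H) * T * star (U g : H →L[ℂ] H))
        rw [star_mul, star_mul, star_star, mul_assoc]
      map_smul' := by
        intro c T
        ext1
        change (U g : H →L[ℂ] H) * (c • (T : H →L[ℂ] H)) * star (U g : H →L[ℂ] H) =
          c • ((U g : H →L[ℂ] H) * T * star (U g : H →L[ℂ] H))
        rw [mul_smul_comm, smul_mul_assoc] }
  map_one' := by
    ext T : 2
    change (U 1 : H →L[ℂ] H) * T * star (U 1 : H →L[ℂ] H) = T
    simp
  map_mul' := by
    intro g k
    ext T : 2
    change (U (g * k) : H →L[ℂ] H) * T * star (U (g * k) : H →L[ℂ] H) =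
      (U g : H →L[ℂ] H) * ((U k : H →L[ℂ] H) * T * star (U k : H →L[ℂ] H)) *
        star (U g : H →L[ℂ] H)
    rw [map_mul, Submonoid.coe_mul, star_mul]
    simp only [mul_assoc]

theorem coe_conjAction (h : Normalizes A U) (g : G) (T : A) :
    (conjAction h g T : H →L[ℂ] H) = (U g : H →L[ℂ] H) * T * star (U g : H →L[ℂ] H) := rfl

theorem compactIdeal_invariant (h : Normalizes A U) (g : G) (T : A)
    (hT : T ∈ (compactIdeal A).toSubmodule) :
    conjAction h g T ∈ (compactIdeal A).toSubmodule :=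
  IsCompactOperator.comp_clm (IsCompactOperator.clm_comp hT (U g : H →L[ℂ] H))
    (star (U g : H →L[ℂ] H))

/-- The action of `G` on `A / (A ∩ 𝒦(H))` induced by conjugation. -/
abbrev conjQuotAction (h : Normalizes A U) :
    G →* ((compactIdeal A).Quot ≃⋆ₐ[ℂ] (compactIdeal A).Quot) :=
  (compactIdeal A).quotAction (conjAction h) (compactIdeal_invariant h)

/-- The map `A ⋊_alg G → (A / (A ∩ 𝒦(H))) ⋊_alg G` that applies the quotient map to every
coefficient. -/
abbrev crossedToQuot (h : Normalizes A U) (x : AlgCrossedProduct (conjAction h)) :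
    AlgCrossedProduct (conjQuotAction h) :=
  x.toQuot (compactIdeal A) (compactIdeal_invariant h)

/-- The additive map `A ⋊_alg G → B(H)`, `(T, γ) ↦ T U(γ)`. -/
def crossedRepAdd (h : Normalizes A U) : AlgCrossedProduct (conjAction h) →+ (H →L[ℂ] H) :=
  AlgCrossedProduct.liftAdd fun g =>
    { toFun := fun T => (T : H →L[ℂ] H) * (U g : H →L[ℂ] H)
      map_zero' := zero_mul _
      map_add' := fun _ _ => add_mul _ _ _ }

theorem crossedRepAdd_single (h : Normalizes A U) (g : G) (T : A) :
    crossedRepAdd h (AlgCrossedProduct.single _ g T) = (T : H →L[ℂ] H) * (U g : H →L[ℂ] H) :=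
  AlgCrossedProduct.liftAdd_single _ _ _

/-- The `*`-homomorphism `A ⋊_alg G → B(H)`, `(T, γ) ↦ T U(γ)`. -/
def crossedRep (h : Normalizes A U) : AlgCrossedProduct (conjAction h) →⋆ₙₐ[ℂ] (H →L[ℂ] H) where
  toFun := crossedRepAdd h
  map_zero' := map_zero (crossedRepAdd h)
  map_add' := map_add (crossedRepAdd h)
  map_smul' := by
    intro c x
    induction x using AlgCrossedProduct.induction with
    | zero => simp
    | add x y hx hy => rw [smul_add, map_add, map_add, hx, hy, smul_add]
    | single g T =>
      rw [AlgCrossedProduct.smul_single, crossedRepAdd_single,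
        crossedRepAdd_single]
      exact smul_mul_assoc c (T : H →L[ℂ] H) (U g : H →L[ℂ] H)
  map_mul' := by
    intro x y
    induction x using AlgCrossedProduct.induction with
    | zero => simp
    | add x x' hx hx' => rw [add_mul, map_add, map_add, hx, hx', add_mul]
    | single g S =>
      induction y using AlgCrossedProduct.induction with
      | zero => simp
      | add x x' hx hx' => rw [mul_add, map_add, map_add, hx, hx', mul_add]
      | single k T =>
        rw [AlgCrossedProduct.single_mul_single, crossedRepAdd_single,
          crossedRepAdd_single, crossedRepAdd_single]
        change ((S : H →L[ℂ] H) * ((U g : H →L[ℂ] H) * T * star (U g : H →L[ℂ] H))) *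
          (U (g * k) : H →L[ℂ] H) =
            ((S : H →L[ℂ] H) * (U g : H →L[ℂ] H)) * ((T : H →L[ℂ] H) * (U k : H →L[ℂ] H))
        have e : star (U g : H →L[ℂ] H) * (U g : H →L[ℂ] H) = 1 :=
          Unitary.coe_star_mul_self (U g)
        rw [map_mul, Submonoid.coe_mul]
        simp only [mul_assoc]
        rw [← mul_assoc (star (U g : H →L[ℂ] H)) (U g : H →L[ℂ] H), e, one_mul]
  map_star' := by
    intro x
    induction x using AlgCrossedProduct.induction with
    | zero => simp
    | add x x' hx hx' => rw [star_add, map_add, map_add, hx, hx', star_add]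
    | single g T =>
      rw [AlgCrossedProduct.star_single, crossedRepAdd_single,
        crossedRepAdd_single]
      change ((U g⁻¹ : H →L[ℂ] H) * star (T : H →L[ℂ] H) * star (U g⁻¹ : H →L[ℂ] H)) *
        (U g⁻¹ : H →L[ℂ] H) = star ((T : H →L[ℂ] H) * (U g : H →L[ℂ] H))
      have e : star (U g⁻¹ : H →L[ℂ] H) * (U g⁻¹ : H →L[ℂ] H) = 1 :=
        Unitary.coe_star_mul_self (U g⁻¹)
      have e' : (U g⁻¹ : H →L[ℂ] H) = star (U g : H →L[ℂ] H) := by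
        rw [map_inv]; rfl
      rw [mul_assoc, e, mul_one, star_mul, e']

theorem crossedRep_single (h : Normalizes A U) (g : G) (T : A) :
    crossedRep h (AlgCrossedProduct.single _ g T) = (T : H →L[ℂ] H) * (U g : H →L[ℂ] H) :=
  crossedRepAdd_single h g T

end Operators

/-! ## Metrics compatible with a topology -/

/-- A metric on `Y` that induces the given topology of `Y`. -/
structure CompatibleMetric (Y : Type*) [TopologicalSpace Y] where
  /-- the distance function -/
  dist : Y → Y → ℝ
  dist_self : ∀ x, dist x x = 0
  dist_comm : ∀ x y, dist x y = dist y x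
  dist_triangle : ∀ x y z, dist x z ≤ dist x y + dist y z
  eq_of_dist_eq_zero : ∀ {x y}, dist x y = 0 → x = y
  hasBasis_nhds : ∀ x, (𝓝 x).HasBasis (fun ε : ℝ => 0 < ε) (fun ε => {y | dist y x < ε})

namespace CompatibleMetric

variable {Y : Type*} [TopologicalSpace Y] (D : CompatibleMetric Y)

theorem dist_nonneg (x y : Y) : 0 ≤ D.dist x y := by
  have h1 := D.dist_triangle x y x
  rw [D.dist_self, D.dist_comm y x] at h1
  linarith

/-- The same data as a term of Mathlib's `MetricSpace`, with the given topology. -/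
@[reducible]
def toMetricSpace : MetricSpace Y :=
  let m : PseudoMetricSpace Y :=
    { dist := D.dist
      dist_self := D.dist_self
      dist_comm := D.dist_comm
      dist_triangle := D.dist_triangle }
  have h : (inferInstance : TopologicalSpace Y) = m.toUniformSpace.toTopologicalSpace := by
    refine TopologicalSpace.ext_nhds fun x => ?_
    refine (D.hasBasis_nhds x).ext (@Metric.nhds_basis_ball Y m x) ?_ ?_
    · intro ε hε
      exact ⟨ε, hε, fun y hy => hy⟩
    · intro ε hε
      exact ⟨ε, hε, fun y hy => hy⟩
  { m.replaceTopology h with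
    eq_of_dist_eq_zero := fun {x y} hxy => D.eq_of_dist_eq_zero hxy }

/-- Distance between two subsets, with value `∞` if one of them is empty. -/
def setDist (A B : Set Y) : ℝ≥0∞ := ⨅ x ∈ A, ⨅ y ∈ B, ENNReal.ofReal (D.dist x y)

theorem setDist_comm (A B : Set Y) : D.setDist A B = D.setDist B A := by
  unfold setDist
  rw [iInf₂_comm]
  simp only [D.dist_comm]

theorem lt_setDist_iff {r : ℝ} (hr : 0 ≤ r) {A B : Set Y} :
    ENNReal.ofReal r < D.setDist A B ↔
      ∃ r' > r, ∀ x ∈ A, ∀ y ∈ B, r' ≤ D.dist x y := by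
  constructor
  · intro h
    obtain ⟨s, hs1, hs2⟩ := ENNReal.lt_iff_exists_nnreal_btwn.1 h
    refine ⟨s, ?_, fun x hx y hy => ?_⟩
    · have := (ENNReal.ofReal_lt_iff_lt_toReal hr ENNReal.coe_ne_top).1 hs1
      simpa using this
    · have h1 : (s : ℝ≥0∞) ≤ ENNReal.ofReal (D.dist x y) :=
        hs2.le.trans ((iInf₂_le x hx).trans (iInf₂_le y hy))
      have := ENNReal.le_ofReal_iff_toReal_le ENNReal.coe_ne_top (D.dist_nonneg x y) |>.1 h1
      simpa using this
  · rintro ⟨r', hr', h⟩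
    refine lt_of_lt_of_le ((ENNReal.ofReal_lt_ofReal_iff (hr.trans_lt hr')).2 hr') ?_
    exact le_iInf₂ fun x hx => le_iInf₂ fun y hy => ENNReal.ofReal_le_ofReal (h x hx y hy)

/-- Bounded geometry: there is a gauge `ϱ > 0` such that for every `R > 0` there is `N` such that
every ball of radius `R` is contained in a union of `N` balls of radius `ϱ`. -/
def BoundedGeometry : Prop :=
  ∃ ϱ > 0, ∀ R > 0, ∃ N : ℕ, ∀ x : Y, ∃ Z : Finset Y, Z.card ≤ N ∧
    {y | D.dist y x < R} ⊆ ⋃ z ∈ Z, {y | D.dist y z < ϱ}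

/-- The group `G` acts by Lipschitz maps. -/
def LipschitzAction (G : Type*) [Group G] [MulAction G Y] : Prop :=
  ∀ g : G, ∃ L : ℝ, ∀ x y : Y, D.dist (g • x) (g • y) ≤ L * D.dist x y

end CompatibleMetric

/-! ## Operators on `L²(Y, ν)` -/

section Module

variable {Y : Type*} [MeasurableSpace Y] (ν : Measure Y)

/-- The Hilbert space `L²(Y, ν)`. -/
abbrev L2 : Type _ := Lp ℂ 2 ν

/-- The algebra `B(L²(Y, ν))`. -/
abbrev BL2 : Type _ := L2 ν →L[ℂ] L2 ν

/-- The representation of `L^∞(Y, ν)` on `L²(Y, ν)` by multiplication operators. -/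
def mulOp (f : Lp ℂ ∞ ν) : BL2 ν :=
  (ContinuousLinearMap.mul ℂ ℂ).holderL ν ∞ 2 2 f

/-- The multiplication operator of an essentially bounded function. -/
def fnOp {f : Y → ℂ} (hf : MemLp f ∞ ν) : BL2 ν := mulOp ν hf.toLp

variable {ν}

theorem fnOp_ae {f : Y → ℂ} (hf : MemLp f ∞ ν) (ξ : L2 ν) :
    fnOp ν hf ξ =ᵐ[ν] fun y => f y * ξ y := by
  have h1 : fnOp ν hf ξ =ᵐ[ν] fun y => (hf.toLp f : Y → ℂ) y * ξ y :=
    (ContinuousLinearMap.mul ℂ ℂ).coeFn_holder (r := 2) hf.toLp ξ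
  filter_upwards [h1, hf.coeFn_toLp] with y h1 h2
  rw [h1, h2]

theorem fnOp_mul {f g : Y → ℂ} (hf : MemLp f ∞ ν) (hg : MemLp g ∞ ν)
    (hfg : MemLp (fun y => f y * g y) ∞ ν) : fnOp ν hf * fnOp ν hg = fnOp ν hfg := by
  ext ξ
  filter_upwards [fnOp_ae hf (fnOp ν hg ξ), fnOp_ae hg ξ, fnOp_ae hfg ξ] with y h1 h2 h3
  rw [mul_apply_eq_comp, h1, h2, h3, mul_assoc]

theorem fnOp_add {f g : Y → ℂ} (hf : MemLp f ∞ ν) (hg : MemLp g ∞ ν)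
    (hfg : MemLp (fun y => f y + g y) ∞ ν) : fnOp ν hf + fnOp ν hg = fnOp ν hfg := by
  ext ξ
  filter_upwards [fnOp_ae hf ξ, fnOp_ae hg ξ, fnOp_ae hfg ξ,
    Lp.coeFn_add (fnOp ν hf ξ) (fnOp ν hg ξ)] with y h1 h2 h3 h4
  rw [add_apply, h4, Pi.add_apply, h1, h2, h3, add_mul]

theorem fnOp_congr {f g : Y → ℂ} (hf : MemLp f ∞ ν) (hg : MemLp g ∞ ν) (h : f = g) :
    fnOp ν hf = fnOp ν hg := by subst h; rfl

theorem fnOp_one (h : MemLp (fun _ : Y => (1 : ℂ)) ∞ ν) : fnOp ν h = 1 := by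
  ext ξ
  filter_upwards [fnOp_ae h ξ] with y h1
  rw [h1, one_mul, one_apply_eq_self]

theorem fnOp_zero {f : Y → ℂ} (h : MemLp f ∞ ν) (h0 : ∀ y, f y = 0) : fnOp ν h = 0 := by
  ext ξ
  filter_upwards [fnOp_ae h ξ, Lp.coeFn_zero ℂ 2 ν] with y h1 h2
  rw [h1, h0, zero_mul, zero_apply, h2, Pi.zero_apply]

theorem star_fnOp {f : Y → ℂ} (hf : MemLp f ∞ ν) (hf' : MemLp (fun y => star (f y)) ∞ ν) :
    star (fnOp ν hf) = fnOp ν hf' := by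
  rw [ContinuousLinearMap.star_eq_adjoint, eq_comm, ContinuousLinearMap.eq_adjoint_iff]
  intro ξ η
  rw [L2.inner_def, L2.inner_def]
  refine integral_congr_ae ?_
  filter_upwards [fnOp_ae hf' ξ, fnOp_ae hf η] with y h1 h2
  rw [h1, h2]
  simp only [RCLike.inner_apply, map_mul, RCLike.star_def, RCLike.conj_conj]
  ring

variable (ν)

/-- The projection `χ_A` of a measurable set `A`. -/
def indOp {A : Set Y} (hA : MeasurableSet A) : BL2 ν :=
  fnOp ν (f := A.indicator fun _ => (1 : ℂ))
    (memLp_top_of_bound ((measurable_const.indicator hA).aestronglyMeasurable) 1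
      (Eventually.of_forall fun y => by
        by_cases h : y ∈ A <;> simp [h]))

variable [TopologicalSpace Y] [BorelSpace Y]

theorem memLp_top_of_continuous {f : Y → ℂ} (hf : Continuous f) {C : ℝ} (hC : ∀ y, ‖f y‖ ≤ C) :
    MemLp f ∞ ν :=
  memLp_top_of_bound hf.aestronglyMeasurable C (Eventually.of_forall hC)

theorem memLp_top_C0 (f : C₀(Y, ℂ)) : MemLp f ∞ ν := by
  obtain ⟨C, hC⟩ := isBounded_iff_forall_norm_le.1 f.isBounded_range
  exact memLp_top_of_continuous ν f.continuous fun y => hC _ ⟨y, rfl⟩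

theorem memLp_top_Cc (f : C_c(Y, ℂ)) : MemLp f ∞ ν := by
  obtain ⟨C, hC⟩ := f.hasCompactSupport.exists_bound_of_continuous f.continuous
  exact memLp_top_of_continuous ν f.continuous hC

/-- The representation of `C₀(Y)` on `L²(Y, ν)` by multiplication operators. -/
def c0Op (f : C₀(Y, ℂ)) : BL2 ν := fnOp ν (memLp_top_C0 ν f)

/-- The representation of `C_c(Y)` on `L²(Y, ν)` by multiplication operators. -/
def ccOp (f : C_c(Y, ℂ)) : BL2 ν := fnOp ν (memLp_top_Cc ν f)

variable {ν} (D : CompatibleMetric Y)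

/-- The operator `T` has propagation at most `r` with respect to the metric `D`. -/
def HasPropagationLE (r : ℝ) (T : BL2 ν) : Prop :=
  ∀ f g : C₀(Y, ℂ), ENNReal.ofReal r < D.setDist (tsupport f) (tsupport g) →
    c0Op ν f * T * c0Op ν g = 0

/-- The operator `T` has finite propagation with respect to the metric `D`. -/
def HasFinitePropagation (T : BL2 ν) : Prop := ∃ r : ℝ, 0 ≤ r ∧ HasPropagationLE D r T

/-- The operator `T` is locally compact. -/
def IsLocallyCompactOperator (T : BL2 ν) : Prop :=
  ∀ f : C_c(Y, ℂ), IsCompactOperator (ccOp ν f * T : BL2 ν) ∧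
    IsCompactOperator (T * ccOp ν f : BL2 ν)

variable (ν) in
/-- The operator norm localization property of the module `L²(Y, ν)`. -/
def HasONL : Prop :=
  ∃ c : ℝ, 0 < c ∧ c ≤ 1 ∧ ∀ r > 0, ∃ R : ℝ, ∀ T : BL2 ν, HasPropagationLE D r T →
    ∃ (A : Set Y) (hA : MeasurableSet A), (∀ x ∈ A, ∀ y ∈ A, D.dist x y ≤ R) ∧
      c * ‖T‖ ≤ ‖indOp ν hA * T‖

/-! ### Operators of finite propagation form a `*`-algebra -/

theorem star_c0Op (f : C₀(Y, ℂ)) : star (c0Op ν f) = c0Op ν (star f) :=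
  star_fnOp _ _

theorem tsupport_star {Y : Type*} [TopologicalSpace Y] (f : C₀(Y, ℂ)) : tsupport (star f : C₀(Y, ℂ)) = tsupport f := by
  unfold tsupport
  congr 1
  ext y
  simp [Function.mem_support]

theorem HasPropagationLE.star {r : ℝ} {T : BL2 ν} (hT : HasPropagationLE D r T) :
    HasPropagationLE D r (star T) := by
  intro f g hfg
  have := hT (Star.star g) (Star.star f) (by
    rwa [tsupport_star, tsupport_star, D.setDist_comm])
  have h2 := congrArg Star.star this
  rwa [star_mul, star_mul, star_c0Op, star_c0Op, star_star, star_star, star_zero,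
    ← mul_assoc] at h2

theorem HasPropagationLE.mono {r s : ℝ} (hrs : r ≤ s) {T : BL2 ν} (hT : HasPropagationLE D r T) :
    HasPropagationLE D s T := fun f g h =>
  hT f g (lt_of_le_of_lt (ENNReal.ofReal_le_ofReal hrs) h)

theorem HasPropagationLE.add {r : ℝ} {S T : BL2 ν} (hS : HasPropagationLE D r S)
    (hT : HasPropagationLE D r T) : HasPropagationLE D r (S + T) := by
  intro f g h
  rw [mul_add, add_mul, hS f g h, hT f g h, add_zero]

theorem HasPropagationLE.smul {r : ℝ} (c : ℂ) {T : BL2 ν} (hT : HasPropagationLE D r T) :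
    HasPropagationLE D r (c • T) := by
  intro f g h
  rw [mul_smul_comm, smul_mul_assoc, hT f g h, smul_zero]

theorem hasPropagationLE_zero (r : ℝ) : HasPropagationLE D r (0 : BL2 ν) := by
  intro f g _
  rw [mul_zero, zero_mul]

/-- The multiplication representation of `C₀(Y)` is non-degenerate. -/
theorem eq_zero_of_mul_c0Op [T2Space Y] [LocallyCompactSpace Y] [SigmaCompactSpace Y]
    {A : BL2 ν} (hA : ∀ h : C₀(Y, ℂ), A * c0Op ν h = 0) : A = 0 := by
  let K : CompactExhaustion Y := default
  have hex : ∀ n, ∃ f : C(Y, ℝ), Set.EqOn f 1 (K n) ∧ HasCompactSupport f ∧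
      ∀ y, f y ∈ Set.Icc (0 : ℝ) 1 := by
    intro n
    obtain ⟨f, h1, -, h3, h4⟩ := exists_continuous_one_zero_of_isCompact (K.isCompact n)
      isClosed_empty (Set.disjoint_empty _)
    exact ⟨f, h1, h3, h4⟩
  choose f hf1 hfc hfI using hex
  let F : ℕ → C₀(Y, ℂ) := fun n =>
    { toFun := fun y => (f n y : ℂ)
      continuous_toFun := by fun_prop
      zero_at_infty' := by
        refine HasCompactSupport.is_zero_at_infty (f := fun y => (f n y : ℂ)) ?_
        exact (hfc n).comp_left (g := fun x : ℝ => (x : ℂ)) Complex.ofReal_zero }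
  have hF : ∀ n y, F n y = (f n y : ℂ) := fun _ _ => rfl
  have hweak : ∀ ξ η : L2 ν,
      Tendsto (fun n => inner ℂ η (c0Op ν (F n) ξ)) atTop (𝓝 (inner ℂ η ξ)) := by
    intro ξ η
    simp only [L2.inner_def]
    refine tendsto_integral_of_dominated_convergence (fun y => ‖inner ℂ (η y) (ξ y)‖) ?_ ?_ ?_ ?_
    · intro n
      exact (L2.integrable_inner η (c0Op ν (F n) ξ)).aestronglyMeasurable
    · exact (L2.integrable_inner η ξ).norm
    · intro n
      filter_upwards [fnOp_ae (memLp_top_C0 ν (F n)) ξ] with y hy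
      have hy' : (c0Op ν (F n) ξ : L2 ν) y = (F n) y * ξ y := hy
      rw [hy', hF, ← smul_eq_mul, inner_smul_right, norm_mul]
      refine mul_le_of_le_one_left (norm_nonneg _) ?_
      rw [Complex.norm_real, Real.norm_eq_abs, abs_le]
      exact ⟨by linarith [(hfI n y).1], (hfI n y).2⟩
    · have hall : ∀ᵐ y ∂ν, ∀ n, (c0Op ν (F n) ξ : L2 ν) y = (F n) y * ξ y :=
        ae_all_iff.2 fun n => fnOp_ae (memLp_top_C0 ν (F n)) ξ
      filter_upwards [hall] with y hy
      obtain ⟨N, hN⟩ := K.exists_mem y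
      refine tendsto_const_nhds.congr' ?_
      filter_upwards [eventually_ge_atTop N] with n hn
      have h1 : f n y = 1 := hf1 n (K.subset hn hN)
      rw [hy, hF, h1, Complex.ofReal_one, one_mul]
  ext1 ξ
  rw [zero_apply]
  refine ext_inner_left ℂ fun η => ?_
  rw [inner_zero_right, ← ContinuousLinearMap.adjoint_inner_left]
  refine tendsto_nhds_unique (hweak ξ _) (tendsto_const_nhds.congr fun n => ?_)
  rw [ContinuousLinearMap.adjoint_inner_left]
  have : A (c0Op ν (F n) ξ) = 0 := by
    have := congrArg (fun B : BL2 ν => B ξ) (hA (F n))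
    simpa using this
  rw [this, inner_zero_right]

theorem HasPropagationLE.mul [LocallyCompactSpace Y] [SigmaCompactSpace Y]
    {r s : ℝ} (hr : 0 ≤ r) (hs : 0 ≤ s) {S T : BL2 ν}
    (hS : HasPropagationLE D r S) (hT : HasPropagationLE D s T) :
    HasPropagationLE D (r + s) (S * T) := by
  intro f g hfg
  let _ : MetricSpace Y := D.toMetricSpace
  have hdist : ∀ x y : Y, dist x y = D.dist x y := fun _ _ => rfl
  obtain ⟨q, hq, hq'⟩ := (D.lt_setDist_iff (add_nonneg hr hs)).1 hfg
  obtain ⟨e, he, heq⟩ : ∃ e > 0, r + s + 4 * e = q := ⟨(q - (r + s)) / 4, by linarith, by ring⟩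
  by_cases hne : (tsupport f).Nonempty
  swap
  · have h0 : ∀ y, f y = 0 := by
      intro y
      by_contra hy
      exact hne ⟨y, subset_tsupport _ hy⟩
    have : c0Op ν f = 0 := fnOp_zero _ h0
    rw [this, zero_mul, zero_mul]
  let φ : Y → ℝ := fun y => max 0 (min 1 ((Metric.infDist y (tsupport f) - (r + e)) / e))
  have hφc : Continuous φ := by
    have := Metric.continuous_infDist_pt (tsupport f)
    fun_prop
  have hφ0 : ∀ y, 0 ≤ φ y := fun y => le_max_left _ _
  have hφ1 : ∀ y, φ y ≤ 1 := fun y => max_le zero_le_one (min_le_left _ _)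
  have hφn : ∀ y, ‖(φ y : ℂ)‖ ≤ 1 := fun y => by
    rw [Complex.norm_real, Real.norm_eq_abs, abs_le]
    exact ⟨by linarith [hφ0 y], hφ1 y⟩
  have hψn : ∀ y, ‖(1 - φ y : ℂ)‖ ≤ 1 := fun y => by
    rw [← Complex.ofReal_one, ← Complex.ofReal_sub, Complex.norm_real, Real.norm_eq_abs, abs_le]
    exact ⟨by linarith [hφ1 y], by linarith [hφ0 y]⟩
  have hφC : Continuous fun y => (φ y : ℂ) := by fun_prop
  have hψC : Continuous fun y => (1 - φ y : ℂ) := by fun_prop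
  have hφs : ∀ y, φ y ≠ 0 → r + e ≤ Metric.infDist y (tsupport f) := by
    intro y hy
    by_contra hlt
    rw [not_le] at hlt
    apply hy
    refine max_eq_left ((min_le_right _ _).trans ?_)
    exact div_nonpos_of_nonpos_of_nonneg (by linarith) he.le
  have hψs : ∀ y, (1 - φ y) ≠ 0 → Metric.infDist y (tsupport f) ≤ r + 2 * e := by
    intro y hy
    by_contra hlt
    rw [not_le] at hlt
    apply hy
    have h1 : 1 ≤ (Metric.infDist y (tsupport f) - (r + e)) / e := by
      rw [le_div_iff₀ he]; linarith
    have h2 : φ y = 1 := by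
      change max 0 (min 1 _) = 1
      rw [min_eq_left h1]
      exact max_eq_right zero_le_one
    rw [h2, sub_self]
  have hcut : ∀ (u : Y → ℂ) (_ : Continuous u) (_ : ∀ y, ‖u y‖ ≤ 1) (h : C₀(Y, ℂ)),
      ∃ k : C₀(Y, ℂ), ∀ y, k y = u y * h y := by
    intro u hu hu1 h
    refine ⟨{ toFun := fun y => u y * h y
              continuous_toFun := hu.mul h.continuous
              zero_at_infty' := ?_ }, fun _ => rfl⟩
    refine squeeze_zero_norm (a := fun y => ‖h y‖) (fun y => ?_) ?_
    · rw [norm_mul]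
      exact mul_le_of_le_one_left (norm_nonneg _) (hu1 y)
    · simpa using h.zero_at_infty'.norm
  have hMφ := memLp_top_of_continuous ν hφC hφn
  have hMψ := memLp_top_of_continuous ν hψC hψn
  have hM1 : MemLp (fun _ : Y => (1 : ℂ)) ∞ ν :=
    memLp_top_of_continuous ν continuous_const (C := 1) (by simp)
  have hsum : fnOp ν hMφ + fnOp ν hMψ = 1 := by
    have h2 : MemLp (fun y => (φ y : ℂ) + (1 - φ y : ℂ)) ∞ ν := hMφ.add hMψ
    rw [fnOp_add _ _ h2, ← fnOp_one hM1]
    exact fnOp_congr _ _ (by ext y; ring)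
  have hleft : c0Op ν f * S * fnOp ν hMφ = 0 := by
    refine eq_zero_of_mul_c0Op fun h => ?_
    obtain ⟨k, hk⟩ := hcut _ hφC hφn h
    have h1 : fnOp ν hMφ * c0Op ν h = c0Op ν k := by
      have hm : MemLp (fun y => (φ y : ℂ) * h y) ∞ ν :=
        (memLp_top_C0 ν k).ae_eq (Eventually.of_forall hk)
      rw [c0Op, fnOp_mul _ _ hm]
      exact fnOp_congr _ _ (by ext y; rw [hk])
    rw [mul_assoc, h1]
    refine hS f k ((D.lt_setDist_iff hr).2 ⟨r + e, by linarith, fun x hx y hy => ?_⟩)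
    have hy2 : r + e ≤ Metric.infDist y (tsupport f) := by
      have hcl : IsClosed {y | r + e ≤ Metric.infDist y (tsupport f)} :=
        isClosed_le continuous_const (Metric.continuous_infDist_pt _)
      refine closure_minimal (s := Function.support k) ?_ hcl hy
      intro z hz
      refine hφs z fun h0 => hz ?_
      rw [hk, h0, Complex.ofReal_zero, zero_mul]
    have := Metric.infDist_le_dist_of_mem (x := y) hx
    rw [← hdist, dist_comm]
    linarith
  have hright : fnOp ν hMψ * T * c0Op ν g = 0 := by
    have hstar : Star.star (fnOp ν hMψ * T * c0Op ν g) = 0 := by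
      have hMψ' : MemLp (fun y => Star.star (1 - φ y : ℂ)) ∞ ν :=
        hMψ.star
      have hss : Star.star (fnOp ν hMψ) = fnOp ν hMψ := by
        rw [star_fnOp _ hMψ']
        refine fnOp_congr _ _ ?_
        ext y
        rw [← Complex.ofReal_one, ← Complex.ofReal_sub, Complex.star_def, Complex.conj_ofReal]
      rw [star_mul, star_mul, hss, star_c0Op, ← mul_assoc]
      refine eq_zero_of_mul_c0Op fun h => ?_
      obtain ⟨k, hk⟩ := hcut _ hψC hψn h
      have h1 : fnOp ν hMψ * c0Op ν h = c0Op ν k := by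
        have hm : MemLp (fun y => (1 - φ y : ℂ) * h y) ∞ ν :=
          (memLp_top_C0 ν k).ae_eq (Eventually.of_forall hk)
        rw [c0Op, fnOp_mul _ _ hm]
        exact fnOp_congr _ _ (by ext y; rw [hk])
      rw [mul_assoc, h1]
      refine hT.star D (Star.star g) k ((D.lt_setDist_iff hs).2
        ⟨s + e, by linarith, fun x hx y hy => ?_⟩)
      rw [tsupport_star] at hx
      have hy2 : Metric.infDist y (tsupport f) ≤ r + 2 * e := by
        have hcl : IsClosed {y | Metric.infDist y (tsupport f) ≤ r + 2 * e} :=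
          isClosed_le (Metric.continuous_infDist_pt _) continuous_const
        refine closure_minimal (s := Function.support k) ?_ hcl hy
        intro z hz
        refine hψs z fun h0 => hz ?_
        rw [hk]
        have : (1 - φ z : ℂ) = 0 := by exact_mod_cast h0
        rw [this, zero_mul]
      obtain ⟨z, hz, hyz⟩ := (Metric.infDist_lt_iff (r := r + 3 * e) hne).1 (by linarith)
      have h3 := hq' z hz x hx
      rw [← hdist] at h3
      rw [← hdist]
      have := dist_triangle z y x
      rw [dist_comm z y, dist_comm y x] at this
      linarith
    rw [← star_star (fnOp ν hMψ * T * c0Op ν g), hstar, star_zero]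
  calc c0Op ν f * (S * T) * c0Op ν g
      = c0Op ν f * S * (fnOp ν hMφ + fnOp ν hMψ) * T * c0Op ν g := by
        rw [hsum, mul_one]; simp only [mul_assoc]
    _ = (c0Op ν f * S * fnOp ν hMφ) * T * c0Op ν g +
        c0Op ν f * S * (fnOp ν hMψ * T * c0Op ν g) := by
        rw [mul_add, add_mul, add_mul]; simp only [mul_assoc]
    _ = 0 := by rw [hleft, hright]; simp

theorem star_ccOp (f : C_c(Y, ℂ)) : star (ccOp ν f) = ccOp ν (star f) :=
  star_fnOp _ _

theorem IsLocallyCompactOperator.star {T : BL2 ν} (hT : IsLocallyCompactOperator T) :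
    IsLocallyCompactOperator (star T) := by
  intro f
  have h1 := isCompactOperator_star (hT (Star.star f)).1
  have h2 := isCompactOperator_star (hT (Star.star f)).2
  rw [star_mul, star_ccOp, star_star] at h1 h2
  exact ⟨h2, h1⟩

variable (ν)

/-- The Roe `*`-algebra of the module `L²(Y, ν)` over the metric space `(Y, D)`: all locally
compact operators of finite propagation. -/
def roeStarAlgebra [LocallyCompactSpace Y] [SigmaCompactSpace Y] :
    NonUnitalStarSubalgebra ℂ (BL2 ν) where
  carrier := {T | HasFinitePropagation D T ∧ IsLocallyCompactOperator T}
  add_mem' := by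
    rintro S T ⟨⟨r, hr, hS⟩, hS'⟩ ⟨⟨s, hs, hT⟩, hT'⟩
    refine ⟨⟨max r s, hr.trans (le_max_left _ _),
      (hS.mono D (le_max_left _ _)).add D (hT.mono D (le_max_right _ _))⟩, fun f => ?_⟩
    rw [mul_add, add_mul]
    exact ⟨(hS' f).1.add (hT' f).1, (hS' f).2.add (hT' f).2⟩
  zero_mem' := by
    refine ⟨⟨0, le_rfl, hasPropagationLE_zero D 0⟩, fun f => ?_⟩
    rw [mul_zero, zero_mul]
    exact ⟨isCompactOperator_zero, isCompactOperator_zero⟩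
  smul_mem' := by
    rintro c T ⟨⟨r, hr, hT⟩, hT'⟩
    refine ⟨⟨r, hr, hT.smul D c⟩, fun f => ?_⟩
    rw [mul_smul_comm, smul_mul_assoc]
    exact ⟨(hT' f).1.smul c, (hT' f).2.smul c⟩
  mul_mem' := by
    rintro S T ⟨⟨r, hr, hS⟩, hS'⟩ ⟨⟨s, hs, hT⟩, hT'⟩
    refine ⟨⟨r + s, add_nonneg hr hs, hS.mul D hr hs hT⟩, fun f => ?_⟩
    rw [← mul_assoc, mul_assoc S]
    exact ⟨(hS' f).1.comp_clm T, (hT' f).2.clm_comp S⟩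
  star_mem' := by
    rintro T ⟨⟨r, hr, hT⟩, hT'⟩
    exact ⟨⟨r, hr, hT.star D⟩, hT'.star⟩

/-- The Roe algebra: the norm closure of the Roe `*`-algebra. -/
def roeAlgebra [LocallyCompactSpace Y] [SigmaCompactSpace Y] :
    NonUnitalStarSubalgebra ℂ (BL2 ν) :=
  (roeStarAlgebra ν D).topologicalClosure

end Module

/-! ## The Koopman representation -/

section Koopman

variable {Γ Y : Type*} [Group Γ] [MulAction Γ Y] [MeasurableSpace Y]

/-- The action of `Γ` on `(Y, ν)` is non-singular: it is measurable and preserves the measure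
class of `ν`. -/
def NonsingularAction (Γ : Type*) {Y : Type*} [Group Γ] [MulAction Γ Y] [MeasurableSpace Y]
    (ν : Measure Y) : Prop :=
  ∀ g : Γ, Measure.QuasiMeasurePreserving (fun y : Y => g • y) ν ν

variable (ν : Measure Y)

/-- The Radon-Nikodym cocycle `r(γ, y) = dγ_*ν/dν (y)`. -/
def rnCocycle (g : Γ) (y : Y) : ℝ≥0∞ := (ν.map fun y => g • y).rnDeriv ν y

/-- The function `r(γ, y)^{1/2} ξ(γ⁻¹ y)`. -/
def koopmanFun (g : Γ) (ξ : Y → ℂ) (y : Y) : ℂ :=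
  ((Real.sqrt (rnCocycle ν g y).toReal : ℝ) : ℂ) * ξ (g⁻¹ • y)

variable {ν} (hν : NonsingularAction Γ ν)

theorem measurable_rnCocycle (g : Γ) : Measurable (rnCocycle ν g) :=
  Measure.measurable_rnDeriv _ _

theorem aestronglyMeasurable_koopmanFun (hν : NonsingularAction Γ ν) (g : Γ) {ξ : Y → ℂ}
    (hξ : AEStronglyMeasurable ξ ν) : AEStronglyMeasurable (koopmanFun ν g ξ) ν := by
  refine AEStronglyMeasurable.mul ?_ (hξ.comp_quasiMeasurePreserving (hν g⁻¹))
  have : Measurable fun y => ((Real.sqrt (rnCocycle ν g y).toReal : ℝ) : ℂ) :=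
    Complex.measurable_ofReal.comp (measurable_rnCocycle g).ennreal_toReal.sqrt
  exact this.aestronglyMeasurable

variable [SigmaFinite ν]

theorem sigmaFinite_map_smul (hν : NonsingularAction Γ ν) (g : Γ) :
    SigmaFinite (ν.map fun y => g • y) := by
  let e : Y ≃ᵐ Y :=
    { toFun := fun y => g • y
      invFun := fun y => g⁻¹ • y
      left_inv := fun y => by simp
      right_inv := fun y => by simp
      measurable_toFun := (hν g).measurable
      measurable_invFun := (hν g⁻¹).measurable }
  exact e.sigmaFinite_map

theorem withDensity_rnCocycle (hν : NonsingularAction Γ ν) (g : Γ) :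
    ν.withDensity (rnCocycle ν g) = ν.map fun y => g • y := by
  have := sigmaFinite_map_smul hν g
  exact Measure.withDensity_rnDeriv_eq _ _ (hν g).absolutelyContinuous

theorem rnCocycle_lt_top (hν : NonsingularAction Γ ν) (g : Γ) :
    ∀ᵐ y ∂ν, rnCocycle ν g y < ∞ := by
  have := sigmaFinite_map_smul hν g
  exact Measure.rnDeriv_lt_top _ _

theorem rnCocycle_one : ∀ᵐ y ∂ν, rnCocycle ν (1 : Γ) y = 1 := by
  have h : (ν.map fun y => (1 : Γ) • y) = ν := by simp
  unfold rnCocycle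
  rw [h]
  exact Measure.rnDeriv_self ν

theorem rnCocycle_mul (hν : NonsingularAction Γ ν) (g k : Γ) :
    ∀ᵐ y ∂ν, rnCocycle ν (g * k) y = rnCocycle ν g y * rnCocycle ν k (g⁻¹ • y) := by
  have hm : Measurable fun y => rnCocycle ν k (g⁻¹ • y) :=
    (measurable_rnCocycle k).comp (hν g⁻¹).measurable
  have h : (ν.map fun y => (g * k) • y) =
      ν.withDensity (fun y => rnCocycle ν g y * rnCocycle ν k (g⁻¹ • y)) := by
    have h1 : (ν.map fun y => (g * k) • y) = (ν.map fun y => k • y).map (fun y => g • y) := by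
      rw [Measure.map_map (hν g).measurable (hν k).measurable]
      congr 1
      ext y
      simp [mul_smul]
    rw [h1, ← withDensity_rnCocycle hν k]
    have h2 := withDensity_mul ν (measurable_rnCocycle (ν := ν) g) hm
    rw [show (fun y => rnCocycle ν g y * rnCocycle ν k (g⁻¹ • y)) =
      rnCocycle ν g * fun y => rnCocycle ν k (g⁻¹ • y) from rfl, h2, withDensity_rnCocycle hν g]
    ext s hs
    rw [Measure.map_apply (hν g).measurable hs, withDensity_apply _ ((hν g).measurable hs),
      withDensity_apply _ hs, setLIntegral_map hs hm (hν g).measurable]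
    simp
  unfold rnCocycle at h ⊢
  rw [h]
  exact Measure.rnDeriv_withDensity ν ((measurable_rnCocycle g).mul hm)

theorem eLpNorm_koopmanFun (hν : NonsingularAction Γ ν) (g : Γ) {ξ : Y → ℂ}
    (hξ : AEStronglyMeasurable ξ ν) : eLpNorm (koopmanFun ν g ξ) 2 ν = eLpNorm ξ 2 ν := by
  rw [eLpNorm_eq_lintegral_rpow_enorm_toReal two_ne_zero ENNReal.ofNat_ne_top,
    eLpNorm_eq_lintegral_rpow_enorm_toReal two_ne_zero ENNReal.ofNat_ne_top]
  congr 1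
  simp only [ENNReal.toReal_ofNat, ENNReal.rpow_ofNat]
  have h1 : ∫⁻ y, ‖koopmanFun ν g ξ y‖ₑ ^ 2 ∂ν =
      ∫⁻ y, (rnCocycle ν g * fun y => ‖ξ (g⁻¹ • y)‖ₑ ^ 2) y ∂ν := by
    refine lintegral_congr_ae ?_
    filter_upwards [rnCocycle_lt_top hν g] with y hy
    simp only [koopmanFun, Pi.mul_apply, enorm_mul, mul_pow]
    congr 1
    rw [← ofReal_norm, Complex.norm_real, Real.norm_eq_abs, abs_of_nonneg
      (Real.sqrt_nonneg _), ← ENNReal.ofReal_pow (Real.sqrt_nonneg _),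
      Real.sq_sqrt ENNReal.toReal_nonneg, ENNReal.ofReal_toReal hy.ne]
  have hmeas : AEMeasurable (fun y => ‖ξ (g⁻¹ • y)‖ₑ ^ 2) ν :=
    ((hξ.comp_quasiMeasurePreserving (hν g⁻¹)).enorm).pow_const 2
  rw [h1, ← lintegral_withDensity_eq_lintegral_mul₀ (measurable_rnCocycle g).aemeasurable hmeas,
    withDensity_rnCocycle hν g]
  have hmap : ν.map (fun y => g • y) ≪ ν := (hν g).absolutelyContinuous
  rw [lintegral_map' (hmeas.mono_ac hmap) (hν g).measurable.aemeasurable]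
  simp

theorem memLp_koopmanFun (hν : NonsingularAction Γ ν) (g : Γ) (ξ : L2 ν) :
    MemLp (koopmanFun ν g ξ) 2 ν :=
  ⟨aestronglyMeasurable_koopmanFun hν g (Lp.aestronglyMeasurable ξ), by
    rw [eLpNorm_koopmanFun hν g (Lp.aestronglyMeasurable ξ)]; exact Lp.eLpNorm_lt_top ξ⟩

/-- The operator `π(γ)` of the Koopman representation, `π(γ)ξ(y) = r(γ, y)^{1/2} ξ(γ⁻¹ y)`, as a
linear isometry of `L²(Y, ν)`. -/
def koopmanIsometry (g : Γ) : L2 ν →ₗᵢ[ℂ] L2 ν where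
  toFun ξ := (memLp_koopmanFun hν g ξ).toLp
  map_add' ξ η := by
    rw [← MemLp.toLp_add]
    refine MemLp.toLp_congr _ _ ?_
    filter_upwards [(hν g⁻¹).ae (Lp.coeFn_add ξ η)] with y hy
    simp only [koopmanFun, Pi.add_apply] at hy ⊢
    rw [hy, mul_add]
  map_smul' c ξ := by
    rw [RingHom.id_apply, ← MemLp.toLp_const_smul]
    refine MemLp.toLp_congr _ _ ?_
    filter_upwards [(hν g⁻¹).ae (Lp.coeFn_smul c ξ)] with y hy
    simp only [koopmanFun, Pi.smul_apply, smul_eq_mul] at hy ⊢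
    rw [hy]
    ring
  norm_map' ξ := by
    change ‖(memLp_koopmanFun hν g ξ).toLp‖ = ‖ξ‖
    rw [Lp.norm_toLp, eLpNorm_koopmanFun hν g (Lp.aestronglyMeasurable ξ), Lp.norm_def]

theorem koopmanIsometry_ae (g : Γ) (ξ : L2 ν) :
    koopmanIsometry hν g ξ =ᵐ[ν] koopmanFun ν g ξ :=
  (memLp_koopmanFun hν g ξ).coeFn_toLp

theorem koopmanIsometry_one (ξ : L2 ν) : koopmanIsometry hν 1 ξ = ξ := by
  ext
  filter_upwards [koopmanIsometry_ae hν 1 ξ, rnCocycle_one (Γ := Γ) (ν := ν)] with y h1 h2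
  rw [h1, koopmanFun, h2]
  simp

theorem koopmanIsometry_mul (g k : Γ) (ξ : L2 ν) :
    koopmanIsometry hν (g * k) ξ = koopmanIsometry hν g (koopmanIsometry hν k ξ) := by
  ext
  filter_upwards [koopmanIsometry_ae hν (g * k) ξ,
    koopmanIsometry_ae hν g (koopmanIsometry hν k ξ),
    (hν g⁻¹).ae (koopmanIsometry_ae hν k ξ), rnCocycle_mul hν g k] with y h1 h2 h3 h4
  rw [h1, h2, koopmanFun, koopmanFun, h3, koopmanFun, h4, ENNReal.toReal_mul,
    Real.sqrt_mul ENNReal.toReal_nonneg, Complex.ofReal_mul, mul_inv_rev, mul_smul, mul_assoc]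

/-- The Koopman representation `π : Γ → U(L²(Y, ν))` of a non-singular action. -/
def koopman : Γ →* unitary (BL2 ν) where
  toFun g := ⟨(koopmanIsometry hν g).toContinuousLinearMap, by
    have h1 : ∀ k : Γ, star (koopmanIsometry hν k).toContinuousLinearMap *
        (koopmanIsometry hν k).toContinuousLinearMap = (1 : BL2 ν) := by
      intro k
      rw [ContinuousLinearMap.star_eq_adjoint]
      exact (ContinuousLinearMap.norm_map_iff_adjoint_comp_self _).1
        (koopmanIsometry hν k).norm_map
    have h2 : (koopmanIsometry hν g).toContinuousLinearMap *
        (koopmanIsometry hν g⁻¹).toContinuousLinearMap = (1 : BL2 ν) := by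
      ext1 ξ
      change koopmanIsometry hν g (koopmanIsometry hν g⁻¹ ξ) = ξ
      rw [← koopmanIsometry_mul, mul_inv_cancel, koopmanIsometry_one]
    have h3 : star (koopmanIsometry hν g).toContinuousLinearMap =
        (koopmanIsometry hν g⁻¹).toContinuousLinearMap := by
      rw [← mul_one (star _), ← h2, ← mul_assoc, h1, one_mul]
    exact Unitary.mem_iff.2 ⟨h1 g, by rw [h3, h2]⟩⟩
  map_one' := by
    ext1
    ext1 ξ
    exact koopmanIsometry_one hν ξ
  map_mul' g k := by
    ext1
    ext1 ξ
    exact koopmanIsometry_mul hν g k ξ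

theorem koopman_ae (g : Γ) (ξ : L2 ν) :
    (koopman hν g : BL2 ν) ξ =ᵐ[ν]
      fun y => ((Real.sqrt (rnCocycle ν g y).toReal : ℝ) : ℂ) * ξ (g⁻¹ • y) :=
  koopmanIsometry_ae hν g ξ

theorem koopman_mul_fnOp (g : Γ) {f f' : Y → ℂ} (hf : MemLp f ∞ ν) (hf' : MemLp f' ∞ ν)
    (h : ∀ y, f' y = f (g⁻¹ • y)) :
    (koopman hν g : BL2 ν) * fnOp ν hf = fnOp ν hf' * (koopman hν g : BL2 ν) := by
  ext ξ
  filter_upwards [koopman_ae hν g (fnOp ν hf ξ), (hν g⁻¹).ae (fnOp_ae hf ξ),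
    fnOp_ae hf' ((koopman hν g : BL2 ν) ξ), koopman_ae hν g ξ] with y h1 h2 h3 h4
  rw [mul_apply_eq_comp, mul_apply_eq_comp, h1, h2, h3, h4, h]
  ring

/-! ### The Koopman representation normalizes the Roe `*`-algebra -/

variable [TopologicalSpace Y] [BorelSpace Y] (D : CompatibleMetric Y)

theorem CompatibleMetric.LipschitzAction.continuous_smul {Γ Y : Type*} [Group Γ] [MulAction Γ Y]
    [TopologicalSpace Y] {D : CompatibleMetric Y}
    (hD : D.LipschitzAction Γ) (g : Γ) : Continuous fun y : Y => g • y := by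
  obtain ⟨L, hL⟩ := hD g
  refine continuous_iff_continuousAt.2 fun x => ?_
  refine ((D.hasBasis_nhds x).tendsto_iff (D.hasBasis_nhds (g • x))).2 fun ε hε => ?_
  refine ⟨ε / (|L| + 1), by positivity, fun y hy => ?_⟩
  have h1 : D.dist y x * (|L| + 1) < ε := (lt_div_iff₀ (by positivity)).1 hy
  refine (hL y x).trans_lt (lt_of_le_of_lt ?_ h1)
  have := mul_le_mul_of_nonneg_right (le_abs_self L) (D.dist_nonneg y x)
  nlinarith [D.dist_nonneg y x]

/-- The homeomorphism of `Y` given by a group element. -/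
def CompatibleMetric.LipschitzAction.homeomorph {Γ Y : Type*} [Group Γ] [MulAction Γ Y]
    [TopologicalSpace Y] {D : CompatibleMetric Y}
    (hD : D.LipschitzAction Γ) (g : Γ) : Y ≃ₜ Y where
  toFun y := g • y
  invFun y := g⁻¹ • y
  left_inv y := by simp
  right_inv y := by simp
  continuous_toFun := hD.continuous_smul g
  continuous_invFun := hD.continuous_smul g⁻¹

variable [LocallyCompactSpace Y] [SigmaCompactSpace Y]

theorem normalizes_roeStarAlgebra (hD : D.LipschitzAction Γ) :
    Normalizes (roeStarAlgebra ν D) (koopman hν) := by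
  rintro g T ⟨⟨r, hr, hT⟩, hT'⟩
  set u : BL2 ν := (koopman hν g : BL2 ν) with hu
  have huu : star u * u = 1 := Unitary.coe_star_mul_self (koopman hν g)
  have huu' : u * star u = 1 := Unitary.coe_mul_star_self (koopman hν g)
  let e : Y ≃ₜ Y := hD.homeomorph g
  have key : ∀ {f f' : Y → ℂ} (hf : MemLp f ∞ ν) (hf' : MemLp f' ∞ ν),
      (∀ y, f' y = f (e y)) → fnOp ν hf * u = u * fnOp ν hf' ∧
        star u * fnOp ν hf = fnOp ν hf' * star u := by
    intro f f' hf hf' h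
    have h1 : u * fnOp ν hf' = fnOp ν hf * u := koopman_mul_fnOp hν g hf' hf fun y => by
      rw [h]
      change f y = f (g • g⁻¹ • y)
      rw [smul_inv_smul]
    refine ⟨h1.symm, ?_⟩
    calc star u * fnOp ν hf = star u * (fnOp ν hf * u) * star u := by
          rw [mul_assoc, mul_assoc, huu', mul_one]
      _ = fnOp ν hf' * star u := by
          rw [← h1, ← mul_assoc, huu, one_mul]
  constructor
  · obtain ⟨L, hL⟩ := hD g
    have hL1 : ∀ x y : Y, D.dist (g • x) (g • y) ≤ max L 1 * D.dist x y := fun x y =>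
      (hL x y).trans (mul_le_mul_of_nonneg_right (le_max_left _ _) (D.dist_nonneg x y))
    have hLpos : 0 < max L 1 := lt_max_of_lt_right one_pos
    refine ⟨max L 1 * r, by positivity, fun f k hfk => ?_⟩
    obtain ⟨q, hq, hq'⟩ := (D.lt_setDist_iff (by positivity)).1 hfk
    let f' : C₀(Y, ℂ) := f.comp e.toCocompactMap
    let k' : C₀(Y, ℂ) := k.comp e.toCocompactMap
    have hf := (key (memLp_top_C0 ν f) (memLp_top_C0 ν f') fun y => rfl).1
    have hk := (key (memLp_top_C0 ν k) (memLp_top_C0 ν k') fun y => rfl).2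
    have hsupp : ∀ (h : C₀(Y, ℂ)), ∀ y ∈ tsupport (h.comp e.toCocompactMap : C₀(Y, ℂ)),
        e y ∈ tsupport h := by
      intro h y hy
      have := tsupport_comp_subset_preimage h e.continuous hy
      exact this
    have h0 := hT f' k' ((D.lt_setDist_iff hr).2 ⟨q / max L 1, by
      rw [gt_iff_lt, lt_div_iff₀ hLpos]; linarith, fun x hx y hy => by
        rw [div_le_iff₀ hLpos, mul_comm]
        exact (hq' _ (hsupp f x hx) _ (hsupp k y hy)).trans (hL1 x y)⟩)
    calc c0Op ν f * (u * T * star u) * c0Op ν k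
        = (c0Op ν f * u) * T * (star u * c0Op ν k) := by simp only [mul_assoc]
      _ = u * (c0Op ν f' * T * c0Op ν k') * star u := by
          have hf2 : c0Op ν f * u = u * c0Op ν f' := hf
          have hk2 : star u * c0Op ν k = c0Op ν k' * star u := hk
          rw [hf2, hk2]; simp only [mul_assoc]
      _ = 0 := by rw [h0, mul_zero, zero_mul]
  · intro f
    let f' : C_c(Y, ℂ) := f.comp e.toCocompactMap
    have hf := key (memLp_top_Cc ν f) (memLp_top_Cc ν f') fun y => rfl
    have hf1 : ccOp ν f * u = u * ccOp ν f' := hf.1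
    have hf2 : star u * ccOp ν f = ccOp ν f' * star u := hf.2
    constructor
    · have : ccOp ν f * (u * T * star u) = u * (ccOp ν f' * T) * star u := by
        rw [← mul_assoc, ← mul_assoc, hf1]; simp only [mul_assoc]
      rw [this]
      exact IsCompactOperator.comp_clm ((hT' f').1.clm_comp u) (star u)
    · have : (u * T * star u) * ccOp ν f = u * (T * ccOp ν f') * star u := by
        rw [mul_assoc, hf2]; simp only [mul_assoc]
      rw [this]
      exact IsCompactOperator.comp_clm ((hT' f').2.clm_comp u) (star u)

theorem normalizes_roeAlgebra (hD : D.LipschitzAction Γ) :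
    Normalizes (roeAlgebra ν D) (koopman hν) :=
  (normalizes_roeStarAlgebra hν D hD).topologicalClosure

end Koopman

/-! ## Warped metrics -/

/-- A proper length function on a group. -/
structure ProperLength (Γ : Type*) [Group Γ] where
  /-- the length of a group element -/
  len : Γ → ℝ
  nonneg : ∀ g, 0 ≤ len g
  eq_zero_iff : ∀ g, len g = 0 ↔ g = 1
  inv : ∀ g, len g⁻¹ = len g
  mul_le : ∀ g k, len (g * k) ≤ len g + len k
  proper : ∀ r : ℝ, {g | len g ≤ r}.Finite

theorem ProperLength.exists_pos_le {Γ : Type*} [Group Γ] (ℓ : ProperLength Γ) :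
    ∃ m > 0, ∀ g : Γ, g ≠ 1 → m ≤ ℓ.len g := by
  have hfin : ({g | ℓ.len g ≤ 1} ∩ {g | g ≠ 1}).Finite := (ℓ.proper 1).inter_of_left _
  by_cases hne : ({g | ℓ.len g ≤ 1} ∩ {g | g ≠ 1}).Nonempty
  · obtain ⟨k, hk, hmin⟩ := Set.exists_min_image _ ℓ.len hfin hne
    have hk0 : 0 < ℓ.len k :=
      lt_of_le_of_ne (ℓ.nonneg k) fun h => hk.2 ((ℓ.eq_zero_iff k).1 h.symm)
    refine ⟨ℓ.len k, hk0, fun g hg => ?_⟩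
    by_cases h1 : ℓ.len g ≤ 1
    · exact hmin g ⟨h1, hg⟩
    · exact hk.1.trans (not_le.1 h1).le
  · refine ⟨1, one_pos, fun g hg => ?_⟩
    by_contra h
    exact hne ⟨g, (not_le.1 h).le, hg⟩

section Warped

variable {Γ Y : Type*} [Group Γ] [TopologicalSpace Y] [MulAction Γ Y]

/-- The function `ρ` is a metric on `Y` with `ρ ≤ D` and `ρ(y, γ y) ≤ ℓ(γ)` for all `y`, `γ`. -/
structure IsWarpAdmissible (D : CompatibleMetric Y) (ℓ : ProperLength Γ) (ρ : Y → Y → ℝ) :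
    Prop where
  self : ∀ x, ρ x x = 0
  comm : ∀ x y, ρ x y = ρ y x
  triangle : ∀ x y z, ρ x z ≤ ρ x y + ρ y z
  eq_of_eq_zero : ∀ x y, ρ x y = 0 → x = y
  le_dist : ∀ x y, ρ x y ≤ D.dist x y
  le_len : ∀ y (g : Γ), ρ y (g • y) ≤ ℓ.len g

/-- The warped distance: the largest metric `δ` on `Y` with `δ ≤ D` and `δ(y, γ y) ≤ ℓ(γ)`. -/
def warpedDist (D : CompatibleMetric Y) (ℓ : ProperLength Γ) (x y : Y) : ℝ :=
  sSup {s | ∃ ρ, IsWarpAdmissible D ℓ ρ ∧ s = ρ x y}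

variable (D : CompatibleMetric Y) (ℓ : ProperLength Γ)

theorem isWarpAdmissible_min {m : ℝ} (hm : 0 < m) (hℓ : ∀ g : Γ, g ≠ 1 → m ≤ ℓ.len g) :
    IsWarpAdmissible D ℓ fun x y => min (D.dist x y) m where
  self x := by rw [D.dist_self, min_eq_left hm.le]
  comm x y := by rw [D.dist_comm]
  triangle x y z := by
    have h := D.dist_triangle x y z
    have h1 := D.dist_nonneg x y
    have h2 := D.dist_nonneg y z
    rcases le_total (D.dist x y) m with h3 | h3 <;> rcases le_total (D.dist y z) m with h4 | h4 <;>
      simp only [min_eq_left h3, min_eq_left h4, min_eq_right h3, min_eq_right h4]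
    · exact (min_le_left _ _).trans h
    · exact (min_le_right _ _).trans (by linarith)
    · exact (min_le_right _ _).trans (by linarith)
    · exact (min_le_right _ _).trans (by linarith)
  eq_of_eq_zero x y h := by
    rcases min_choice (D.dist x y) m with h1 | h1
    · exact D.eq_of_dist_eq_zero (h1.symm.trans h)
    · exact absurd (h1.symm.trans h) hm.ne'
  le_dist x y := min_le_left _ _
  le_len y g := by
    by_cases hg : g = 1
    · subst hg
      rw [one_smul, D.dist_self, min_eq_left hm.le]
      exact ℓ.nonneg 1
    · exact (min_le_right _ _).trans (hℓ g hg)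

theorem le_warpedDist {ρ : Y → Y → ℝ} (hρ : IsWarpAdmissible D ℓ ρ) (x y : Y) :
    ρ x y ≤ warpedDist D ℓ x y := by
  refine le_csSup ⟨D.dist x y, ?_⟩ ⟨ρ, hρ, rfl⟩
  rintro _ ⟨σ, hσ, rfl⟩
  exact hσ.le_dist x y

theorem warpedDist_le {x y : Y} {c : ℝ} (h : ∀ ρ, IsWarpAdmissible D ℓ ρ → ρ x y ≤ c) :
    warpedDist D ℓ x y ≤ c := by
  obtain ⟨m, hm, hℓ⟩ := ℓ.exists_pos_le
  refine csSup_le ⟨_, _, isWarpAdmissible_min D ℓ hm hℓ, rfl⟩ ?_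
  rintro _ ⟨σ, hσ, rfl⟩
  exact h σ hσ

/-- The warped distance is an admissible metric; by `le_warpedDist` it is the largest one. -/
theorem isWarpAdmissible_warpedDist : IsWarpAdmissible D ℓ (warpedDist D ℓ) where
  self x := by
    obtain ⟨m, hm, hℓ⟩ := ℓ.exists_pos_le
    refine le_antisymm (warpedDist_le D ℓ fun ρ hρ => (hρ.self x).le) ?_
    have := le_warpedDist D ℓ (isWarpAdmissible_min D ℓ hm hℓ) x x
    rwa [(isWarpAdmissible_min D ℓ hm hℓ).self] at this
  comm x y := by
    refine le_antisymm (warpedDist_le D ℓ fun ρ hρ => ?_) (warpedDist_le D ℓ fun ρ hρ => ?_)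
    · rw [hρ.comm]; exact le_warpedDist D ℓ hρ y x
    · rw [hρ.comm]; exact le_warpedDist D ℓ hρ x y
  triangle x y z := warpedDist_le D ℓ fun ρ hρ =>
    (hρ.triangle x y z).trans (add_le_add (le_warpedDist D ℓ hρ x y) (le_warpedDist D ℓ hρ y z))
  eq_of_eq_zero x y h := by
    obtain ⟨m, hm, hℓ⟩ := ℓ.exists_pos_le
    have hadm := isWarpAdmissible_min D ℓ hm hℓ
    have := le_warpedDist D ℓ hadm x y
    rw [h] at this
    exact hadm.eq_of_eq_zero x y (le_antisymm this (le_min (D.dist_nonneg x y) hm.le))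
  le_dist x y := warpedDist_le D ℓ fun ρ hρ => hρ.le_dist x y
  le_len y g := warpedDist_le D ℓ fun ρ hρ => hρ.le_len y g

/-- The warped metric `δ_Γ`. -/
def CompatibleMetric.warped : CompatibleMetric Y where
  dist := warpedDist D ℓ
  dist_self := (isWarpAdmissible_warpedDist D ℓ).self
  dist_comm := (isWarpAdmissible_warpedDist D ℓ).comm
  dist_triangle := (isWarpAdmissible_warpedDist D ℓ).triangle
  eq_of_dist_eq_zero := (isWarpAdmissible_warpedDist D ℓ).eq_of_eq_zero _ _
  hasBasis_nhds x := by
    obtain ⟨m, hm, hℓ⟩ := ℓ.exists_pos_le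
    refine (D.hasBasis_nhds x).to_hasBasis (fun ε hε => ⟨min ε m, lt_min hε hm, fun y hy => ?_⟩)
      fun ε hε => ⟨ε, hε, fun y hy => ?_⟩
    · have h1 : min (D.dist y x) m < min ε m :=
        (le_warpedDist D ℓ (isWarpAdmissible_min D ℓ hm hℓ) y x).trans_lt hy
      change D.dist y x < ε
      by_contra h2
      exact absurd h1 (not_lt.2 (min_le_min_right m (not_lt.1 h2)))
    · exact ((isWarpAdmissible_warpedDist D ℓ).le_dist y x).trans_lt hy

end Warped

/-! ## Open cones -/

/-- The underlying space `X × [1, ∞)` of the open cone over `X`, with the product topology. -/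
def OpenCone (X : Type*) : Type _ := X × Set.Ici (1 : ℝ)

namespace OpenCone

variable {X : Type*}

instance [TopologicalSpace X] : TopologicalSpace (OpenCone X) :=
  inferInstanceAs (TopologicalSpace (X × Set.Ici (1 : ℝ)))

instance [MeasurableSpace X] : MeasurableSpace (OpenCone X) :=
  inferInstanceAs (MeasurableSpace (X × Set.Ici (1 : ℝ)))

instance {Γ : Type*} [Group Γ] [MulAction Γ X] : MulAction Γ (OpenCone X) where
  smul g p := (g • p.1, p.2)
  one_smul p := Prod.ext (one_smul Γ p.1) rfl
  mul_smul g k p := Prod.ext (mul_smul g k p.1) rfl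

theorem smul_def {Γ : Type*} [Group Γ] [MulAction Γ X] (g : Γ) (p : OpenCone X) :
    g • p = (g • p.1, p.2) := rfl

/-- Lebesgue measure on `[1, ∞)`. -/
def lebesgue : Measure (Set.Ici (1 : ℝ)) := (volume : Measure ℝ).comap (fun t => (t : ℝ))

instance : SigmaFinite lebesgue := by
  refine SigmaFinite.of_map _ (f := fun t : Set.Ici (1 : ℝ) => (t : ℝ))
    measurable_subtype_coe.aemeasurable ?_
  unfold lebesgue
  rw [(MeasurableEmbedding.subtype_coe measurableSet_Ici).map_comap]
  infer_instance

/-- The measure `μ × λ` on `X × [1, ∞)`, where `λ` is Lebesgue measure. -/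
def measure [MeasurableSpace X] (μ : Measure X) : Measure (OpenCone X) :=
  μ.prod lebesgue

instance [MeasurableSpace X] (μ : Measure X) [SigmaFinite μ] : SigmaFinite (measure μ) :=
  inferInstanceAs (SigmaFinite (μ.prod lebesgue))

theorem nonsingularAction [MeasurableSpace X] {μ : Measure X} [SigmaFinite μ] {Γ : Type*} [Group Γ]
    [MulAction Γ X] (hμ : NonsingularAction Γ μ) : NonsingularAction Γ (measure μ) := fun g =>
  MeasureTheory.QuasiMeasurePreserving.prodMap (hμ g) (Measure.QuasiMeasurePreserving.id lebesgue)

variable [MetricSpace X]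

instance [CompactSpace X] : LocallyCompactSpace (OpenCone X) :=
  have : LocallyCompactSpace (Set.Ici (1 : ℝ)) := isClosed_Ici.locallyCompactSpace
  inferInstanceAs (LocallyCompactSpace (X × Set.Ici (1 : ℝ)))

instance [CompactSpace X] : SigmaCompactSpace (OpenCone X) :=
  have : LocallyCompactSpace (Set.Ici (1 : ℝ)) := isClosed_Ici.locallyCompactSpace
  inferInstanceAs (SigmaCompactSpace (X × Set.Ici (1 : ℝ)))

instance [CompactSpace X] [MeasurableSpace X] [BorelSpace X] : BorelSpace (OpenCone X) :=
  inferInstanceAs (BorelSpace (X × Set.Ici (1 : ℝ)))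

/-- The cone distance `d((x, t), (y, s)) = min(t, s) d(x, y) + |t - s|`. -/
def coneDist (p q : OpenCone X) : ℝ :=
  min (p.2 : ℝ) (q.2 : ℝ) * dist p.1 q.1 + |(p.2 : ℝ) - (q.2 : ℝ)|

theorem coneDist_comm (p q : OpenCone X) : coneDist p q = coneDist q p := by
  unfold coneDist
  rw [min_comm, dist_comm, abs_sub_comm]

theorem coneDist_triangle (hX : ∀ x y : X, dist x y ≤ 2) (p q r : OpenCone X) :
    coneDist p r ≤ coneDist p q + coneDist q r := by
  have aux : ∀ p q r : OpenCone X, (p.2 : ℝ) ≤ r.2 →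
      coneDist p r ≤ coneDist p q + coneDist q r := by
    rintro ⟨x, t, ht⟩ ⟨y, s, hs⟩ ⟨z, u, hu⟩ htu
    simp only [Set.mem_Ici] at ht hs hu
    change t ≤ u at htu
    change min t u * dist x z + |t - u| ≤
      (min t s * dist x y + |t - s|) + (min s u * dist y z + |s - u|)
    have h1 := dist_triangle x y z
    have h2 := hX x z
    have hxy : 0 ≤ dist x y := dist_nonneg
    have hyz : 0 ≤ dist y z := dist_nonneg
    rw [min_eq_left htu, abs_of_nonpos (sub_nonpos.2 htu)]
    rcases le_total t s with hts | hts
    · rw [min_eq_left hts]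
      have h3 : t ≤ min s u := le_min hts htu
      have h4 := abs_sub_le t s u
      have h5 : -(t - u) ≤ |t - u| := neg_le_abs _
      nlinarith [mul_le_mul_of_nonneg_right h3 hyz]
    · rw [min_eq_right hts, min_eq_left (hts.trans htu), abs_of_nonneg (sub_nonneg.2 hts),
        abs_of_nonpos (sub_nonpos.2 (hts.trans htu))]
      nlinarith [mul_le_mul_of_nonneg_left h1 (zero_le_one.trans hs),
        mul_nonneg (sub_nonneg.2 hts) (sub_nonneg.2 h2)]
  rcases le_total (p.2 : ℝ) (r.2 : ℝ) with h | h
  · exact aux p q r h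
  · have := aux r q p h
    rw [coneDist_comm p r, coneDist_comm p q, coneDist_comm q r]
    linarith

theorem dist_fst_le (p q : OpenCone X) : dist p.1 q.1 ≤ coneDist p q := by
  have h1 : (1 : ℝ) ≤ min (p.2 : ℝ) (q.2 : ℝ) := le_min p.2.2 q.2.2
  have h2 := mul_le_mul_of_nonneg_right h1 (dist_nonneg (x := p.1) (y := q.1))
  have h3 := abs_nonneg ((p.2 : ℝ) - (q.2 : ℝ))
  unfold coneDist
  linarith

theorem dist_snd_le (p q : OpenCone X) : dist p.2 q.2 ≤ coneDist p q := by
  have h1 : (0 : ℝ) ≤ min (p.2 : ℝ) (q.2 : ℝ) :=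
    zero_le_one.trans (le_min p.2.2 q.2.2)
  have h2 := mul_nonneg h1 (dist_nonneg (x := p.1) (y := q.1))
  rw [Subtype.dist_eq, Real.dist_eq]
  unfold coneDist
  linarith

/-- The metric of the open cone over a compact metric space of diameter at most `2`. -/
def metric (hX : ∀ x y : X, dist x y ≤ 2) : CompatibleMetric (OpenCone X) where
  dist := coneDist
  dist_self p := by simp [coneDist]
  dist_comm := coneDist_comm
  dist_triangle := coneDist_triangle hX
  eq_of_dist_eq_zero := by
    intro p q h
    refine Prod.ext ?_ ?_
    · exact dist_le_zero.1 (h ▸ dist_fst_le p q)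
    · exact dist_le_zero.1 (h ▸ dist_snd_le p q)
  hasBasis_nhds p := by
    have hb : (𝓝 p).HasBasis (fun ε : ℝ => 0 < ε)
        (fun ε => {q : OpenCone X | dist q.1 p.1 < ε ∧ dist q.2 p.2 < ε}) := by
      have hs : ∀ ε : ℝ, {q : OpenCone X | dist q.1 p.1 < ε ∧ dist q.2 p.2 < ε} =
          Metric.ball (α := X × Set.Ici (1 : ℝ)) p ε := fun ε => by
        ext q
        exact max_lt_iff.symm
      simp only [hs]
      exact Metric.nhds_basis_ball (α := X × Set.Ici (1 : ℝ))
    refine hb.to_hasBasis (fun ε hε => ⟨ε, hε, fun q hq => ?_⟩) fun ε hε => ?_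
    · exact ⟨(dist_fst_le q p).trans_lt hq, (dist_snd_le q p).trans_lt hq⟩
    · have ht : (1 : ℝ) ≤ p.2 := p.2.2
      refine ⟨ε / (p.2 + 1), by positivity, fun q hq => ?_⟩
      obtain ⟨h1, h2⟩ := hq
      rw [Subtype.dist_eq, Real.dist_eq] at h2
      have h3 : min (q.2 : ℝ) (p.2 : ℝ) * dist q.1 p.1 ≤ p.2 * (ε / (p.2 + 1)) :=
        mul_le_mul (min_le_right _ _) h1.le dist_nonneg (by linarith)
      have h4 : (p.2 : ℝ) * (ε / (p.2 + 1)) + ε / (p.2 + 1) = ε := by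
        field_simp
      change coneDist q p < ε
      unfold coneDist
      linarith

theorem lipschitzAction (hX : ∀ x y : X, dist x y ≤ 2) {Γ : Type*} [Group Γ] [MulAction Γ X]
    (hL : ∀ g : Γ, ∃ K : ℝ≥0, LipschitzWith K fun x : X => g • x) :
    (metric hX).LipschitzAction Γ := by
  intro g
  obtain ⟨K, hK⟩ := hL g
  refine ⟨max K 1, fun p q => ?_⟩
  have h1 := hK.dist_le_mul p.1 q.1
  have h2 : (0 : ℝ) ≤ min (p.2 : ℝ) (q.2 : ℝ) :=
    zero_le_one.trans (le_min p.2.2 q.2.2)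
  have h3 : (K : ℝ) * dist p.1 q.1 ≤ max (K : ℝ) 1 * dist p.1 q.1 :=
    mul_le_mul_of_nonneg_right (le_max_left _ _) dist_nonneg
  have h4 := mul_le_mul_of_nonneg_left (h1.trans h3) h2
  have h5 : |(p.2 : ℝ) - q.2| ≤ max (K : ℝ) 1 * |(p.2 : ℝ) - q.2| :=
    le_mul_of_one_le_left (abs_nonneg _) (le_max_right _ _)
  change min (p.2 : ℝ) (q.2 : ℝ) * dist (g • p.1) (g • q.1) + |(p.2 : ℝ) - q.2| ≤
    max (K : ℝ) 1 * (min (p.2 : ℝ) (q.2 : ℝ) * dist p.1 q.1 + |(p.2 : ℝ) - q.2|)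
  linarith

section Roe

variable [CompactSpace X] [MeasurableSpace X] [BorelSpace X] (μ : Measure X)
  (hX : ∀ x y : X, dist x y ≤ 2)

/-- The Roe `*`-algebra of the open cone, on the module `L²(X × [1, ∞), μ × λ)`. -/
abbrev roeStar : NonUnitalStarSubalgebra ℂ (BL2 (measure μ)) :=
  roeStarAlgebra (measure μ) (metric hX)

/-- The Roe algebra of the open cone. -/
abbrev roe : NonUnitalStarSubalgebra ℂ (BL2 (measure μ)) :=
  roeAlgebra (measure μ) (metric hX)

variable {Γ : Type*} [Group Γ] [MulAction Γ X] (ℓ : ProperLength Γ)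

/-- The Roe `*`-algebra of the unified warped cone: the open cone with its metric warped along the
action `γ (x, t) = (γ x, t)`. -/
abbrev warpedRoeStar : NonUnitalStarSubalgebra ℂ (BL2 (measure μ)) :=
  roeStarAlgebra (measure μ) ((metric hX).warped ℓ)

/-- The Roe algebra of the unified warped cone. -/
abbrev warpedRoe : NonUnitalStarSubalgebra ℂ (BL2 (measure μ)) :=
  roeAlgebra (measure μ) ((metric hX).warped ℓ)

variable {μ} [SigmaFinite μ]

theorem normalizes_roeStar (hL : ∀ g : Γ, ∃ K : ℝ≥0, LipschitzWith K fun x : X => g • x)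
    (hμ : NonsingularAction Γ μ) :
    Normalizes (roeStar μ hX) (koopman (nonsingularAction hμ)) :=
  normalizes_roeStarAlgebra _ _ (lipschitzAction hX hL)

theorem normalizes_roe (hL : ∀ g : Γ, ∃ K : ℝ≥0, LipschitzWith K fun x : X => g • x)
    (hμ : NonsingularAction Γ μ) :
    Normalizes (roe μ hX) (koopman (nonsingularAction hμ)) :=
  normalizes_roeAlgebra _ _ (lipschitzAction hX hL)

end Roe

end OpenCone

end

/-! Surjectivity of `Ψ` on the Roe `*`-algebras is geometric. A warped distance below `R` is
realized by a chain of moves and jumps, and all the jumps of a chain can be collected into one group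
element of length at most `R`; the Lipschitz constants control what this does to the moves. By
properness of the length only finitely many group elements occur, so an operator of finite warped
propagation lives near the union of finitely many graphs (`exists_smul_dist_le_of_warpedDist_lt`).
Bounded geometry provides a countable partition into uniformly bounded pieces `A z` whose centres
have bounded multiplicity. In each row `χ_{A z} T` the columns are distributed among the finitely
many `g`. For fixed `g` the blocks have orthogonal ranges and domains of bounded multiplicity, so
they add up to a bounded operator `S_g` (`exists_blockSum`), and `S_g π(g)⁻¹` has finite propagation
for the original metric. Hence `T = ∑ S_g` has the required form (`exists_eq_sum_mul_koopman`).

Injectivity modulo compact operators uses freeness. On the compact space `X` the displacement of `g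
≠ 1` is bounded below, and the cone multiplies it by the height, so `g` moves points arbitrarily far
outside compact sets (`OpenCone.expandsAtInfinity`). Consequently, on a bounded set `A` far out, the
terms `T_g π(g)` with `g ≠ 1` do not meet the support of `χ_A T_1`, and `χ_A T_1` is a compression
of the whole sum (`exists_isCompact_indOp_mul_eq`). If the sum is compact, its part outside a large
compact set is small. Norm localization passes from such bounded sets to the whole part of `T_1`
outside the compact set, which is therefore small as well, while the remaining part of `T_1` is
compact by local compactness (`isCompactOperator_coeff_one`). For coefficients in the Roe algebra
the argument is run on finite propagation approximants. Their propagation grows as the approximation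
improves, so it matters that the localization constant `c` does not depend on the propagation.

Density of the image for the Roe algebras follows from the decomposition on the dense Roe
`*`-algebra. Compact operators are norm limits of their compressions to compact sets, which have
finite propagation. -/

/-! ## Sums of operators with orthogonal ranges -/

section BlockSum

variable {H ι : Type*} [NormedAddCommGroup H] [InnerProductSpace ℂ H] [CompleteSpace H]

/-- A family of operators with orthogonal ranges and square-summable values has a bounded sum. -/
theorem exists_mul_eq_of_orthogonal {P Q : ι → H →L[ℂ] H} (hstar : ∀ i, star (P i) = P i)
    (horth : ∀ i j, i ≠ j → P i * P j = 0) (hPQ : ∀ i, P i * Q i = Q i) {M : ℝ}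
    (hM : ∀ (s : Finset ι) (ξ : H), ∑ i ∈ s, ‖Q i ξ‖ ^ 2 ≤ M * ‖ξ‖ ^ 2) :
    ∃ S : H →L[ℂ] H, ∀ i, P i * S = Q i := by
  classical
  let V : ∀ i, LinearMap.range (P i : H →ₗ[ℂ] H) →ₗᵢ[ℂ] H := fun i => Submodule.subtypeₗᵢ _
  have hV : OrthogonalFamily ℂ (fun i => LinearMap.range (P i : H →ₗ[ℂ] H)) V := by
    rintro i j hij ⟨_, a, rfl⟩ ⟨_, b, rfl⟩
    change inner ℂ (P i a) (P j b) = 0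
    rw [← ContinuousLinearMap.adjoint_inner_right, ← ContinuousLinearMap.star_eq_adjoint, hstar,
      ← mul_apply_eq_comp, horth i j hij, zero_apply,
      inner_zero_right]
  let f : H → ∀ i, LinearMap.range (P i : H →ₗ[ℂ] H) := fun ξ i =>
    ⟨Q i ξ, Q i ξ, by
      change (P i * Q i) ξ = _
      rw [hPQ]⟩
  -- For an orthogonal family, summability is the same as summability of the squared norms, whose
  -- partial sums are bounded by `hM`.
  have hsum : ∀ ξ, Summable fun i => Q i ξ := fun ξ =>
    (hV.summable_iff_norm_sq_summable (f ξ)).2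
      (summable_of_sum_le (fun i => sq_nonneg _) fun s => hM s ξ)
  have hM0 : ∀ ξ : H, 0 ≤ M * ‖ξ‖ ^ 2 := fun ξ => by simpa using hM ∅ ξ
  let S₀ : H →ₗ[ℂ] H :=
    { toFun := fun ξ => ∑' i, Q i ξ
      map_add' := fun ξ η => by
        rw [← (hsum ξ).tsum_add (hsum η)]
        simp only [map_add]
      map_smul' := fun c ξ => by
        rw [RingHom.id_apply, ← (hsum ξ).tsum_const_smul c]
        simp only [map_smul] }
  -- Pythagoras bounds the finite partial sums by `√M * ‖ξ‖`, and the bound passes to the limit.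
  have hbound : ∀ ξ, ‖S₀ ξ‖ ≤ √M * ‖ξ‖ := by
    intro ξ
    have h1 : Tendsto (fun s : Finset ι => ‖∑ i ∈ s, Q i ξ‖) atTop (𝓝 ‖S₀ ξ‖) :=
      (hsum ξ).hasSum.norm
    refine le_of_tendsto h1 (Eventually.of_forall fun s => ?_)
    have h2 : ‖∑ i ∈ s, Q i ξ‖ ^ 2 = ∑ i ∈ s, ‖Q i ξ‖ ^ 2 := hV.norm_sum (f ξ) s
    have h3 : ‖∑ i ∈ s, Q i ξ‖ ≤ √(M * ‖ξ‖ ^ 2) := Real.le_sqrt_of_sq_le (h2 ▸ hM s ξ)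
    rwa [Real.sqrt_mul' _ (sq_nonneg _), Real.sqrt_sq (norm_nonneg _)] at h3
  refine ⟨S₀.mkContinuous _ hbound, fun j => ?_⟩
  ext1 ξ
  change P j (∑' i, Q i ξ) = Q j ξ
  -- Only the term `j` survives, since `P j * Q i = P j * P i * Q i = 0` for `i ≠ j`.
  rw [(P j).map_tsum (hsum ξ), tsum_eq_single j]
  · rw [← mul_apply_eq_comp, hPQ]
  · intro i hij
    rw [← hPQ i, ← mul_apply_eq_comp, ← mul_assoc, horth j i hij.symm, zero_mul,
      zero_apply]

end BlockSum

/-! ## Projections of measurable sets -/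

section IndOp

variable {Y : Type*} [MeasurableSpace Y] {ν : Measure Y}

theorem memLp_top_indicator_one {A : Set Y} (hA : MeasurableSet A) :
    MemLp (A.indicator fun _ => (1 : ℂ)) ∞ ν :=
  memLp_top_of_bound ((measurable_const.indicator hA).aestronglyMeasurable) 1
    (Eventually.of_forall fun y => by by_cases h : y ∈ A <;> simp [h])

theorem indOp_ae {A : Set Y} (hA : MeasurableSet A) (ξ : L2 ν) :
    indOp ν hA ξ =ᵐ[ν] A.indicator ξ := by
  filter_upwards [fnOp_ae (memLp_top_indicator_one hA) ξ] with y hy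
  refine Eq.trans hy ?_
  by_cases h : y ∈ A <;> simp [h]

theorem indOp_mul {A B : Set Y} (hA : MeasurableSet A) (hB : MeasurableSet B) :
    indOp ν hA * indOp ν hB = indOp ν (hA.inter hB) := by
  ext ξ
  filter_upwards [indOp_ae hA (indOp ν hB ξ), indOp_ae hB ξ, indOp_ae (hA.inter hB) ξ]
    with y h1 h2 h3
  rw [mul_apply_eq_comp, h1, h3, Set.inter_comm]
  by_cases h : y ∈ A <;> by_cases h' : y ∈ B <;> simp [h, h', h2]

theorem indOp_congr {A B : Set Y} (hA : MeasurableSet A) (hB : MeasurableSet B) (h : A = B) :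
    indOp ν hA = indOp ν hB := by
  subst h; rfl

theorem indOp_eq_zero {A : Set Y} (hA : MeasurableSet A) (h : A = ∅) : indOp ν hA = 0 :=
  fnOp_zero _ fun y => by simp [h]

theorem indOp_mul_self {A : Set Y} (hA : MeasurableSet A) :
    indOp ν hA * indOp ν hA = indOp ν hA := by
  rw [indOp_mul]
  exact indOp_congr _ _ (Set.inter_self A)

theorem indOp_mul_comm {A B : Set Y} (hA : MeasurableSet A) (hB : MeasurableSet B) :
    indOp ν hA * indOp ν hB = indOp ν hB * indOp ν hA := by
  rw [indOp_mul, indOp_mul]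
  exact indOp_congr _ _ (Set.inter_comm A B)

theorem indOp_mul_eq_zero {A B : Set Y} (hA : MeasurableSet A) (hB : MeasurableSet B)
    (h : Disjoint A B) : indOp ν hA * indOp ν hB = 0 := by
  rw [indOp_mul]
  exact indOp_eq_zero _ h.inter_eq

theorem star_indOp {A : Set Y} (hA : MeasurableSet A) : star (indOp ν hA) = indOp ν hA := by
  have hfun : (fun y => star (A.indicator (fun _ => (1 : ℂ)) y)) =
      A.indicator fun _ => (1 : ℂ) := by
    ext y
    by_cases h : y ∈ A <;> simp [h]
  have hm := memLp_top_indicator_one (ν := ν) hA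
  have hm' : MemLp (fun y => star (A.indicator (fun _ => (1 : ℂ)) y)) ∞ ν := by rwa [hfun]
  exact (star_fnOp hm hm').trans (fnOp_congr _ _ hfun)

theorem norm_indOp_apply_le {A : Set Y} (hA : MeasurableSet A) (ξ : L2 ν) :
    ‖indOp ν hA ξ‖ ≤ ‖ξ‖ := by
  refine Lp.norm_le_norm_of_ae_le ?_
  filter_upwards [indOp_ae hA ξ] with y hy
  rw [hy]
  exact norm_indicator_le_norm_self _ _

theorem norm_indOp_le {A : Set Y} (hA : MeasurableSet A) : ‖indOp ν hA‖ ≤ 1 :=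
  ContinuousLinearMap.opNorm_le_bound _ zero_le_one fun ξ => by
    rw [one_mul]; exact norm_indOp_apply_le hA ξ

theorem norm_indOp_mul_le {A : Set Y} (hA : MeasurableSet A) (T : BL2 ν) :
    ‖indOp ν hA * T‖ ≤ ‖T‖ :=
  (norm_mul_le _ _).trans (mul_le_of_le_one_left (norm_nonneg _) (norm_indOp_le hA))

theorem norm_mul_indOp_le {A : Set Y} (hA : MeasurableSet A) (T : BL2 ν) :
    ‖T * indOp ν hA‖ ≤ ‖T‖ :=
  (norm_mul_le _ _).trans (mul_le_of_le_one_right (norm_nonneg _) (norm_indOp_le hA))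

theorem indOp_add_compl {A : Set Y} (hA : MeasurableSet A) :
    indOp ν hA + indOp ν hA.compl = 1 := by
  ext ξ
  filter_upwards [indOp_ae hA ξ, indOp_ae hA.compl ξ,
    Lp.coeFn_add (indOp ν hA ξ) (indOp ν hA.compl ξ)] with y h1 h2 h3
  rw [add_apply, h3, Pi.add_apply, h1, h2, one_apply_eq_self]
  exact congrFun (Set.indicator_self_add_compl A ξ) y

theorem fnOp_mul_indOp {f : Y → ℂ} (hf : MemLp f ∞ ν) {A : Set Y} (hA : MeasurableSet A)
    (h : Function.support f ⊆ A) : fnOp ν hf * indOp ν hA = fnOp ν hf := by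
  ext ξ
  filter_upwards [fnOp_ae hf (indOp ν hA ξ), fnOp_ae hf ξ, indOp_ae hA ξ] with y h1 h2 h3
  rw [mul_apply_eq_comp, h1, h2, h3]
  by_cases hy : y ∈ A
  · rw [Set.indicator_of_mem hy]
  · have : f y = 0 := by
      by_contra h0
      exact hy (h h0)
    rw [this, zero_mul, zero_mul]

theorem indOp_mul_fnOp {f : Y → ℂ} (hf : MemLp f ∞ ν) {A : Set Y} (hA : MeasurableSet A)
    (h : Function.support f ⊆ A) : indOp ν hA * fnOp ν hf = fnOp ν hf := by
  ext ξ
  filter_upwards [indOp_ae hA (fnOp ν hf ξ), fnOp_ae hf ξ] with y h1 h2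
  rw [mul_apply_eq_comp, h1]
  by_cases hy : y ∈ A
  · rw [Set.indicator_of_mem hy]
  · have : f y = 0 := by
      by_contra h0
      exact hy (h h0)
    rw [Set.indicator_of_notMem hy, h2, this, zero_mul]

theorem indOp_mul_fnOp_of_eqOn_one {f : Y → ℂ} (hf : MemLp f ∞ ν) {A : Set Y}
    (hA : MeasurableSet A) (h : ∀ y ∈ A, f y = 1) :
    indOp ν hA * fnOp ν hf = indOp ν hA ∧ fnOp ν hf * indOp ν hA = indOp ν hA := by
  constructor
  · ext ξ
    filter_upwards [indOp_ae hA (fnOp ν hf ξ), fnOp_ae hf ξ, indOp_ae hA ξ] with y h1 h2 h3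
    rw [mul_apply_eq_comp, h1, h3]
    by_cases hy : y ∈ A
    · rw [Set.indicator_of_mem hy, Set.indicator_of_mem hy, h2, h y hy, one_mul]
    · rw [Set.indicator_of_notMem hy, Set.indicator_of_notMem hy]
  · ext ξ
    filter_upwards [fnOp_ae hf (indOp ν hA ξ), indOp_ae hA ξ] with y h2 h3
    rw [mul_apply_eq_comp, h2, h3]
    by_cases hy : y ∈ A
    · rw [h y hy, one_mul]
    · rw [Set.indicator_of_notMem hy, mul_zero]

/-- An operator is zero if it is zero after compression to each set of a countable cover. -/
theorem eq_zero_of_indOp_mul {ι : Type*} [Countable ι] {A : ι → Set Y}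
    (hA : ∀ i, MeasurableSet (A i)) (hcov : ∀ y, ∃ i, y ∈ A i) {S : BL2 ν}
    (h : ∀ i, indOp ν (hA i) * S = 0) : S = 0 := by
  ext ξ
  have h1 : ∀ᵐ y ∂ν, ∀ i, (indOp ν (hA i) (S ξ)) y = (A i).indicator (S ξ) y :=
    ae_all_iff.2 fun i => indOp_ae (hA i) (S ξ)
  filter_upwards [h1, Lp.coeFn_zero ℂ 2 ν] with y h1 h0
  obtain ⟨i, hi⟩ := hcov y
  have h2 := h1 i
  have h3 : indOp ν (hA i) (S ξ) = 0 := by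
    rw [← mul_apply_eq_comp, h i, zero_apply]
  rw [h3, Set.indicator_of_mem hi] at h2
  rw [← h2, zero_apply]

theorem eq_zero_of_mul_indOp {ι : Type*} [Countable ι] {A : ι → Set Y}
    (hA : ∀ i, MeasurableSet (A i)) (hcov : ∀ y, ∃ i, y ∈ A i) {S : BL2 ν}
    (h : ∀ i, S * indOp ν (hA i) = 0) : S = 0 := by
  rw [← star_star S, eq_zero_of_indOp_mul hA hcov (S := star S), star_zero]
  intro i
  rw [← star_indOp (hA i), ← star_mul, h, star_zero]

/-- An operator supported on finitely many pieces of a countable partition is a finite sum. -/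
theorem eq_sum_of_indOp_mul_eq_zero {ι : Type*} [Countable ι] {A : ι → Set Y}
    (hA : ∀ i, MeasurableSet (A i)) (hcov : ∀ y, ∃ i, y ∈ A i)
    (hdisj : Pairwise fun i j => Disjoint (A i) (A j)) {S : BL2 ν} (s : Finset ι)
    (h : ∀ i ∉ s, indOp ν (hA i) * S = 0) : S = ∑ i ∈ s, indOp ν (hA i) * S := by
  classical
  rw [← sub_eq_zero]
  refine eq_zero_of_indOp_mul hA hcov fun i => ?_
  have h1 : ∀ j, indOp ν (hA i) * (indOp ν (hA j) * S) =
      if i = j then indOp ν (hA i) * S else 0 := by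
    intro j
    rw [← mul_assoc]
    split_ifs with hij
    · subst hij
      rw [indOp_mul_self]
    · rw [indOp_mul_eq_zero _ _ (hdisj hij), zero_mul]
  rw [mul_sub, Finset.mul_sum, Finset.sum_congr rfl fun j _ => h1 j, Finset.sum_ite_eq]
  split_ifs with hi
  · rw [sub_self]
  · rw [h i hi, sub_zero]

theorem norm_sq_eq_integral (η : L2 ν) : ‖η‖ ^ 2 = ∫ y, ‖η y‖ ^ 2 ∂ν := by
  rw [← inner_self_eq_norm_sq (𝕜 := ℂ), L2.inner_def, ← integral_re (L2.integrable_inner η η)]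
  exact integral_congr_ae (Eventually.of_forall fun y => inner_self_eq_norm_sq (𝕜 := ℂ) (η y))

theorem integrable_norm_sq (η : L2 ν) : Integrable (fun y => ‖η y‖ ^ 2) ν :=
  (Lp.memLp η).norm.integrable_sq

/-- Pointwise, the sum of the `|χ_{W i} ξ|²` is `|ξ|²` times the number of indices in `s` whose set
contains the point, and this number is at most `N`. Integrating gives the bound. -/
theorem sum_norm_indOp_sq_le {ι : Type*} {W : ι → Set Y} (hW : ∀ i, MeasurableSet (W i)) {N : ℕ}
    (hN : ∀ (s : Finset ι) (y : Y), (∀ i ∈ s, y ∈ W i) → s.card ≤ N) (s : Finset ι) (ξ : L2 ν) :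
    ∑ i ∈ s, ‖indOp ν (hW i) ξ‖ ^ 2 ≤ N * ‖ξ‖ ^ 2 := by
  classical
  rw [Finset.sum_congr rfl fun i _ => norm_sq_eq_integral _,
    ← integral_finsetSum _ fun i _ => integrable_norm_sq _, norm_sq_eq_integral,
    ← integral_const_mul]
  refine integral_mono_ae (integrable_finsetSum _ fun i _ => integrable_norm_sq _)
    ((integrable_norm_sq ξ).const_mul _) ?_
  have hall : ∀ᵐ y ∂ν, ∀ i ∈ s, (indOp ν (hW i) ξ) y = (W i).indicator ξ y :=
    (s.eventually_all).2 fun i _ => indOp_ae (hW i) ξ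
  filter_upwards [hall] with y hy
  have h1 : ∀ i ∈ s, ‖(indOp ν (hW i) ξ) y‖ ^ 2 = if y ∈ W i then ‖ξ y‖ ^ 2 else 0 := by
    intro i hi
    rw [hy i hi]
    by_cases h : y ∈ W i <;> simp [h]
  change ∑ i ∈ s, ‖(indOp ν (hW i) ξ) y‖ ^ 2 ≤ (N : ℝ) * ‖ξ y‖ ^ 2
  rw [Finset.sum_congr rfl h1, ← Finset.sum_filter, Finset.sum_const, nsmul_eq_mul]
  refine mul_le_mul_of_nonneg_right ?_ (sq_nonneg _)
  exact_mod_cast hN _ y fun i hi => (Finset.mem_filter.1 hi).2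

/-- For a partition `A` and sets `W i` of bounded multiplicity, the blocks
`χ_{A i} T χ_{W i}` assemble to a bounded operator. -/
theorem exists_blockSum {ι : Type*} {A W : ι → Set Y} (hA : ∀ i, MeasurableSet (A i))
    (hdisj : Pairwise fun i j => Disjoint (A i) (A j)) (hW : ∀ i, MeasurableSet (W i)) {N : ℕ}
    (hN : ∀ (s : Finset ι) (y : Y), (∀ i ∈ s, y ∈ W i) → s.card ≤ N) (T : BL2 ν) :
    ∃ S : BL2 ν, ∀ i, indOp ν (hA i) * S = indOp ν (hA i) * T * indOp ν (hW i) := by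
  -- Disjointness of the `A i` makes the ranges orthogonal. Each block satisfies `‖χ_{A i} T χ_{W i}
  -- ξ‖² ≤ ‖T‖² ‖χ_{W i} ξ‖²`, and the multiplicity bound sums these to `‖T‖² N ‖ξ‖²`.
  refine exists_mul_eq_of_orthogonal (fun i => star_indOp (hA i))
    (fun i j hij => indOp_mul_eq_zero _ _ (hdisj hij)) (fun i => ?_) (M := ‖T‖ ^ 2 * N)
    fun s ξ => ?_
  · rw [← mul_assoc, ← mul_assoc, indOp_mul_self]
  · calc ∑ i ∈ s, ‖(indOp ν (hA i) * T * indOp ν (hW i)) ξ‖ ^ 2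
        ≤ ∑ i ∈ s, ‖T‖ ^ 2 * ‖indOp ν (hW i) ξ‖ ^ 2 := by
          refine Finset.sum_le_sum fun i _ => ?_
          rw [← mul_pow]
          refine pow_le_pow_left₀ (norm_nonneg _) ?_ 2
          exact (norm_indOp_apply_le (hA i) (T (indOp ν (hW i) ξ))).trans (T.le_opNorm _)
      _ ≤ ‖T‖ ^ 2 * N * ‖ξ‖ ^ 2 := by
          rw [← Finset.mul_sum, mul_assoc]
          exact mul_le_mul_of_nonneg_left (sum_norm_indOp_sq_le hW hN s ξ) (sq_nonneg _)

end IndOp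

/-! ## Compact operators -/

theorem IsCompactOperator.mul_left {H : Type*} [NormedAddCommGroup H] [NormedSpace ℂ H]
    {T : H →L[ℂ] H} (hT : IsCompactOperator T) (S : H →L[ℂ] H) :
    IsCompactOperator (S * T : H →L[ℂ] H) := hT.clm_comp S

theorem IsCompactOperator.mul_right {H : Type*} [NormedAddCommGroup H] [NormedSpace ℂ H]
    {T : H →L[ℂ] H} (hT : IsCompactOperator T) (S : H →L[ℂ] H) :
    IsCompactOperator (T * S : H →L[ℂ] H) := hT.comp_clm S

theorem isCompactOperator_sum {ι : Type*} (s : Finset ι) {H : Type*} [NormedAddCommGroup H]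
    [NormedSpace ℂ H] {T : ι → H →L[ℂ] H}
    (h : ∀ i ∈ s, IsCompactOperator (T i)) : IsCompactOperator (∑ i ∈ s, T i : H →L[ℂ] H) := by
  classical
  induction s using Finset.induction_on with
  | empty =>
    rw [Finset.sum_empty]
    exact isCompactOperator_zero
  | insert i s hi ih =>
    rw [Finset.sum_insert hi]
    exact IsCompactOperator.add (h i (Finset.mem_insert_self _ _))
      (ih fun j hj => h j (Finset.mem_insert_of_mem hj))

/-! ## Compatible metrics -/

section Metric

variable {Y : Type*} [TopologicalSpace Y]

theorem CompatibleMetric.t2Space (D : CompatibleMetric Y) : T2Space Y :=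
  let _ := D.toMetricSpace
  inferInstance

theorem CompatibleMetric.isOpen_thickening (D : CompatibleMetric Y) (A : Set Y) (e : ℝ) :
    IsOpen {y | ∃ a ∈ A, D.dist y a < e} := by
  let _ := D.toMetricSpace
  have : {y | ∃ a ∈ A, D.dist y a < e} = ⋃ a ∈ A, Metric.ball a e := by
    ext y
    simp only [Set.mem_ofPred_eq, Set.mem_iUnion, Metric.mem_ball, exists_prop]
    rfl
  rw [this]
  exact isOpen_biUnion fun _ _ => Metric.isOpen_ball

theorem CompatibleMetric.isOpen_ball (D : CompatibleMetric Y)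
    (a : Y) (e : ℝ) : IsOpen {y | D.dist y a < e} := by
  simpa using D.isOpen_thickening {a} e

theorem CompatibleMetric.exists_dist_le (D : CompatibleMetric Y)
    {K : Set Y} (hK : IsCompact K) : ∃ R, ∀ x ∈ K, ∀ y ∈ K, D.dist x y ≤ R := by
  let _ := D.toMetricSpace
  obtain ⟨R, hR⟩ := Metric.isBounded_iff.1 hK.isBounded
  exact ⟨R, fun x hx y hy => hR hx hy⟩

/-- Compactly supported cut-off functions. -/
theorem exists_cutoff [LocallyCompactSpace Y] [T2Space Y] {K U : Set Y} (hK : IsCompact K)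
    (hU : IsOpen U) (hKU : K ⊆ U) :
    ∃ f : C(Y, ℂ), HasCompactSupport f ∧ (∀ y ∈ K, f y = 1) ∧ tsupport f ⊆ U := by
  obtain ⟨f, h1, h2, h3, -⟩ := exists_continuousMap_one_of_isCompact_subset_isOpen hK hU hKU
  have hsupp : Function.support (fun y => (f y : ℂ)) = Function.support f := by
    ext y
    simp
  have hts : tsupport (fun y => (f y : ℂ)) = tsupport f := by
    rw [tsupport, hsupp, tsupport]
  refine ⟨⟨fun y => (f y : ℂ), by fun_prop⟩, ?_, fun y hy => ?_, ?_⟩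
  · change IsCompact (tsupport fun y => (f y : ℂ))
    rwa [hts]
  · change (f y : ℂ) = 1
    rw [h1 hy, Pi.one_apply, Complex.ofReal_one]
  · change tsupport (fun y => (f y : ℂ)) ⊆ U
    rwa [hts]

end Metric

/-! ## Propagation and local compactness in terms of measurable sets -/

section Propagation

variable {Y : Type*} [MeasurableSpace Y] {ν : Measure Y} [TopologicalSpace Y] [BorelSpace Y]
  {D : CompatibleMetric Y}

/-- Propagation is defined by functions in `C₀`, whereas the arguments below cut with measurable
sets. The gap between `r` and `q` leaves room for continuous cut-offs around `A` and `B`. These must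
have compact support, so `A` and `B` are first cut down by a compact exhaustion. -/
theorem HasPropagationLE.indOp_mul_mul_indOp [LocallyCompactSpace Y] [SigmaCompactSpace Y]
    {r q : ℝ} (hr : 0 ≤ r)
    (hrq : r < q) {T : BL2 ν} (hT : HasPropagationLE D r T) {A B : Set Y} (hA : MeasurableSet A)
    (hB : MeasurableSet B) (h : ∀ x ∈ A, ∀ y ∈ B, q ≤ D.dist x y) :
    indOp ν hA * T * indOp ν hB = 0 := by
  have := D.t2Space
  let K : CompactExhaustion Y := default
  have hKm : ∀ n, MeasurableSet (K n) := fun n => (K.isCompact n).measurableSet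
  -- One `e` is spent on the neighbourhood of `A` and one on that of `B`; the third keeps the two
  -- supports strictly more than `r` apart.
  obtain ⟨e, he, hqe⟩ : ∃ e > 0, q = r + 3 * e := ⟨(q - r) / 3, by linarith, by ring⟩
  have hcut : ∀ (A : Set Y) (n : ℕ), ∃ f : C₀(Y, ℂ), (∀ y ∈ A ∩ K n, f y = 1) ∧
      ∀ y ∈ tsupport f, ∃ a ∈ A, D.dist y a < e := by
    intro A n
    have hc : IsCompact (closure (A ∩ K n)) :=
      (K.isCompact n).closure_of_subset Set.inter_subset_right
    have hsub : closure (A ∩ K n) ⊆ {y | ∃ a ∈ A, D.dist y a < e} := by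
      intro y hy
      obtain ⟨a, ha, haA⟩ := mem_closure_iff.1 hy {z | D.dist z y < e} (D.isOpen_ball y e)
        (by simpa [D.dist_self] using he)
      exact ⟨a, haA.1, by rw [D.dist_comm]; exact ha⟩
    obtain ⟨f, h1, h2, h3⟩ := exists_cutoff hc (D.isOpen_thickening A e) hsub
    exact ⟨⟨f, h1.is_zero_at_infty⟩, fun y hy => h2 y (subset_closure hy), fun y hy => h3 hy⟩
  have key : ∀ n m, indOp ν (hKm n) * (indOp ν hA * T * indOp ν hB) * indOp ν (hKm m) = 0 := by
    intro n m
    obtain ⟨f, hf1, hf2⟩ := hcut A n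
    obtain ⟨g, hg1, hg2⟩ := hcut B m
    have h0 : c0Op ν f * T * c0Op ν g = 0 := by
      refine hT f g ((D.lt_setDist_iff hr).2 ⟨r + e, by linarith, fun x hx y hy => ?_⟩)
      obtain ⟨a, ha, hxa⟩ := hf2 x hx
      obtain ⟨b, hb, hyb⟩ := hg2 y hy
      have h1 := h a ha b hb
      have h2 := D.dist_triangle a x b
      have h3 := D.dist_triangle x y b
      rw [D.dist_comm] at hxa
      linarith
    have e1 : indOp ν (hA.inter (hKm n)) * c0Op ν f = indOp ν (hA.inter (hKm n)) :=
      (indOp_mul_fnOp_of_eqOn_one _ _ hf1).1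
    have e2 : c0Op ν g * indOp ν (hB.inter (hKm m)) = indOp ν (hB.inter (hKm m)) :=
      (indOp_mul_fnOp_of_eqOn_one _ _ hg1).2
    calc indOp ν (hKm n) * (indOp ν hA * T * indOp ν hB) * indOp ν (hKm m)
        = (indOp ν hA * indOp ν (hKm n)) * T * (indOp ν hB * indOp ν (hKm m)) := by
          rw [indOp_mul_comm hA]; simp only [mul_assoc]
      _ = indOp ν (hA.inter (hKm n)) * (c0Op ν f * T * c0Op ν g) * indOp ν (hB.inter (hKm m)) := by
          rw [indOp_mul, indOp_mul, ← mul_assoc, ← mul_assoc, e1, mul_assoc _ (c0Op ν g), e2]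
      _ = 0 := by rw [h0, mul_zero, zero_mul]
  refine eq_zero_of_indOp_mul hKm K.exists_mem fun n => ?_
  exact eq_zero_of_mul_indOp hKm K.exists_mem fun m => key n m

/-- A multiplication operator absorbs the projection of its closed support, so it is enough to test
on closed supports. -/
theorem hasPropagationLE_of_indOp {r : ℝ} (hr : 0 ≤ r) {T : BL2 ν}
    (h : ∀ (A B : Set Y) (hA : MeasurableSet A) (hB : MeasurableSet B),
      (∃ q > r, ∀ x ∈ A, ∀ y ∈ B, q ≤ D.dist x y) → indOp ν hA * T * indOp ν hB = 0) :
    HasPropagationLE D r T := by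
  intro f g hfg
  have h0 := h _ _ (isClosed_tsupport f).measurableSet (isClosed_tsupport g).measurableSet
    ((D.lt_setDist_iff hr).1 hfg)
  have e1 : c0Op ν f * indOp ν (isClosed_tsupport f).measurableSet = c0Op ν f :=
    fnOp_mul_indOp _ _ (subset_tsupport f)
  have e2 : indOp ν (isClosed_tsupport g).measurableSet * c0Op ν g = c0Op ν g :=
    indOp_mul_fnOp _ _ (subset_tsupport g)
  calc c0Op ν f * T * c0Op ν g
      = c0Op ν f * (indOp ν (isClosed_tsupport f).measurableSet * T *
          indOp ν (isClosed_tsupport g).measurableSet) * c0Op ν g := by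
        rw [← mul_assoc, ← mul_assoc, e1, mul_assoc (c0Op ν f * T), e2]
    _ = 0 := by rw [h0, mul_zero, zero_mul]

/-- The projection `χ_K` absorbs a compactly supported cut-off that equals `1` on `K`. The converse
below uses that `f` absorbs the projection of its support. -/
theorem IsLocallyCompactOperator.indOp_mul [LocallyCompactSpace Y] [T2Space Y] {T : BL2 ν}
    (hT : IsLocallyCompactOperator T) {K : Set Y} (hK : IsCompact K) (hKm : MeasurableSet K) :
    IsCompactOperator (indOp ν hKm * T : BL2 ν) ∧ IsCompactOperator (T * indOp ν hKm : BL2 ν) := by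
  obtain ⟨f, h1, h2, -⟩ := exists_cutoff hK isOpen_univ (Set.subset_univ K)
  let F : C_c(Y, ℂ) := ⟨f, h1⟩
  have e : indOp ν hKm * ccOp ν F = indOp ν hKm ∧ ccOp ν F * indOp ν hKm = indOp ν hKm :=
    indOp_mul_fnOp_of_eqOn_one _ _ h2
  constructor
  · rw [← e.1, mul_assoc]
    exact (hT F).1.mul_left _
  · rw [← e.2, ← mul_assoc]
    exact (hT F).2.mul_right _

theorem isLocallyCompactOperator_of_indOp [T2Space Y] {T : BL2 ν}
    (h : ∀ (K : Set Y) (hKm : MeasurableSet K), IsCompact K →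
      IsCompactOperator (indOp ν hKm * T : BL2 ν) ∧ IsCompactOperator (T * indOp ν hKm : BL2 ν)) :
    IsLocallyCompactOperator T := by
  intro f
  obtain ⟨h1, h2⟩ := h _ (isClosed_tsupport f).measurableSet f.hasCompactSupport
  have e1 : ccOp ν f * indOp ν (isClosed_tsupport f).measurableSet = ccOp ν f :=
    fnOp_mul_indOp _ _ (subset_tsupport f)
  have e2 : indOp ν (isClosed_tsupport f).measurableSet * ccOp ν f = ccOp ν f :=
    indOp_mul_fnOp _ _ (subset_tsupport f)
  constructor
  · rw [← e1, mul_assoc]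
    exact h1.mul_left _
  · rw [← e2, ← mul_assoc]
    exact h2.mul_right _

end Propagation

/-! ## Compact operators and the Roe algebra -/

section Compact

variable {Y : Type*} [MeasurableSpace Y] {ν : Measure Y}

/-- Dominated convergence: `|ξ|²` dominates, and every point eventually lies in `A n`. -/
theorem tendsto_indOp_compl_apply {A : ℕ → Set Y} (hA : ∀ n, MeasurableSet (A n))
    (hmono : Monotone A) (hcov : ∀ y, ∃ n, y ∈ A n) (ξ : L2 ν) :
    Tendsto (fun n => ‖indOp ν (hA n).compl ξ‖) atTop (𝓝 0) := by
  have hall : ∀ᵐ y ∂ν, ∀ n, (indOp ν (hA n).compl ξ) y = (A n)ᶜ.indicator ξ y :=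
    ae_all_iff.2 fun n => indOp_ae (hA n).compl ξ
  have h1 : Tendsto (fun n => ∫ y, ‖(indOp ν (hA n).compl ξ) y‖ ^ 2 ∂ν) atTop
      (𝓝 (∫ _, (0 : ℝ) ∂ν)) := by
    refine tendsto_integral_of_dominated_convergence (fun y => ‖ξ y‖ ^ 2)
      (fun n => (integrable_norm_sq _).aestronglyMeasurable) (integrable_norm_sq ξ)
      (fun n => ?_) ?_
    · filter_upwards [hall] with y hy
      rw [hy n, norm_pow, norm_norm]
      exact pow_le_pow_left₀ (norm_nonneg _) (norm_indicator_le_norm_self _ _) 2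
    · filter_upwards [hall] with y hy
      obtain ⟨N, hN⟩ := hcov y
      refine tendsto_const_nhds.congr' ?_
      filter_upwards [eventually_ge_atTop N] with n hn
      rw [hy n, Set.indicator_of_notMem (by simpa using hmono hn hN)]
      simp
  simp only [← norm_sq_eq_integral, integral_zero] at h1
  have h2 := h1.sqrt
  simpa [Real.sqrt_sq (norm_nonneg _)] using h2

/-- The projections of the complements tend to zero strongly and are contractions, so the
convergence is uniform on the totally bounded image of the unit ball: a finite `ε / 2`-net is
enough. -/
theorem IsCompactOperator.exists_norm_indOp_compl_mul_le {T : BL2 ν} (hT : IsCompactOperator T)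
    {A : ℕ → Set Y} (hA : ∀ n, MeasurableSet (A n)) (hmono : Monotone A)
    (hcov : ∀ y, ∃ n, y ∈ A n) {ε : ℝ} (hε : 0 < ε) :
    ∃ N, ∀ n ≥ N, ‖indOp ν (hA n).compl * T‖ ≤ ε := by
  have htb : TotallyBounded (T '' Metric.closedBall 0 1) :=
    (hT.isCompact_closure_image_closedBall (f := (T : L2 ν →ₗ[ℂ] L2 ν))
      1).totallyBounded.subset subset_closure
  obtain ⟨t, htf, htc⟩ := Metric.totallyBounded_iff.1 htb (ε / 2) (by positivity)
  have hev : ∀ᶠ n in atTop, ∀ η ∈ t, ‖indOp ν (hA n).compl η‖ < ε / 2 :=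
    (htf.eventually_all).2 fun η _ =>
      (tendsto_indOp_compl_apply hA hmono hcov η).eventually_lt_const (by positivity)
  obtain ⟨N, hN⟩ := eventually_atTop.1 hev
  refine ⟨N, fun n hn => ContinuousLinearMap.opNorm_le_of_unit_norm hε.le fun ξ hξ => ?_⟩
  obtain ⟨η, hη, hξη⟩ := Set.mem_iUnion₂.1
    (htc (Set.mem_image_of_mem T (show ξ ∈ Metric.closedBall 0 1 by simp [hξ])))
  rw [Metric.mem_ball, dist_eq_norm] at hξη
  have h1 : (indOp ν (hA n).compl * T) ξ =
      indOp ν (hA n).compl (T ξ - η) + indOp ν (hA n).compl η := by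
    rw [← map_add, sub_add_cancel, mul_apply_eq_comp]
  rw [h1]
  refine (norm_add_le _ _).trans ?_
  have h2 := norm_indOp_apply_le (hA n).compl (T ξ - η)
  have h3 := hN n hn η hη
  linarith

variable [TopologicalSpace Y] [BorelSpace Y]

theorem IsCompactOperator.isLocallyCompactOperator {T : BL2 ν} (hT : IsCompactOperator T) :
    IsLocallyCompactOperator T := fun f =>
  ⟨hT.mul_left (ccOp ν f), hT.mul_right (ccOp ν f)⟩

variable [LocallyCompactSpace Y] [SigmaCompactSpace Y]

/-- The Roe algebra contains the compact operators. -/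
theorem IsCompactOperator.mem_roeAlgebra (D : CompatibleMetric Y) {T : BL2 ν}
    (hT : IsCompactOperator T) : T ∈ roeAlgebra ν D := by
  have := D.t2Space
  let K : CompactExhaustion Y := default
  have hKm : ∀ n, MeasurableSet (K n) := fun n => (K.isCompact n).measurableSet
  change T ∈ closure (roeStarAlgebra ν D : Set (BL2 ν))
  refine Metric.mem_closure_iff.2 fun ε hε => ?_
  obtain ⟨N₁, hN₁⟩ := hT.exists_norm_indOp_compl_mul_le hKm K.subset K.exists_mem
    (show 0 < ε / 3 by positivity)
  obtain ⟨N₂, hN₂⟩ := (isCompactOperator_star hT).exists_norm_indOp_compl_mul_le hKm K.subset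
    K.exists_mem (show 0 < ε / 3 by positivity)
  set n := max N₁ N₂
  set P := indOp ν (hKm n)
  set Q := indOp ν (hKm n).compl
  have hPQ : P + Q = 1 := indOp_add_compl _
  have h1 : ‖Q * T‖ ≤ ε / 3 := hN₁ n (le_max_left _ _)
  -- Passing to adjoints turns the left estimate for `star T` into a right estimate for `T`.
  have h2 : ‖T * Q‖ ≤ ε / 3 := by
    have h := hN₂ n (le_max_right _ _)
    rwa [← norm_star, star_mul, star_star, star_indOp] at h
  refine ⟨P * T * P, ⟨?_, ?_⟩, ?_⟩
  -- The compression `P * T * P` lives on `K n × K n`, so its propagation is bounded by the diameter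
  -- of `K n`.
  · obtain ⟨R, hR⟩ := D.exists_dist_le (K.isCompact n)
    refine ⟨max R 0, le_max_right _ _, hasPropagationLE_of_indOp (le_max_right _ _) ?_⟩
    rintro A B hA hB ⟨q, hq, hAB⟩
    have hRq : R < q := (le_max_left _ _).trans_lt hq
    by_cases hAK : Disjoint A (K n)
    · have : indOp ν hA * P = 0 := indOp_mul_eq_zero _ _ hAK
      simp only [← mul_assoc, this, zero_mul]
    · by_cases hBK : Disjoint (K n) B
      · have : P * indOp ν hB = 0 := indOp_mul_eq_zero _ _ hBK
        rw [mul_assoc, mul_assoc, this, mul_zero, mul_zero]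
      · obtain ⟨a, ha, haK⟩ := Set.not_disjoint_iff.1 hAK
        obtain ⟨b, hbK, hb⟩ := Set.not_disjoint_iff.1 hBK
        exact absurd (hR a haK b hbK) (not_le.2 (hRq.trans_le (hAB a ha b hb)))
  · exact IsCompactOperator.isLocallyCompactOperator ((hT.mul_left P).mul_right P)
  · have e : T - P * T * P = Q * T + P * (T * Q) := by
      calc T - P * T * P = (P + Q) * T * (P + Q) - P * T * P := by rw [hPQ, one_mul, mul_one]
        _ = Q * T * (P + Q) + P * (T * Q) := by noncomm_ring
        _ = _ := by rw [hPQ, mul_one]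
    rw [dist_eq_norm, e]
    have h3 := norm_add_le (Q * T) (P * (T * Q))
    have h4 : ‖P * (T * Q)‖ ≤ ‖T * Q‖ := norm_indOp_mul_le _ _
    linarith

/-- On the Roe `*`-algebra this is local compactness, and it survives norm limits because the
compact operators are norm closed. -/
theorem isCompactOperator_indOp_mul_of_mem_roeAlgebra {D : CompatibleMetric Y} {T : BL2 ν}
    (hT : T ∈ roeAlgebra ν D) {K : Set Y} (hK : IsCompact K) (hKm : MeasurableSet K) :
    IsCompactOperator (indOp ν hKm * T : BL2 ν) := by
  have := D.t2Space
  have hcl : IsClosed {T : BL2 ν | IsCompactOperator (indOp ν hKm * T : BL2 ν)} :=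
    isClosed_setOfPred_isCompactOperator.preimage (continuous_const_mul (indOp ν hKm))
  exact closure_minimal (fun S hS => (hS.2.indOp_mul hK hKm).1) hcl hT

end Compact

/-! ## The Koopman representation and measurable sets -/

section Koopman

variable {Γ Y : Type*} [Group Γ] [MulAction Γ Y] [MeasurableSpace Y] {ν : Measure Y}

theorem measurableSet_smul_preimage (hν : NonsingularAction Γ ν) (g : Γ) {A : Set Y}
    (hA : MeasurableSet A) : MeasurableSet ((fun y => g • y) ⁻¹' A) := (hν g).measurable hA

variable [SigmaFinite ν] (hν : NonsingularAction Γ ν)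

/-- This is `π(g) χ_A = χ_{gA} π(g)`, with `gA` written as a preimage under `g⁻¹` because
non-singularity gives measurability of preimages. -/
theorem koopman_mul_indOp (g : Γ) {A : Set Y} (hA : MeasurableSet A) :
    (koopman hν g : BL2 ν) * indOp ν hA =
      indOp ν (measurableSet_smul_preimage hν g⁻¹ hA) * (koopman hν g : BL2 ν) :=
  koopman_mul_fnOp hν g _ _ fun _ => rfl

theorem indOp_mul_koopman (g : Γ) {A : Set Y} (hA : MeasurableSet A) :
    indOp ν hA * (koopman hν g : BL2 ν) =
      (koopman hν g : BL2 ν) * indOp ν (measurableSet_smul_preimage hν g hA) := by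
  rw [koopman_mul_indOp]
  congr 1
  refine indOp_congr _ _ ?_
  ext y
  simp

theorem norm_mul_koopman_le (g : Γ) (T : BL2 ν) : ‖T * (koopman hν g : BL2 ν)‖ ≤ ‖T‖ := by
  refine (norm_mul_le _ _).trans (mul_le_of_le_one_right (norm_nonneg _) ?_)
  exact ContinuousLinearMap.opNorm_le_bound _ zero_le_one fun ξ => by
    rw [one_mul]; exact ((koopmanIsometry hν g).norm_map ξ).le

theorem koopman_mul_koopman (g k : Γ) :
    (koopman hν g : BL2 ν) * (koopman hν k : BL2 ν) = (koopman hν (g * k) : BL2 ν) := by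
  rw [map_mul, Submonoid.coe_mul]

end Koopman

/-! ## Displacement in a warped metric -/

section WarpChain

variable {Γ Y : Type*} [Group Γ] [TopologicalSpace Y] [MulAction Γ Y]

/-- There is a chain from `x` to `z` of moves in `Y` and jumps along the action, of total
length `s`. -/
inductive WarpChain (D : CompatibleMetric Y) (ℓ : ProperLength Γ) : Y → Y → ℝ → Prop
  | refl (x : Y) : WarpChain D ℓ x x 0
  | move (x : Y) {y z : Y} {s : ℝ} : WarpChain D ℓ y z s → WarpChain D ℓ x z (D.dist x y + s)
  | jump (g : Γ) {y z : Y} {s : ℝ} : WarpChain D ℓ (g • y) z s → WarpChain D ℓ y z (ℓ.len g + s)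

variable {D : CompatibleMetric Y} {ℓ : ProperLength Γ}

namespace WarpChain

theorem nonneg {x y : Y} {s : ℝ} (h : WarpChain D ℓ x y s) : 0 ≤ s := by
  induction h with
  | refl => exact le_rfl
  | move x _ ih => exact add_nonneg (D.dist_nonneg _ _) ih
  | jump g _ ih => exact add_nonneg (ℓ.nonneg g) ih

theorem of_dist (x y : Y) : WarpChain D ℓ x y (D.dist x y) := by
  simpa using (refl (ℓ := ℓ) (D := D) y).move x

theorem of_smul (g : Γ) (y : Y) : WarpChain D ℓ y (g • y) (ℓ.len g) := by
  simpa using (refl (ℓ := ℓ) (D := D) (g • y)).jump g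

theorem trans {x y z : Y} {s t : ℝ} (h : WarpChain D ℓ x y s) (h' : WarpChain D ℓ y z t) :
    WarpChain D ℓ x z (s + t) := by
  induction h with
  | refl => simpa using h'
  | move x _ ih =>
    rw [add_assoc]
    exact (ih h').move x
  | jump g _ ih =>
    rw [add_assoc]
    exact (ih h').jump g

theorem symm {x y : Y} {s : ℝ} (h : WarpChain D ℓ x y s) : WarpChain D ℓ y x s := by
  induction h with
  | refl x => exact refl x
  | @move x y z s _ ih =>
    rw [add_comm, D.dist_comm]
    exact ih.trans (of_dist y x)
  | @jump g y z s _ ih =>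
    have h1 : WarpChain D ℓ (g • y) y (ℓ.len g) := by
      simpa [ℓ.inv] using of_smul (D := D) (ℓ := ℓ) g⁻¹ (g • y)
    rw [add_comm]
    exact ih.trans h1

/-- Induction along the chain. If `g` carries `y` close to `z`, it carries `x` close to `z` too,
since it stretches the first move from `x` to `y` by at most `L`. A first jump by `g` is absorbed by
multiplying on the right by `g`. The bound `s ≤ R` ensures that every group element met on the way
has Lipschitz constant `L`. -/
theorem exists_smul {R L : ℝ} (hL0 : 0 ≤ L)
    (hL : ∀ g : Γ, ℓ.len g ≤ R → ∀ x y, D.dist (g • x) (g • y) ≤ L * D.dist x y)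
    {x z : Y} {s : ℝ} (h : WarpChain D ℓ x z s) (hs : s ≤ R) :
    ∃ g : Γ, ℓ.len g ≤ s ∧ D.dist (g • x) z ≤ L * s := by
  induction h with
  | refl x => exact ⟨1, ((ℓ.eq_zero_iff 1).2 rfl).le, by simp [D.dist_self]⟩
  | @move x y z s _ ih =>
    have h0 := D.dist_nonneg x y
    obtain ⟨g, hg, hgz⟩ := ih (by linarith)
    refine ⟨g, by linarith, ?_⟩
    have h1 := D.dist_triangle (g • x) (g • y) z
    have h2 := hL g (by linarith) x y
    linarith
  | @jump g y z s _ ih =>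
    have h0 := ℓ.nonneg g
    obtain ⟨k, hk, hkz⟩ := ih (by linarith)
    refine ⟨k * g, by linarith [ℓ.mul_le k g], ?_⟩
    rw [mul_smul]
    have := mul_nonneg hL0 h0
    linarith

end WarpChain

/-- The infimum of the lengths of chains. -/
noncomputable def chainDist (D : CompatibleMetric Y) (ℓ : ProperLength Γ) (x y : Y) : ℝ :=
  sInf {s | WarpChain D ℓ x y s}

theorem chainDist_le {x y : Y} {s : ℝ} (h : WarpChain D ℓ x y s) : chainDist D ℓ x y ≤ s :=
  csInf_le ⟨0, fun _ ht => WarpChain.nonneg ht⟩ h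

theorem exists_warpChain_lt {x y : Y} {R : ℝ} (h : chainDist D ℓ x y < R) :
    ∃ s < R, WarpChain D ℓ x y s := by
  obtain ⟨s, hs, hsR⟩ := exists_lt_of_csInf_lt ⟨_, WarpChain.of_dist x y⟩ h
  exact ⟨s, hsR, hs⟩

theorem chainDist_comm (x y : Y) : chainDist D ℓ x y = chainDist D ℓ y x := by
  unfold chainDist
  congr 1
  ext s
  exact ⟨WarpChain.symm, WarpChain.symm⟩

theorem chainDist_triangle (x y z : Y) :
    chainDist D ℓ x z ≤ chainDist D ℓ x y + chainDist D ℓ y z := by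
  refine le_of_forall_pos_le_add fun ε hε => ?_
  obtain ⟨s, hs, h⟩ := exists_warpChain_lt
    (show chainDist D ℓ x y < chainDist D ℓ x y + ε / 2 by linarith)
  obtain ⟨t, ht, h'⟩ := exists_warpChain_lt
    (show chainDist D ℓ y z < chainDist D ℓ y z + ε / 2 by linarith)
  have := chainDist_le (h.trans h')
  linarith

/-- The chain distance meets every condition of admissibility except that it is not known to
separate points. Its maximum with the admissible metric `min (D.dist x y) m` does separate points,
and the warped distance dominates every admissible metric. -/
theorem chainDist_le_warpedDist (x y : Y) : chainDist D ℓ x y ≤ warpedDist D ℓ x y := by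
  obtain ⟨m, hm, hℓ⟩ := ℓ.exists_pos_le
  have hadm := isWarpAdmissible_min D ℓ hm hℓ
  have : IsWarpAdmissible D ℓ fun x y => max (chainDist D ℓ x y) (min (D.dist x y) m) :=
    { self := fun x => by
        rw [hadm.self]
        exact max_eq_right (chainDist_le (.refl x))
      comm := fun x y => by rw [hadm.comm, chainDist_comm]
      triangle := fun x y z => max_le
        ((chainDist_triangle x y z).trans (add_le_add (le_max_left _ _) (le_max_left _ _)))
        ((hadm.triangle x y z).trans (add_le_add (le_max_right _ _) (le_max_right _ _)))
      eq_of_eq_zero := fun x y h => hadm.eq_of_eq_zero x y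
        (le_antisymm ((le_max_right _ _).trans h.le) (le_min (D.dist_nonneg x y) hm.le))
      le_dist := fun x y => max_le (chainDist_le (.of_dist x y)) (hadm.le_dist x y)
      le_len := fun y g => max_le (chainDist_le (.of_smul g y)) (hadm.le_len y g) }
  exact (le_max_left _ _).trans (le_warpedDist D ℓ this x y)

theorem CompatibleMetric.LipschitzAction.exists_bound (hD : D.LipschitzAction Γ) {F : Set Γ}
    (hF : F.Finite) : ∃ L, 0 ≤ L ∧ ∀ g ∈ F, ∀ x y, D.dist (g • x) (g • y) ≤ L * D.dist x y := by
  choose L hL using hD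
  obtain ⟨M, hM⟩ := (hF.image L).bddAbove
  refine ⟨max M 0, le_max_right _ _, fun g hg x y => (hL g x y).trans ?_⟩
  exact mul_le_mul_of_nonneg_right ((hM (Set.mem_image_of_mem L hg)).trans (le_max_left _ _))
    (D.dist_nonneg x y)

/-- Points at bounded warped distance are at bounded distance up to a short group element. -/
theorem exists_smul_dist_le_of_warpedDist_lt (hD : D.LipschitzAction Γ) (ℓ : ProperLength Γ)
    (R : ℝ) : ∃ C, ∀ x y, warpedDist D ℓ x y < R →
      ∃ g : Γ, ℓ.len g ≤ R ∧ D.dist (g • x) y ≤ C := by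
  -- Properness of the length leaves finitely many group elements of length at most `R`, so one
  -- Lipschitz constant serves them all.
  obtain ⟨L, hL0, hL⟩ := hD.exists_bound (ℓ.proper R)
  refine ⟨L * R, fun x y hxy => ?_⟩
  obtain ⟨s, hs, h⟩ := exists_warpChain_lt ((chainDist_le_warpedDist x y).trans_lt hxy)
  obtain ⟨g, hg, hgy⟩ := h.exists_smul hL0 hL hs.le
  exact ⟨g, hg.trans hs.le, hgy.trans (mul_le_mul_of_nonneg_left hs.le hL0)⟩

end WarpChain

/-! ## Partitions of spaces of bounded geometry -/

section Partition

/-- After an injection of the indices into `ℕ`, a point is assigned to the set of least index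
containing it. This serves twice: to turn a cover by balls into a partition, and to resolve overlaps
between the regions of different group elements. -/
theorem exists_measurable_disjointed {ι Y : Type*} [Countable ι] [MeasurableSpace Y]
    {V : ι → Set Y} (hV : ∀ i, MeasurableSet (V i)) :
    ∃ W : ι → Set Y, (∀ i, MeasurableSet (W i)) ∧ (∀ i, W i ⊆ V i) ∧
      (Pairwise fun i j => Disjoint (W i) (W j)) ∧ ∀ y i, y ∈ V i → ∃ j, y ∈ W j := by
  obtain ⟨e, he⟩ := exists_injective_nat ι
  refine ⟨fun i => V i \ ⋃ j, ⋃ (_ : e j < e i), V j, fun i => ?_, fun i => Set.sdiff_subset,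
    ?_, ?_⟩
  · exact (hV i).diff (MeasurableSet.iUnion fun j => MeasurableSet.iUnion fun _ => hV j)
  · intro i j hij
    refine Set.disjoint_left.2 fun y hi hj => ?_
    have h1 : ∀ j, e j < e i → y ∉ V j := by simpa using hi.2
    have h2 : ∀ i, e i < e j → y ∉ V i := by simpa using hj.2
    rcases lt_trichotomy (e i) (e j) with h | h | h
    · exact h2 i h hi.1
    · exact hij (he h)
    · exact h1 j h hj.1
  · intro y i hi
    classical
    have hex : ∃ n, ∃ i, e i = n ∧ y ∈ V i := ⟨_, i, rfl, hi⟩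
    obtain ⟨j, hj, hyj⟩ := Nat.find_spec hex
    refine ⟨j, hyj, ?_⟩
    simp only [Set.mem_iUnion, not_exists]
    intro k hk hyk
    exact Nat.find_min hex (hj ▸ hk) ⟨k, rfl, hyk⟩

variable {Y : Type*} [TopologicalSpace Y] (D : CompatibleMetric Y)

/-- A maximal `e`-separated set exists by Zorn's lemma, and a point at distance at least `e` from
all of it could be added. -/
theorem CompatibleMetric.exists_separated_cover {e : ℝ} (he : 0 < e) :
    ∃ Z : Set Y, (∀ x ∈ Z, ∀ y ∈ Z, D.dist x y < e → x = y) ∧ ∀ y, ∃ z ∈ Z, D.dist y z < e := by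
  obtain ⟨Z, hZ⟩ := zorn_subset {Z : Set Y | ∀ x ∈ Z, ∀ y ∈ Z, D.dist x y < e → x = y} (by
    intro c hc hchain
    refine ⟨⋃₀ c, ?_, fun s hs => Set.subset_sUnion_of_mem hs⟩
    rintro x ⟨s, hs, hxs⟩ y ⟨t, ht, hyt⟩ hxy
    rcases hchain.total hs ht with h | h
    · exact hc ht x (h hxs) y hyt hxy
    · exact hc hs x hxs y (h hyt) hxy)
  refine ⟨Z, hZ.prop, fun y => ?_⟩
  by_contra! hy
  have hins : insert y Z ∈ {Z : Set Y | ∀ x ∈ Z, ∀ y ∈ Z, D.dist x y < e → x = y} := by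
    rintro a (rfl | ha) b (rfl | hb) hab
    · rfl
    · exact absurd hab (not_lt.2 (hy b hb))
    · rw [D.dist_comm] at hab
      exact absurd hab (not_lt.2 (hy a ha))
    · exact hZ.prop a ha b hb hab
  have hyZ : y ∈ Z := hZ.le_of_ge hins (Set.subset_insert y Z) (Set.mem_insert y Z)
  have := hy y hyZ
  rw [D.dist_self] at this
  linarith

/-- The points `z i` have bounded multiplicity at every scale. -/
def CompatibleMetric.UniformlyLocallyFinite {ι : Type*} (z : ι → Y) : Prop :=
  ∀ R, ∃ N : ℕ, ∀ (s : Finset ι) (y : Y), (∀ i ∈ s, D.dist y (z i) < R) → s.card ≤ N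

variable {D}

theorem CompatibleMetric.UniformlyLocallyFinite.finite {ι : Type*} {z : ι → Y}
    (hz : D.UniformlyLocallyFinite z) (y : Y) (R : ℝ) : {i | D.dist y (z i) < R}.Finite := by
  obtain ⟨N, hN⟩ := hz R
  by_contra h
  obtain ⟨t, hts, ht⟩ := Set.Infinite.exists_subset_card_eq h (N + 1)
  have := hN t y fun i hi => hts hi
  omega

theorem CompatibleMetric.UniformlyLocallyFinite.countable {ι : Type*} {z : ι → Y}
    (hz : D.UniformlyLocallyFinite z) : Countable ι := by
  by_cases hι : Nonempty ι
  · obtain ⟨i₀⟩ := hι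
    rw [← Set.countable_univ_iff]
    refine (Set.countable_iUnion fun n : ℕ => (hz.finite (z i₀) n).countable).mono fun i _ => ?_
    obtain ⟨n, hn⟩ := exists_nat_gt (D.dist (z i₀) (z i))
    exact Set.mem_iUnion.2 ⟨n, hn⟩
  · rw [not_nonempty_iff] at hι
    infer_instance

/-- For a maximal `2ϱ`-separated set, a ball of radius `ϱ` contains at most one of its points, so
the number of balls needed to cover a larger ball bounds the number of points in it. -/
theorem CompatibleMetric.BoundedGeometry.exists_uniformlyLocallyFinite (hD : D.BoundedGeometry) :
    ∃ (Z : Set Y) (a : ℝ), D.UniformlyLocallyFinite (fun z : Z => (z : Y)) ∧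
      ∀ y, ∃ z : Z, D.dist y z < a := by
  obtain ⟨ϱ, hϱ, h⟩ := hD
  obtain ⟨Z, hZ, hcov⟩ := D.exists_separated_cover (show 0 < 2 * ϱ by positivity)
  refine ⟨Z, 2 * ϱ, fun R => ?_, fun y => ?_⟩
  -- Bounded geometry speaks of positive radii only, hence the maximum with `1`.
  · obtain ⟨N, hN⟩ := h (max R 1) (lt_max_of_lt_right one_pos)
    refine ⟨N, fun s y hs => ?_⟩
    obtain ⟨W, hW, hsub⟩ := hN y
    have hex : ∀ i ∈ s, ∃ w ∈ W, D.dist (i : Y) w < ϱ := by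
      intro i hi
      have hi' : (i : Y) ∈ {x | D.dist x y < max R 1} := by
        have := hs i hi
        rw [D.dist_comm] at this
        exact this.trans_le (le_max_left _ _)
      simpa using hsub hi'
    have : Nonempty Y := ⟨y⟩
    choose! f hfW hf using hex
    refine (Finset.card_le_card_of_injOn f hfW fun i hi j hj hij => ?_).trans hW
    refine Subtype.ext (hZ i i.2 j j.2 ?_)
    have h1 := D.dist_triangle i (f i) j
    have h2 := hf i hi
    have h3 := hf j hj
    rw [← hij, D.dist_comm] at h3
    linarith
  · obtain ⟨z, hz, hyz⟩ := hcov y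
    exact ⟨⟨z, hz⟩, hyz⟩

/-- A space of bounded geometry has a countable measurable partition into uniformly bounded sets
with uniformly locally finite centres. -/
theorem CompatibleMetric.BoundedGeometry.exists_partition [MeasurableSpace Y] [BorelSpace Y]
    (hD : D.BoundedGeometry) :
    ∃ (Z : Set Y) (A : Z → Set Y) (a : ℝ), Countable Z ∧
      D.UniformlyLocallyFinite (fun z : Z => (z : Y)) ∧
      (∀ z, MeasurableSet (A z)) ∧ (Pairwise fun z w => Disjoint (A z) (A w)) ∧
      (∀ y, ∃ z, y ∈ A z) ∧ ∀ z, ∀ y ∈ A z, D.dist y z < a := by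
  obtain ⟨Z, a, hZ, hcov⟩ := hD.exists_uniformlyLocallyFinite
  have := hZ.countable
  obtain ⟨A, h1, h2, h3, h4⟩ := exists_measurable_disjointed
    (V := fun z : Z => {y | D.dist y z < a}) fun z => (D.isOpen_ball z a).measurableSet
  refine ⟨Z, A, a, this, hZ, h1, h3, fun y => ?_, fun z y hy => h2 z hy⟩
  obtain ⟨z, hz⟩ := hcov y
  exact h4 y z hz

end Partition

/-! ## The crossed product and the Roe `*`-algebra of the warped metric -/

section Decomposition

variable {Γ Y : Type*} [Group Γ] [MulAction Γ Y] [TopologicalSpace Y] {D : CompatibleMetric Y}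

theorem CompatibleMetric.UniformlyLocallyFinite.finite_of_isCompact {ι : Type*} {z : ι → Y}
    (hz : D.UniformlyLocallyFinite z) {K : Set Y} (hK : IsCompact K) (R : ℝ) :
    {i | ∃ y ∈ K, D.dist y (z i) < R}.Finite := by
  rcases K.eq_empty_or_nonempty with rfl | ⟨y₀, hy₀⟩
  · simp
  · obtain ⟨M, hM⟩ := D.exists_dist_le hK
    refine (hz.finite y₀ (M + R)).subset ?_
    rintro i ⟨y, hy, hyi⟩
    have h1 := D.dist_triangle y₀ y (z i)
    have h2 := hM y₀ hy₀ y hy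
    change D.dist y₀ (z i) < M + R
    linarith

theorem CompatibleMetric.LipschitzAction.isCompact_preimage (hD : D.LipschitzAction Γ) (g : Γ)
    {K : Set Y} (hK : IsCompact K) : IsCompact ((fun y => g • y) ⁻¹' K) :=
  (hD.homeomorph g).isCompact_preimage.2 hK

variable [MeasurableSpace Y] [BorelSpace Y] {ν : Measure Y} (ℓ : ProperLength Γ)

/-- The warped metric is dominated by `D`, so sets far apart in the warped metric are far apart in
`D`. -/
theorem HasPropagationLE.warped [LocallyCompactSpace Y] [SigmaCompactSpace Y] {r : ℝ} (hr : 0 ≤ r)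
    {T : BL2 ν} (hT : HasPropagationLE D r T) :
    HasPropagationLE (D.warped ℓ) r T := by
  refine hasPropagationLE_of_indOp hr ?_
  rintro A B hA hB ⟨q, hq, hAB⟩
  exact hT.indOp_mul_mul_indOp hr hq hA hB fun x hx y hy =>
    (hAB x hx y hy).trans ((isWarpAdmissible_warpedDist D ℓ).le_dist x y)

variable [SigmaFinite ν] (hν : NonsingularAction Γ ν)

/-- The operator `π(g)` lives on the graph of `g`, and `g` moves points by at most `ℓ.len g` in the
warped metric. -/
theorem hasPropagationLE_koopman (g : Γ) :
    HasPropagationLE (D.warped ℓ) (ℓ.len g) (koopman hν g : BL2 ν) := by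
  refine hasPropagationLE_of_indOp (ℓ.nonneg g) ?_
  rintro A B hA hB ⟨q, hq, hAB⟩
  rw [indOp_mul_koopman, mul_assoc, indOp_mul_eq_zero, mul_zero]
  refine Set.disjoint_left.2 fun y hyA hyB => ?_
  have h1 := hAB _ hyA y hyB
  have h2 := (isWarpAdmissible_warpedDist D ℓ).le_len y g
  rw [(isWarpAdmissible_warpedDist D ℓ).comm] at h2
  exact absurd (h1.trans h2) (not_le.2 hq)

variable [LocallyCompactSpace Y] [SigmaCompactSpace Y]

theorem mul_koopman_mem_roeStarAlgebra_warped (hD : D.LipschitzAction Γ) (g : Γ) {T : BL2 ν}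
    (hT : T ∈ roeStarAlgebra ν D) :
    T * (koopman hν g : BL2 ν) ∈ roeStarAlgebra ν (D.warped ℓ) := by
  have := D.t2Space
  obtain ⟨⟨r, hr, hTr⟩, hTc⟩ := hT
  refine ⟨⟨r + ℓ.len g, add_nonneg hr (ℓ.nonneg g),
    (hTr.warped ℓ hr).mul _ hr (ℓ.nonneg g) (hasPropagationLE_koopman ℓ hν g)⟩, ?_⟩
  refine isLocallyCompactOperator_of_indOp fun K hKm hK => ⟨?_, ?_⟩
  · rw [← mul_assoc]
    exact (hTc.indOp_mul hK hKm).1.mul_right _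
  -- Moving `χ_K` to the left of `π(g)` replaces `K` by its translate, which is compact because `g`
  -- acts by a homeomorphism.
  · rw [mul_assoc, koopman_mul_indOp, ← mul_assoc]
    exact (hTc.indOp_mul (hD.isCompact_preimage g⁻¹ hK) _).2.mul_right _

theorem mul_koopman_mem_roeAlgebra_warped (hD : D.LipschitzAction Γ) (g : Γ) {T : BL2 ν}
    (hT : T ∈ roeAlgebra ν D) :
    T * (koopman hν g : BL2 ν) ∈ roeAlgebra ν (D.warped ℓ) :=
  map_mem_closure (f := fun T : BL2 ν => T * (koopman hν g : BL2 ν)) (by fun_prop) hT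
    fun _ hS => mul_koopman_mem_roeStarAlgebra_warped ℓ hν hD g hS

/-- An operator assembled from blocks along the graph of `g` becomes, after composition with
`π(g)⁻¹`, an element of the Roe `*`-algebra. -/
theorem mul_koopman_inv_mem_roeStarAlgebra (hD : D.LipschitzAction Γ) {ι : Type*} [Countable ι]
    {z : ι → Y} (hz : D.UniformlyLocallyFinite z) {A W : ι → Set Y} {a C : ℝ}
    (hA : ∀ i, MeasurableSet (A i)) (hdisj : Pairwise fun i j => Disjoint (A i) (A j))
    (hcov : ∀ y, ∃ i, y ∈ A i) (hAz : ∀ i, ∀ y ∈ A i, D.dist y (z i) < a)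
    (hW : ∀ i, MeasurableSet (W i)) (g : Γ) (hWz : ∀ i, ∀ y ∈ W i, D.dist (g • y) (z i) < C)
    {T S : BL2 ν} (hT : IsLocallyCompactOperator T)
    (hS : ∀ i, indOp ν (hA i) * S = indOp ν (hA i) * T * indOp ν (hW i)) :
    S * (koopman hν g⁻¹ : BL2 ν) ∈ roeStarAlgebra ν D := by
  have := D.t2Space
  have hpre : ∀ (B : Set Y) (y : Y), y ∈ (fun y => (g⁻¹)⁻¹ • y) ⁻¹' B → g • y ∈ B := by
    intro B y hy
    simpa using hy
  refine ⟨⟨max (a + C) 0, le_max_right _ _, hasPropagationLE_of_indOp (le_max_right _ _) ?_⟩,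
    isLocallyCompactOperator_of_indOp fun K hKm hK => ⟨?_, ?_⟩⟩
  -- If `x ∈ A i ∩ B` and `y ∈ W i` with `g • y ∈ B'`, then `x` and `g • y` are both close to `z i`,
  -- so their distance is below `a + C`. Hence no block sees both `B` and `B'`.
  · rintro B B' hB hB' ⟨q, hq, hBB'⟩
    refine eq_zero_of_indOp_mul hA hcov fun i => ?_
    have e : indOp ν (hA i) * (indOp ν hB * (S * (koopman hν g⁻¹ : BL2 ν)) * indOp ν hB') =
        (indOp ν (hA i) * indOp ν hB) * T * (indOp ν (hW i) *
          indOp ν (measurableSet_smul_preimage hν (g⁻¹)⁻¹ hB')) * (koopman hν g⁻¹ : BL2 ν) := by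
      calc _ = (indOp ν hB * indOp ν (hA i)) * S * ((koopman hν g⁻¹ : BL2 ν) * indOp ν hB') := by
            rw [indOp_mul_comm hB]; simp only [mul_assoc]
        _ = indOp ν hB * (indOp ν (hA i) * S) *
              (indOp ν (measurableSet_smul_preimage hν (g⁻¹)⁻¹ hB') *
                (koopman hν g⁻¹ : BL2 ν)) := by
            rw [koopman_mul_indOp]; simp only [mul_assoc]
        _ = _ := by
            rw [hS, indOp_mul_comm (hA i)]; simp only [mul_assoc]
    rw [e]
    by_cases h1 : Disjoint (A i) B
    · rw [indOp_mul_eq_zero _ _ h1, zero_mul, zero_mul, zero_mul]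
    · rw [indOp_mul_eq_zero (hW i), mul_zero, zero_mul]
      obtain ⟨x, hxA, hxB⟩ := Set.not_disjoint_iff.1 h1
      refine Set.disjoint_left.2 fun y hyW hyB' => ?_
      have h2 := hBB' x hxB _ (hpre _ _ hyB')
      have h3 := hAz i x hxA
      have h4 := hWz i y hyW
      have h5 := D.dist_triangle x (z i) (g • y)
      rw [D.dist_comm (z i)] at h5
      have h6 := le_max_left (a + C) 0
      linarith
  -- Only finitely many pieces `A i` meet `K`, and each of their blocks contains the compact factor
  -- `χ_K T`.
  · have hfin := hz.finite_of_isCompact hK a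
    rw [eq_sum_of_indOp_mul_eq_zero hA hcov hdisj hfin.toFinset (S := indOp ν hKm * _)]
    · refine isCompactOperator_sum _ fun i _ => ?_
      have e : indOp ν (hA i) * (indOp ν hKm * (S * (koopman hν g⁻¹ : BL2 ν))) =
          indOp ν (hA i) * (indOp ν hKm * T) * (indOp ν (hW i) * (koopman hν g⁻¹ : BL2 ν)) := by
        calc _ = indOp ν hKm * (indOp ν (hA i) * S) * (koopman hν g⁻¹ : BL2 ν) := by
              rw [← mul_assoc, indOp_mul_comm (hA i)]; simp only [mul_assoc]
          _ = _ := by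
              rw [hS, ← mul_assoc, ← mul_assoc, ← indOp_mul_comm (hA i)]; simp only [mul_assoc]
      rw [e]
      exact ((hT.indOp_mul hK hKm).1.mul_left _).mul_right _
    · intro i hi
      rw [← mul_assoc, indOp_mul_eq_zero, zero_mul]
      refine Set.disjoint_left.2 fun y hyA hyK => hi ?_
      rw [Set.Finite.mem_toFinset]
      exact ⟨y, hyK, hAz i y hyA⟩
  -- On the right, `χ_K` becomes the projection of `B = g⁻¹K`. If `W i` meets `B`, then `z i` lies
  -- within `C` of `K`, so again finitely many blocks remain, each with the compact factor `T χ_B`.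
  · have hfin := hz.finite_of_isCompact hK C
    rw [mul_assoc, koopman_mul_indOp, ← mul_assoc]
    refine IsCompactOperator.mul_right ?_ _
    set B := (fun y => (g⁻¹)⁻¹ • y) ⁻¹' K
    have hBm : MeasurableSet B := measurableSet_smul_preimage hν (g⁻¹)⁻¹ hKm
    have hB : IsCompact B := hD.isCompact_preimage (g⁻¹)⁻¹ hK
    have e : ∀ i, indOp ν (hA i) * (S * indOp ν hBm) =
        indOp ν (hA i) * T * (indOp ν (hW i) * indOp ν hBm) := fun i => by
      rw [← mul_assoc, hS]; simp only [mul_assoc]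
    rw [eq_sum_of_indOp_mul_eq_zero hA hcov hdisj hfin.toFinset (S := S * indOp ν hBm)]
    · refine isCompactOperator_sum _ fun i _ => ?_
      rw [e, indOp_mul_comm, ← mul_assoc, mul_assoc _ T]
      exact ((hT.indOp_mul hB hBm).2.mul_left _).mul_right _
    · intro i hi
      rw [e, indOp_mul_eq_zero, mul_zero]
      refine Set.disjoint_left.2 fun y hyW hyB => hi ?_
      rw [Set.Finite.mem_toFinset]
      exact ⟨g • y, hpre K y hyB, hWz i y hyW⟩

/-- Every element of the Roe `*`-algebra of the warped metric is a finite sum `∑ T_g π(g)` with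
coefficients in the Roe `*`-algebra. -/
theorem exists_eq_sum_mul_koopman (hD : D.LipschitzAction Γ) (hbg : D.BoundedGeometry) {T : BL2 ν}
    (hT : T ∈ roeStarAlgebra ν (D.warped ℓ)) :
    ∃ (F : Finset Γ) (S : Γ → BL2 ν), (∀ g ∈ F, S g ∈ roeStarAlgebra ν D) ∧
      T = ∑ g ∈ F, S g * (koopman hν g : BL2 ν) := by
  classical
  obtain ⟨⟨r, hr, hTr⟩, hTc⟩ := hT
  -- Vanishing of corners of `T` is available only at distances strictly above `r`; here `r + 1` is
  -- used.
  obtain ⟨C, hC⟩ := exists_smul_dist_le_of_warpedDist_lt hD ℓ (r + 1)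
  obtain ⟨Z, A, a, _, hZ, hA, hdisj, hcov, hAz⟩ := hbg.exists_partition
  let F : Finset Γ := (ℓ.proper (r + 1)).toFinset
  -- For fixed `z`, the points that `g` brings within `C + a` of `z`. These sets overlap for
  -- different `g`; making them disjoint assigns every relevant column of the row `A z` to exactly
  -- one `g`.
  have hVm : ∀ (z : Z) (g : F), MeasurableSet {y | D.dist ((g : Γ) • y) z < C + a} := fun z g =>
    measurableSet_smul_preimage hν (g : Γ) (D.isOpen_ball z (C + a)).measurableSet
  choose W hWm hWV hWd hWc using fun z => exists_measurable_disjointed (hVm z)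
  -- If `y ∈ W z g`, then `z` lies within `C + a` of `g • y`, so local finiteness bounds the number
  -- of such `z`.
  have hmult : ∀ g : F, ∃ N : ℕ, ∀ (s : Finset Z) (y : Y), (∀ z ∈ s, y ∈ W z g) → s.card ≤ N := by
    intro g
    obtain ⟨N, hN⟩ := hZ (C + a)
    exact ⟨N, fun s y hs => hN s ((g : Γ) • y) fun z hz => hWV z g (hs z hz)⟩
  have hex : ∀ g : F, ∃ S : BL2 ν, ∀ z, indOp ν (hA z) * S =
      indOp ν (hA z) * T * indOp ν (hWm z g) := by
    intro g
    obtain ⟨N, hN⟩ := hmult g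
    exact exists_blockSum hA hdisj (fun z => hWm z g) hN T
  choose S hS using hex
  have hSmem : ∀ g : F, S g * (koopman hν (g : Γ)⁻¹ : BL2 ν) ∈ roeStarAlgebra ν D := fun g =>
    mul_koopman_inv_mem_roeStarAlgebra hν hD hZ hA hdisj hcov hAz (fun z => hWm z g) g
      (fun z y hy => hWV z g hy) hTc (hS g)
  have hsum : T = ∑ g : F, S g := by
    rw [← sub_eq_zero]
    refine eq_zero_of_indOp_mul hA hcov fun z => ?_
    have hUm : MeasurableSet (⋃ g : F, W z g) := MeasurableSet.iUnion (hWm z)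
    have h1 : ∑ g : F, indOp ν (hWm z g) = indOp ν hUm := by
      ext ξ
      have hall : ∀ᵐ y ∂ν, ∀ g : F, (indOp ν (hWm z g) ξ) y = (W z g).indicator ξ y :=
        ae_all_iff.2 fun g => indOp_ae (hWm z g) ξ
      filter_upwards [hall, indOp_ae hUm ξ,
        Lp.coeFn_finsetSum Finset.univ fun g : F => indOp ν (hWm z g) ξ] with y h1 h2 h3
      rw [h2, sum_apply, h3, Finset.sum_apply, Finset.sum_congr rfl fun g _ => h1 g]
      by_cases hy : y ∈ ⋃ g : F, W z g
      · obtain ⟨g, hg⟩ := Set.mem_iUnion.1 hy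
        rw [Set.indicator_of_mem hy, Finset.sum_eq_single g, Set.indicator_of_mem hg]
        · intro k _ hk
          exact Set.indicator_of_notMem (Set.disjoint_left.1 (hWd z hk.symm) hg) _
        · exact fun h => absurd (Finset.mem_univ g) h
      · rw [Set.indicator_of_notMem hy]
        refine Finset.sum_eq_zero fun g _ => Set.indicator_of_notMem (fun hg => hy ?_) _
        exact Set.mem_iUnion.2 ⟨g, hg⟩
    -- A column at warped distance below `r + 1` from a point of `A z` is brought within `C` of it
    -- by some `g ∈ F`, hence within `C + a` of `z`. The columns outside the union are therefore
    -- beyond the propagation of `T`.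
    have h2 : indOp ν (hA z) * T * indOp ν hUm.compl = 0 := by
      refine hTr.indOp_mul_mul_indOp hr (lt_add_one r) _ _ fun x hx y hy => ?_
      by_contra! hlt
      obtain ⟨g, hg, hgy⟩ := hC y x (by
        rw [(isWarpAdmissible_warpedDist D ℓ).comm]
        exact hlt)
      have hgF : g ∈ F := (ℓ.proper (r + 1)).mem_toFinset.2 hg
      have hyV : D.dist (g • y) z < C + a := by
        have := D.dist_triangle (g • y) x z
        have := hAz z x hx
        linarith
      obtain ⟨k, hk⟩ := hWc z y ⟨g, hgF⟩ hyV
      exact hy (Set.mem_iUnion.2 ⟨k, hk⟩)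
    rw [mul_sub, Finset.mul_sum, Finset.sum_congr rfl fun g _ => hS g z, ← Finset.mul_sum, h1,
      ← h2, sub_eq_iff_eq_add, ← mul_add, add_comm, indOp_add_compl, mul_one]
  -- The coefficient of `g` is `S g * π(g⁻¹)`, so that multiplying by `π(g)` returns `S g`.
  refine ⟨F, fun g => if hg : g ∈ F then S ⟨g, hg⟩ * (koopman hν g⁻¹ : BL2 ν) else 0,
    fun g hg => ?_, ?_⟩
  · simp only [hg, dif_pos]
    exact hSmem ⟨g, hg⟩
  · rw [hsum, ← Finset.sum_coe_sort F]
    refine Finset.sum_congr rfl fun g _ => ?_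
    simp only [g.2, dif_pos, mul_assoc, koopman_mul_koopman]
    simp

end Decomposition

/-! ## Compactness of the coefficients of a compact sum -/

section Injectivity

variable {Γ Y : Type*} [Group Γ] [MulAction Γ Y] [TopologicalSpace Y] {D : CompatibleMetric Y}

/-- Each nontrivial group element moves points arbitrarily far outside of compact sets. -/
def CompatibleMetric.ExpandsAtInfinity (D : CompatibleMetric Y) (Γ : Type*) [Group Γ]
    [MulAction Γ Y] : Prop :=
  ∀ g : Γ, g ≠ 1 → ∀ R : ℝ, ∃ K : Set Y, IsCompact K ∧ ∀ y ∉ K, R < D.dist y (g • y)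

theorem CompatibleMetric.ExpandsAtInfinity.exists_isCompact (h : D.ExpandsAtInfinity Γ)
    (s : Finset Γ) (R : ℝ) :
    ∃ K : Set Y, IsCompact K ∧ ∀ y ∉ K, ∀ g ∈ s, g ≠ 1 → R < D.dist y (g • y) := by
  have hex : ∀ g : Γ, ∃ K : Set Y, IsCompact K ∧ (g ≠ 1 → ∀ y ∉ K, R < D.dist y (g • y)) := by
    intro g
    by_cases hg : g = 1
    · exact ⟨∅, isCompact_empty, fun h => absurd hg h⟩
    · obtain ⟨K, hK, hK'⟩ := h g hg R
      exact ⟨K, hK, fun _ => hK'⟩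
  choose K hK hK' using hex
  refine ⟨⋃ g ∈ s, K g, s.isCompact_biUnion fun g _ => hK g, fun y hy g hg hg1 => ?_⟩
  exact hK' g hg1 y fun hyK => hy (Set.mem_biUnion hg hyK)

variable [MeasurableSpace Y] [BorelSpace Y] [LocallyCompactSpace Y] [SigmaCompactSpace Y]
  {ν : Measure Y} [SigmaFinite ν] (hν : NonsingularAction Γ ν)

/-- Far away, the coefficient at `1` of a sum `∑ T_g π(g)` of operators of finite propagation is
a compression of the sum. -/
theorem exists_isCompact_indOp_mul_eq (hD : D.LipschitzAction Γ) (hexp : D.ExpandsAtInfinity Γ)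
    {s : Finset Γ} (h1s : 1 ∈ s) {r : ℝ} (hr : 0 ≤ r) {T : Γ → BL2 ν}
    (hT : ∀ g ∈ s, HasPropagationLE D r (T g)) (R : ℝ) :
    ∃ K : Set Y, IsCompact K ∧ ∀ (A : Set Y) (hA : MeasurableSet A), Disjoint A K →
      (∀ x ∈ A, ∀ y ∈ A, D.dist x y ≤ R) → ∃ (B : Set Y) (hB : MeasurableSet B),
        indOp ν hA * T 1 =
          indOp ν hA * (∑ g ∈ s, T g * (koopman hν g : BL2 ν)) * indOp ν hB := by
  obtain ⟨L, hL0, hL⟩ := hD.exists_bound s.finite_toSet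
  obtain ⟨K, hK, hKexp⟩ := hexp.exists_isCompact s (R + L * (r + 1) + (r + 1))
  refine ⟨K, hK, fun A hA hAK hAR => ?_⟩
  have hB := (D.isOpen_thickening A (r + 1)).measurableSet
  set B := {y | ∃ a ∈ A, D.dist y a < r + 1}
  refine ⟨B, hB, ?_⟩
  rw [Finset.mul_sum, Finset.sum_mul, Finset.sum_eq_single_of_mem 1 h1s]
  -- The thickening `B` contains everything that `χ_A T 1` can see, so cutting by `χ_B` leaves the
  -- term at `1` unchanged.
  · have h0 : indOp ν hA * T 1 * indOp ν hB.compl = 0 := by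
      refine (hT 1 h1s).indOp_mul_mul_indOp hr (lt_add_one r) _ _ fun x hx y hy => ?_
      by_contra! hlt
      rw [D.dist_comm] at hlt
      exact hy ⟨x, hx, hlt⟩
    rw [map_one, OneMemClass.coe_one, mul_one, ← sub_eq_zero, ← h0, sub_eq_iff_eq_add, ← mul_add,
      add_comm, indOp_add_compl, mul_one]
  -- For `g ≠ 1` the term is `χ_A T_g χ_{gB} π(g)`, which vanishes because `gB` is far from `A`.
  · intro g hg hg1
    rw [mul_assoc, mul_assoc, koopman_mul_indOp, ← mul_assoc, ← mul_assoc,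
      (hT g hg).indOp_mul_mul_indOp hr (lt_add_one r), zero_mul]
    intro x hx y hy
    obtain ⟨a, ha, hya⟩ : ∃ a ∈ A, D.dist (g⁻¹ • y) a < r + 1 := hy
    have h2 := hKexp a (Set.disjoint_left.1 hAK ha) g hg hg1
    have h3 := hL g hg (g⁻¹ • y) a
    rw [smul_inv_smul] at h3
    have h4 := hAR a ha x hx
    have h5 := D.dist_triangle a x (g • a)
    have h6 := D.dist_triangle x y (g • a)
    have h7 := mul_le_mul_of_nonneg_left hya.le hL0
    linarith

/-- It suffices to approximate `T 1` in norm by the compact operators `χ_K T 1`, that is, to make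
the part of `T 1` outside `K` small. Norm localization tests this part on a bounded set, where it is
a compression of the sum up to the approximation error, and the sum is small outside a large compact
set. -/
theorem isCompactOperator_coeff_one (hD : D.LipschitzAction Γ) (hexp : D.ExpandsAtInfinity Γ)
    (honl : HasONL ν D) {s : Finset Γ} (h1s : 1 ∈ s) {T : Γ → BL2 ν}
    (hT : ∀ g ∈ s, T g ∈ roeAlgebra ν D)
    (h : IsCompactOperator (∑ g ∈ s, T g * (koopman hν g : BL2 ν) : BL2 ν)) :
    IsCompactOperator (T 1) := by
  have := D.t2Space
  obtain ⟨c, hc0, -, honl⟩ := honl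
  let K : CompactExhaustion Y := default
  have hKm : ∀ n, MeasurableSet (K n) := fun n => (K.isCompact n).measurableSet
  have hmem : T 1 ∈ closure {S : BL2 ν | IsCompactOperator S} := by
    refine Metric.mem_closure_iff.2 fun δ hδ => ?_
    -- The final estimate is `(card s + 1) / c * ε` for `Q * S 1` plus `ε` for replacing `S 1` by `T
    -- 1`.
    obtain ⟨ε, hε, hεδ⟩ : ∃ ε > 0, ((s.card + 1 : ℝ) / c + 1) * ε < δ := by
      have hM : 0 < (s.card + 1 : ℝ) / c + 1 := by positivity
      refine ⟨δ / (2 * ((s.card + 1 : ℝ) / c + 1)), by positivity, ?_⟩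
      rw [← div_div, mul_div_cancel₀ _ hM.ne']
      linarith
    have hex : ∀ g ∈ s, ∃ (S : BL2 ν) (r : ℝ), HasPropagationLE D r S ∧ ‖S - T g‖ ≤ ε := by
      intro g hg
      obtain ⟨S, ⟨⟨r, -, hS⟩, -⟩, hSg⟩ := Metric.mem_closure_iff.1 (hT g hg) ε hε
      rw [dist_comm, dist_eq_norm] at hSg
      exact ⟨S, r, hS, hSg.le⟩
    choose! S r hSr hST using hex
    obtain ⟨r₀, hr₀⟩ := (s.image r).exists_le
    have hr1 : 0 < max r₀ 1 := lt_max_of_lt_right one_pos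
    have hS : ∀ g ∈ s, HasPropagationLE D (max r₀ 1) (S g) := fun g hg =>
      (hSr g hg).mono D ((hr₀ _ (Finset.mem_image_of_mem r hg)).trans (le_max_left _ _))
    obtain ⟨R, hR⟩ := honl _ hr1
    obtain ⟨K₀, hK₀, hfar⟩ := exists_isCompact_indOp_mul_eq hν hD hexp h1s hr1.le hS R
    obtain ⟨n₀, hn₀⟩ := K.exists_superset_of_isCompact hK₀
    obtain ⟨N, hN⟩ := h.exists_norm_indOp_compl_mul_le hKm K.subset K.exists_mem hε
    set n := max n₀ N
    set P := indOp ν (hKm n)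
    set Q := indOp ν (hKm n).compl
    -- Localization is applied to `Q * S 1` and not to `S 1`, so that the bounded set it yields can
    -- be intersected with the complement of `K n` without loss.
    have hprop : HasPropagationLE D (max r₀ 1) (Q * S 1) := by
      refine hasPropagationLE_of_indOp hr1.le ?_
      rintro A B hA hB ⟨q, hq, hAB⟩
      rw [← mul_assoc, indOp_mul_comm, mul_assoc, mul_assoc, ← mul_assoc (indOp ν hA),
        (hS 1 h1s).indOp_mul_mul_indOp hr1.le hq hA hB hAB, mul_zero]
    obtain ⟨A, hA, hAR, hAn⟩ := hR _ hprop
    have hAQ : indOp ν hA * Q = indOp ν (hA.inter (hKm n).compl) := indOp_mul _ _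
    obtain ⟨B, hB, hAB⟩ := hfar _ (hA.inter (hKm n).compl)
      (Set.disjoint_left.2 fun y hy hyK => hy.2 (K.subset (le_max_left n₀ N) (hn₀ hyK)))
      fun x hx y hy => hAR x hx.1 y hy.1
    have hdiff : ‖(∑ g ∈ s, S g * (koopman hν g : BL2 ν)) -
        ∑ g ∈ s, T g * (koopman hν g : BL2 ν)‖ ≤ s.card * ε := by
      rw [← Finset.sum_sub_distrib, ← nsmul_eq_mul, ← Finset.sum_const]
      refine norm_sum_le_of_le _ fun g hg => ?_
      rw [← sub_mul]
      exact (norm_mul_koopman_le hν g _).trans (hST g hg)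
    -- One `ε` comes from the compact sum cut off by `Q`, and one for each `g ∈ s` from replacing `T
    -- g` by `S g`.
    have hAS : ‖indOp ν hA * (Q * S 1)‖ ≤ (s.card + 1) * ε := by
      rw [← mul_assoc, hAQ, hAB, ← hAQ]
      refine (norm_mul_indOp_le hB _).trans ?_
      rw [mul_assoc]
      refine (norm_indOp_mul_le hA _).trans ?_
      have h1 : Q * (∑ g ∈ s, S g * (koopman hν g : BL2 ν)) =
          Q * (∑ g ∈ s, T g * (koopman hν g : BL2 ν)) +
            Q * ((∑ g ∈ s, S g * (koopman hν g : BL2 ν)) -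
              ∑ g ∈ s, T g * (koopman hν g : BL2 ν)) := by
        rw [← mul_add, add_sub_cancel]
      rw [h1]
      have h2 := norm_indOp_mul_le (hKm n).compl ((∑ g ∈ s, S g * (koopman hν g : BL2 ν)) -
              ∑ g ∈ s, T g * (koopman hν g : BL2 ν))
      have h3 := hN n (le_max_right _ _)
      refine (norm_add_le _ _).trans ?_
      have h4 := h3.trans_eq (one_mul ε).symm
      linarith [h2.trans hdiff]
    have hQS : ‖Q * S 1‖ ≤ (s.card + 1) / c * ε := by
      rw [div_mul_eq_mul_div, le_div_iff₀ hc0, mul_comm]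
      exact hAn.trans hAS
    refine ⟨P * T 1, isCompactOperator_indOp_mul_of_mem_roeAlgebra (hT 1 h1s) (K.isCompact n) _, ?_⟩
    have e : T 1 - P * T 1 = Q * S 1 - Q * (S 1 - T 1) := by
      have hPQ : P + Q = 1 := indOp_add_compl _
      calc T 1 - P * T 1 = (P + Q) * T 1 - P * T 1 := by rw [hPQ, one_mul]
        _ = _ := by noncomm_ring
    rw [dist_eq_norm, e]
    have h1 := norm_sub_le (Q * S 1) (Q * (S 1 - T 1))
    have h2 : ‖Q * (S 1 - T 1)‖ ≤ ‖S 1 - T 1‖ := norm_indOp_mul_le _ _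
    have h3 := hST 1 h1s
    linarith
  rwa [isClosed_setOfPred_isCompactOperator.closure_eq] at hmem

/-- If a finite sum `∑ T_g π(g)` with coefficients in the Roe algebra is compact, then so are its
coefficients. -/
theorem isCompactOperator_coeff (hD : D.LipschitzAction Γ) (hexp : D.ExpandsAtInfinity Γ)
    (honl : HasONL ν D) {s : Finset Γ} {T : Γ → BL2 ν} (hT : ∀ g ∈ s, T g ∈ roeAlgebra ν D)
    (h : IsCompactOperator (∑ g ∈ s, T g * (koopman hν g : BL2 ν) : BL2 ν)) {k : Γ} (hk : k ∈ s) :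
    IsCompactOperator (T k) := by
  -- Multiplying the sum on the right by `π(k⁻¹)` moves the coefficient at `k` to the identity and
  -- keeps the sum compact.
  let e := (Equiv.mulRight k⁻¹).toEmbedding
  have h1 := isCompactOperator_coeff_one hν hD hexp honl (s := s.map e)
    (Finset.mem_map.2 ⟨k, hk, mul_inv_cancel k⟩) (T := fun g => T (g * k)) (fun g hg => by
      obtain ⟨g', hg', rfl⟩ := Finset.mem_map.1 hg
      simpa [e] using hT g' hg') (by
      have h2 := h.mul_right (koopman hν k⁻¹ : BL2 ν)
      rw [Finset.sum_mul] at h2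
      rw [Finset.sum_map]
      simpa [e, mul_assoc] using h2)
  simpa using h1

end Injectivity

/-! ## Homomorphisms of quotients and of crossed products -/

section StarAlg

variable {A B C : Type*} [NonUnitalRing A] [StarRing A] [Module ℂ A]
  [NonUnitalRing B] [StarRing B] [Module ℂ B] [NonUnitalRing C] [StarRing C] [Module ℂ C]

/-- A `*`-homomorphism that vanishes on the kernel of a surjective one factors through it. -/
theorem exists_factor (q : A →⋆ₙₐ[ℂ] B) (hq : Function.Surjective q) (f : A →⋆ₙₐ[ℂ] C)
    (h : ∀ x, q x = 0 → f x = 0) : ∃ F : B →⋆ₙₐ[ℂ] C, ∀ x, F (q x) = f x := by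
  have hwd : ∀ x y, q x = q y → f x = f y := by
    intro x y hxy
    rw [← sub_eq_zero, ← map_sub]
    exact h _ (by rw [map_sub, hxy, sub_self])
  have hF : ∀ x, f (Function.surjInv hq (q x)) = f x := fun x =>
    hwd _ _ (Function.surjInv_eq hq _)
  refine ⟨{ toFun := fun b => f (Function.surjInv hq b)
            map_smul' := ?_
            map_zero' := ?_
            map_add' := ?_
            map_mul' := ?_
            map_star' := ?_ }, hF⟩
  · intro c b
    obtain ⟨x, rfl⟩ := hq b
    rw [← map_smul, hF, hF, map_smul]
    rfl
  · rw [← map_zero q, hF, map_zero]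
  · intro a b
    obtain ⟨x, rfl⟩ := hq a
    obtain ⟨y, rfl⟩ := hq b
    simp only [← map_add, hF]
  · intro a b
    obtain ⟨x, rfl⟩ := hq a
    obtain ⟨y, rfl⟩ := hq b
    simp only [← map_mul, hF]
  · intro a
    obtain ⟨x, rfl⟩ := hq a
    simp only [← map_star, hF]

namespace StarIdeal

variable (I : StarIdeal A)

theorem cls_eq_zero_iff {a : A} : I.cls a = 0 ↔ a ∈ I.toSubmodule :=
  Submodule.Quotient.mk_eq_zero _

/-- The quotient map as a `*`-homomorphism. -/
def clsHom : A →⋆ₙₐ[ℂ] I.Quot where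
  toFun := I.cls
  map_smul' := I.cls_smul
  map_zero' := I.cls_zero
  map_add' := I.cls_add
  map_mul' := I.cls_mul
  map_star' := I.cls_star

end StarIdeal

namespace AlgCrossedProduct

variable {G : Type*} [Group G] {α : G →* (A ≃⋆ₐ[ℂ] A)} (I : StarIdeal A)
  (h : ∀ g, ∀ a ∈ I.toSubmodule, α g a ∈ I.toSubmodule)

theorem toQuot_single (g : G) (a : A) :
    (single α g a).toQuot I h = single (I.quotAction α h) g (I.cls a) :=
  congrArg mk Finsupp.mapRange_single

theorem toQuot_zero : (0 : AlgCrossedProduct α).toQuot I h = 0 :=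
  congrArg mk Finsupp.mapRange_zero

theorem toQuot_add (x y : AlgCrossedProduct α) :
    (x + y).toQuot I h = x.toQuot I h + y.toQuot I h :=
  congrArg mk (Finsupp.mapRange_add I.cls_add x.coeff y.coeff)

/-- The map `A ⋊_alg G → (A / I) ⋊_alg G` as a `*`-homomorphism. -/
noncomputable def toQuotHom : AlgCrossedProduct α →⋆ₙₐ[ℂ] AlgCrossedProduct (I.quotAction α h) where
  toFun x := x.toQuot I h
  map_smul' c x := by
    change (c • x).toQuot I h = c • x.toQuot I h
    induction x using induction with
    | zero => rw [smul_zero, toQuot_zero, smul_zero]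
    | add x y hx hy => rw [smul_add, toQuot_add, toQuot_add, hx, hy, smul_add]
    | single g a => rw [smul_single, toQuot_single, toQuot_single, smul_single, I.cls_smul]
  map_zero' := toQuot_zero I h
  map_add' := toQuot_add I h
  map_mul' x y := by
    induction x using induction with
    | zero => rw [zero_mul, toQuot_zero, zero_mul]
    | add x x' hx hx' => rw [add_mul, toQuot_add, toQuot_add, hx, hx', add_mul]
    | single g a =>
      induction y using induction with
      | zero => rw [mul_zero, toQuot_zero, mul_zero]
      | add x x' hx hx' => rw [mul_add, toQuot_add, toQuot_add, hx, hx', mul_add]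
      | single k b =>
        rw [single_mul_single, toQuot_single, toQuot_single, toQuot_single, single_mul_single,
          I.quotAction_cls, I.cls_mul]
  map_star' x := by
    induction x using induction with
    | zero => rw [star_zero, toQuot_zero, star_zero]
    | add x y hx hy => rw [star_add, toQuot_add, toQuot_add, hx, hy, star_add]
    | single g a =>
      rw [star_single, toQuot_single, toQuot_single, star_single, ← I.cls_star, I.quotAction_cls]

theorem toQuotHom_surjective : Function.Surjective (toQuotHom I h) := by
  rintro ⟨y⟩
  obtain ⟨x, rfl⟩ := Finsupp.mapRange_surjective I.cls I.cls_zero I.cls_surjective y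
  exact ⟨⟨x⟩, rfl⟩

theorem toQuot_eq_zero_iff (x : AlgCrossedProduct α) :
    x.toQuot I h = 0 ↔ ∀ g, x.coeff g ∈ I.toSubmodule := by
  rw [← coeff_injective.eq_iff, DFunLike.ext_iff]
  exact forall_congr' fun g => I.cls_eq_zero_iff

end AlgCrossedProduct

end StarAlg

/-! ### Crossed products represented by operators, modulo compact operators -/

section CrossedRep

variable {H G : Type*} [NormedAddCommGroup H] [InnerProductSpace ℂ H] [CompleteSpace H] [Group G]
  {A B : NonUnitalStarSubalgebra ℂ (H →L[ℂ] H)} {U : G →* unitary (H →L[ℂ] H)}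

theorem crossedRep_eq_sum (hA : Normalizes A U) (x : AlgCrossedProduct (conjAction hA)) :
    crossedRep hA x = ∑ g ∈ x.coeff.support, (x.coeff g : H →L[ℂ] H) * (U g : H →L[ℂ] H) :=
  rfl

theorem crossedRep_mem (hA : Normalizes A U) (hAB : ∀ g, ∀ T ∈ A, T * (U g : H →L[ℂ] H) ∈ B)
    (x : AlgCrossedProduct (conjAction hA)) : crossedRep hA x ∈ B := by
  rw [crossedRep_eq_sum]
  exact sum_mem fun g _ => hAB g _ (x.coeff g).2

theorem exists_crossedRep_eq_sum (hA : Normalizes A U) (F : Finset G) {S : G → H →L[ℂ] H}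
    (hS : ∀ g ∈ F, S g ∈ A) : ∃ x, crossedRep hA x = ∑ g ∈ F, S g * (U g : H →L[ℂ] H) := by
  refine ⟨∑ g : F, AlgCrossedProduct.single _ (g : G) ⟨S g, hS g g.2⟩, ?_⟩
  rw [map_sum, ← Finset.sum_coe_sort F]
  exact Finset.sum_congr rfl fun g _ => crossedRep_single hA _ _

/-- A `*`-homomorphism induced by `crossedRep` descends to the quotients by the compact operators,
and it becomes injective if the coefficients of compact elements are compact. -/
theorem exists_quotHom (hA : Normalizes A U) (Ψ : AlgCrossedProduct (conjAction hA) →⋆ₙₐ[ℂ] B)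
    (hΨ : ∀ x, (Ψ x : H →L[ℂ] H) = crossedRep hA x)
    (hcoeff : ∀ x, IsCompactOperator (crossedRep hA x) →
      ∀ g, IsCompactOperator (x.coeff g : H →L[ℂ] H)) :
    ∃ Φ : AlgCrossedProduct (conjQuotAction hA) →⋆ₙₐ[ℂ] (compactIdeal B).Quot,
      (∀ x, Φ (crossedToQuot hA x) = (compactIdeal B).cls (Ψ x)) ∧ Function.Injective Φ := by
  let q := AlgCrossedProduct.toQuotHom (compactIdeal A) (compactIdeal_invariant hA)
  have hq : Function.Surjective q := AlgCrossedProduct.toQuotHom_surjective _ _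
  have hq0 : ∀ x, q x = 0 ↔ ∀ g, IsCompactOperator (x.coeff g : H →L[ℂ] H) :=
    AlgCrossedProduct.toQuot_eq_zero_iff _ _
  have hcls : ∀ x, (compactIdeal B).cls (Ψ x) = 0 ↔ IsCompactOperator (crossedRep hA x) := by
    intro x
    rw [StarIdeal.cls_eq_zero_iff, ← hΨ]
    rfl
  -- The kernel of `q` consists of the sums with compact coefficients, and such a sum is represented
  -- by a compact operator.
  obtain ⟨Φ, hΦ⟩ := exists_factor q hq ((compactIdeal B).clsHom.comp Ψ) fun x hx => by
    refine (hcls x).2 ?_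
    rw [crossedRep_eq_sum]
    exact isCompactOperator_sum _ fun g _ => ((hq0 x).1 hx g).mul_right _
  refine ⟨Φ, hΦ, (injective_iff_map_eq_zero Φ).2 fun y hy => ?_⟩
  obtain ⟨x, rfl⟩ := hq y
  rw [hΦ] at hy
  -- Injectivity is the converse: by `hcoeff`, a compact sum has compact coefficients.
  exact (hq0 x).2 (hcoeff x ((hcls x).1 hy))

end CrossedRep

/-! ### Quotients of Roe algebras by the compact operators -/

section RoeQuotient

variable {Y : Type*} [TopologicalSpace Y] [MeasurableSpace Y] [BorelSpace Y]
  [LocallyCompactSpace Y] [SigmaCompactSpace Y] (ν : Measure Y) (D : CompatibleMetric Y)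

instance : CompleteSpace (roeAlgebra ν D) :=
  (NonUnitalStarSubalgebra.isClosed_topologicalClosure (roeStarAlgebra ν D)).completeSpace_coe

instance : CompleteSpace (compactIdeal (roeAlgebra ν D)).Quot :=
  inferInstanceAs (CompleteSpace (roeAlgebra ν D ⧸ (compactIdeal (roeAlgebra ν D)).toSubmodule))

variable {ν D}

/-- The coefficients of a compact element of the crossed product are compact. -/
theorem isCompactOperator_coeff_of_crossedRep {Γ : Type*} [Group Γ] [MulAction Γ Y] [SigmaFinite ν]
    (hν : NonsingularAction Γ ν) (hD : D.LipschitzAction Γ) (hexp : D.ExpandsAtInfinity Γ)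
    (honl : HasONL ν D) {A : NonUnitalStarSubalgebra ℂ (BL2 ν)} (hA : Normalizes A (koopman hν))
    (hAD : ∀ T ∈ A, T ∈ roeAlgebra ν D) (x : AlgCrossedProduct (conjAction hA))
    (hx : IsCompactOperator (crossedRep hA x)) (g : Γ) :
    IsCompactOperator (x.coeff g : BL2 ν) := by
  by_cases hg : g ∈ x.coeff.support
  · rw [crossedRep_eq_sum] at hx
    exact isCompactOperator_coeff hν hD hexp honl (T := fun g => (x.coeff g : BL2 ν))
      (fun g _ => hAD _ (x.coeff g).2) hx hg
  · rw [Finsupp.notMem_support_iff.1 hg]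
    exact isCompactOperator_zero

/-- The quotient map is continuous and surjective, so it maps the dense Roe `*`-algebra onto a dense
set. -/
theorem dense_cls_of_roeStarAlgebra {s : Set (compactIdeal (roeAlgebra ν D)).Quot}
    (hs : ∀ T : roeAlgebra ν D, (T : BL2 ν) ∈ roeStarAlgebra ν D →
      (compactIdeal (roeAlgebra ν D)).cls T ∈ s) : Dense s := by
  have hcont : Continuous (compactIdeal (roeAlgebra ν D)).cls :=
    (compactIdeal (roeAlgebra ν D)).toSubmodule.mkQL.continuous
  have hd : Dense {T : roeAlgebra ν D | (T : BL2 ν) ∈ roeStarAlgebra ν D} := by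
    intro T
    rw [closure_subtype]
    refine closure_mono ?_ T.2
    intro S hS
    exact ⟨⟨S, subset_closure hS⟩, hS, rfl⟩
  refine ((compactIdeal (roeAlgebra ν D)).cls_surjective.denseRange.dense_image hcont hd).mono ?_
  rintro _ ⟨T, hT, rfl⟩
  exact hs T hT

end RoeQuotient

/-! ## Unified warped cones -/

/-- By freeness and compactness, `x ↦ dist x (g • x)` has a positive lower bound `ε` on `X`. At
height `t` the cone metric multiplies it by `t`, so the displacement exceeds `R` outside the compact
set `X × [1, R / ε]`. -/
theorem OpenCone.expandsAtInfinity {X Γ : Type*} [MetricSpace X] [CompactSpace X]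
    (hX : ∀ x y : X, dist x y ≤ 2) [Group Γ] [MulAction Γ X]
    (hL : ∀ g : Γ, ∃ K : ℝ≥0, LipschitzWith K fun x : X => g • x)
    (hfree : ∀ (g : Γ) (x : X), g • x = x → g = 1) :
    (OpenCone.metric hX).ExpandsAtInfinity Γ := by
  intro g hg R
  obtain ⟨ε, hε, hmin⟩ : ∃ ε > 0, ∀ x : X, ε ≤ dist x (g • x) := by
    obtain ⟨K, hK⟩ := hL g
    rcases isEmpty_or_nonempty X with hX0 | hX0
    · exact ⟨1, one_pos, fun x => hX0.elim x⟩
    · obtain ⟨x, -, hx⟩ := isCompact_univ.exists_isMinOn Set.univ_nonempty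
        (continuous_id.dist hK.continuous).continuousOn
      exact ⟨_, dist_pos.2 fun h => hg (hfree g x h.symm), fun y => hx (Set.mem_univ y)⟩
  have hc : IsCompact {t : Set.Ici (1 : ℝ) | (t : ℝ) ∈ Set.Icc 1 (R / ε)} :=
    isClosed_Ici.isClosedEmbedding_subtypeVal.isCompact_preimage isCompact_Icc
  refine ⟨Set.univ ×ˢ {t : Set.Ici (1 : ℝ) | (t : ℝ) ∈ Set.Icc 1 (R / ε)},
    isCompact_univ.prod hc, fun p hp => ?_⟩
  have hp1 : (1 : ℝ) ≤ p.2 := p.2.2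
  have hp2 : R / ε < p.2 := by
    by_contra! h
    exact hp ⟨Set.mem_univ _, hp1, h⟩
  rw [div_lt_iff₀ hε] at hp2
  change R < min (p.2 : ℝ) (p.2 : ℝ) * dist p.1 (g • p.1) + |(p.2 : ℝ) - (p.2 : ℝ)|
  rw [min_self, sub_self, abs_zero, add_zero]
  exact hp2.trans_le (mul_le_mul_of_nonneg_left (hmin p.1) (by linarith))

set_option maxHeartbeats 1000000 in
theorem mainTheorem8 {X Γ : Type*} [MetricSpace X] [CompactSpace X] [MeasurableSpace X]
    [BorelSpace X] (hX : ∀ x y : X, dist x y ≤ 2)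
    (μ : Measure X) [SigmaFinite μ] [μ.IsOpenPosMeasure]
    [Group Γ] [Countable Γ] [MulAction Γ X] (ℓ : ProperLength Γ)
    (hμ : NonsingularAction Γ μ)
    (hL : ∀ g : Γ, ∃ K : ℝ≥0, LipschitzWith K fun x : X => g • x)
    (hfree : ∀ (g : Γ) (x : X), g • x = x → g = 1)
    (hbg : (OpenCone.metric hX).BoundedGeometry)
    (honl : HasONL (OpenCone.measure μ) (OpenCone.metric hX)) :
    -- the Roe `*`-algebras
    (∃ Ψ : AlgCrossedProduct (conjAction (OpenCone.normalizes_roeStar hX hL hμ)) →⋆ₙₐ[ℂ]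
        OpenCone.warpedRoeStar μ hX ℓ,
      (∀ x, (Ψ x : BL2 (OpenCone.measure μ)) =
        crossedRep (OpenCone.normalizes_roeStar hX hL hμ) x) ∧
      Function.Surjective Ψ ∧
      ∃ Ψbar : AlgCrossedProduct (conjQuotAction (OpenCone.normalizes_roeStar hX hL hμ)) ≃⋆ₐ[ℂ]
          (compactIdeal (OpenCone.warpedRoeStar μ hX ℓ)).Quot,
        ∀ x, Ψbar (crossedToQuot (OpenCone.normalizes_roeStar hX hL hμ) x) =
          (compactIdeal (OpenCone.warpedRoeStar μ hX ℓ)).cls (Ψ x)) ∧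
    -- the compact operators lie in both Roe algebras
    (∀ T : BL2 (OpenCone.measure μ), IsCompactOperator T →
      T ∈ OpenCone.roe μ hX ∧ T ∈ OpenCone.warpedRoe μ hX ℓ) ∧
    -- the Roe algebras
    (∃ Ψ : AlgCrossedProduct (conjAction (OpenCone.normalizes_roe hX hL hμ)) →⋆ₙₐ[ℂ]
        OpenCone.warpedRoe μ hX ℓ,
      (∀ x, (Ψ x : BL2 (OpenCone.measure μ)) =
        crossedRep (OpenCone.normalizes_roe hX hL hμ) x) ∧
      ∃ Φ : AlgCrossedProduct (conjQuotAction (OpenCone.normalizes_roe hX hL hμ)) →⋆ₙₐ[ℂ]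
          (compactIdeal (OpenCone.warpedRoe μ hX ℓ)).Quot,
        (∀ x, Φ (crossedToQuot (OpenCone.normalizes_roe hX hL hμ) x) =
          (compactIdeal (OpenCone.warpedRoe μ hX ℓ)).cls (Ψ x)) ∧
        Function.Injective Φ ∧ DenseRange Φ ∧
        CompleteSpace (compactIdeal (OpenCone.warpedRoe μ hX ℓ)).Quot) := by
  have hD := OpenCone.lipschitzAction (Γ := Γ) hX hL
  have hν := OpenCone.nonsingularAction hμ
  have hexp := OpenCone.expandsAtInfinity hX hL hfree
  have hsub : ∀ T ∈ OpenCone.roeStar μ hX, T ∈ OpenCone.roe μ hX := fun T hT => subset_closure hT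
  have hN := OpenCone.normalizes_roeStar hX hL hμ
  have hN' := OpenCone.normalizes_roe hX hL hμ
  let Ψ : AlgCrossedProduct (conjAction hN) →⋆ₙₐ[ℂ] OpenCone.warpedRoeStar μ hX ℓ :=
    NonUnitalStarAlgHom.codRestrict (crossedRep hN) _
      (crossedRep_mem hN fun g _ hT => mul_koopman_mem_roeStarAlgebra_warped ℓ hν hD g hT)
  let Ψ' : AlgCrossedProduct (conjAction hN') →⋆ₙₐ[ℂ] OpenCone.warpedRoe μ hX ℓ :=
    NonUnitalStarAlgHom.codRestrict (crossedRep hN') _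
      (crossedRep_mem hN' fun g _ hT => mul_koopman_mem_roeAlgebra_warped ℓ hν hD g hT)
  have hsurj : Function.Surjective Ψ := by
    intro T
    obtain ⟨F, S, hS, hTS⟩ := exists_eq_sum_mul_koopman ℓ hν hD hbg T.2
    obtain ⟨x, hx⟩ := exists_crossedRep_eq_sum hN F hS
    exact ⟨x, Subtype.ext (hx.trans hTS.symm)⟩
  -- Both coefficient algebras lie in the Roe algebra of the cone, so one statement on compact
  -- coefficients gives injectivity for both quotients.
  obtain ⟨Φ, hΦ, hΦinj⟩ := exists_quotHom hN Ψ (fun _ => rfl)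
    (isCompactOperator_coeff_of_crossedRep hν hD hexp honl hN hsub)
  obtain ⟨Φ', hΦ', hΦinj'⟩ := exists_quotHom hN' Ψ' (fun _ => rfl)
    (isCompactOperator_coeff_of_crossedRep hν hD hexp honl hN' fun _ h => h)
  have hΦsurj : Function.Surjective Φ := by
    intro y
    obtain ⟨T, rfl⟩ := (compactIdeal (OpenCone.warpedRoeStar μ hX ℓ)).cls_surjective y
    obtain ⟨x, rfl⟩ := hsurj T
    exact ⟨_, hΦ x⟩
  refine ⟨⟨Ψ, fun _ => rfl, hsurj, StarAlgEquiv.ofBijective Φ ⟨hΦinj, hΦsurj⟩, hΦ⟩,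
    fun T hT => ⟨hT.mem_roeAlgebra _, hT.mem_roeAlgebra _⟩,
    ⟨Ψ', fun _ => rfl, Φ', hΦ', hΦinj', ?_, inferInstance⟩⟩
  -- For density it is enough to reach the classes of the warped Roe `*`-algebra. Its elements are
  -- finite sums whose coefficients lie in the Roe `*`-algebra of the cone, hence in its closure.
  refine dense_cls_of_roeStarAlgebra fun T hT => ?_
  obtain ⟨F, S, hS, hTS⟩ := exists_eq_sum_mul_koopman ℓ hν hD hbg hT
  obtain ⟨x, hx⟩ := exists_crossedRep_eq_sum hN' F fun g hg => hsub _ (hS g hg)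
  have hxT : Ψ' x = T := Subtype.ext (hx.trans hTS.symm)
  exact ⟨crossedToQuot hN' x, by rw [hΦ', hxT]⟩
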